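/- Let $k$ be an algebraically closed field of characteristic zero, let $G$ be a finite group with identity $e$, and let $\omega : G\times G\times G\to k^\times$ be a normalized 3-cocycle (for the trivial action of $G$ on $k^\times$). For $g\in G$ let $\omega_g$ be the restriction of $\omega$ to the cyclic subgroup $\langle g\rangle$, and let $e(\omega_g)$ be the order of the class of $\omega_g$ in $H^3(\langle g\rangle,k^\times)$. Let $D^\omega G$ be the twisted quantum double of $G$, i.e. the vector space $k^G\otimes kG$ with basis $e_g\# x$ ($g,x\in G$), with $$(e_g\# x)(e_h\# y)=\delta_{g,xhx^{-1}}\,\theta_g(x,y)\,e_g\# xy,\qquad \Delta(e_g\# x)=\sum_{st=g}\gamma_x(s,t)\,(e_s\# x)\otimes(e_t\# x),\qquad \epsilon(e_g\# x)=\delta_{g,e},$$ $$\theta_g(x,y)=\frac{\omega(g,x,y)\,\omega(x,y,(xy)^{-1}g(xy))}{\omega(x,x^{-1}gx,y)},\qquad \gamma_g(x,y)=\frac{\omega(x,y,g)\,\omega(g,g^{-1}xg,g^{-1}yg)}{\omega(x,g,g^{-1}yg)},$$ and with associator $\phi=\sum_{a,b,c}\omega(a,b,c)^{-1}e_a\otimes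 e_b\otimes e_c$ (where $e_a=e_a\# e$). The exponent $\exp D^\omega G$ is the exponent of the fusion category $\mathcal C$ of finite-dimensional $D^\omega G$-modules, that is, the smallest positive integer $N$ such that the $N$-th power of the double braiding $\beta_{Y,X}\beta_{X,Y}: X\otimes Y\to X\otimes Y$ is unipotent for all objects $X,Y$ of the Drinfeld center $\mathcal Z(\mathcal C)$. Consider the conditions (i) $e(\omega_g)$ divides the index $[G:\langle g\rangle]$ for every $g\in G$; (ii) $\exp D^\omega G$ divides $|G|$. Then (i) implies (ii). If $|G|$ is odd, then (i) and (ii) are equivalent. -/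

import Mathlib

open CategoryTheory MonoidalCategory
open scoped TensorProduct

universe u v w

noncomputable section

namespace TensorExponent

section Actions

variable {k : Type u} [Field k]
  {A : Type*} {B : Type*} {C : Type*} {D : Type*}
  [Ring A] [Algebra k A] [Ring B] [Algebra k B] [Ring C] [Algebra k C] [Ring D] [Algebra k D]
  {M : Type*} {N : Type*} {P : Type*} {Q : Type*}
  [AddCommGroup M] [Module k M] [AddCommGroup N] [Module k N]
  [AddCommGroup P] [Module k P] [AddCommGroup Q] [Module k Q]

/-- The action of `A ⊗ B` on `M ⊗ N`, where `A` acts on `M` and `B` acts on `N`. -/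
def tensorAction (f : A →ₐ[k] Module.End k M) (g : B →ₐ[k] Module.End k N) :
    A ⊗[k] B →ₐ[k] Module.End k (M ⊗[k] N) :=
  (Module.endTensorEndAlgHom (R := k) (S := k) (A := k) (M := M) (N := N)).comp
    (Algebra.TensorProduct.map f g)

@[simp]
theorem tensorAction_tmul (f : A →ₐ[k] Module.End k M) (g : B →ₐ[k] Module.End k N)
    (a : A) (b : B) : tensorAction f g (a ⊗ₜ b) = TensorProduct.map (f a) (g b) := rfl

theorem tensorAction_comp (f : A →ₐ[k] Module.End k M) (g : B →ₐ[k] Module.End k N)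
    (p : C →ₐ[k] A) (q : D →ₐ[k] B) (t : C ⊗[k] D) :
    tensorAction (f.comp p) (g.comp q) t =
      tensorAction f g (Algebra.TensorProduct.map p q t) := by
  induction t with
  | zero => simp
  | tmul a b => simp
  | add x y hx hy => simp only [map_add, hx, hy]

/-- The reassociation of a triple tensor product of vector spaces intertwines the actions. -/
theorem assoc_comp_tensorAction (f : A →ₐ[k] Module.End k M) (g : B →ₐ[k] Module.End k N)
    (h : C →ₐ[k] Module.End k P) (t : (A ⊗[k] B) ⊗[k] C) :
    (TensorProduct.assoc k M N P).toLinearMap ∘ₗ tensorAction (tensorAction f g) h t =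
      tensorAction f (tensorAction g h) (Algebra.TensorProduct.assoc k k k A B C t) ∘ₗ
        (TensorProduct.assoc k M N P).toLinearMap := by
  induction t with
  | zero => simp
  | add x y hx hy => simp only [map_add, LinearMap.comp_add, LinearMap.add_comp, hx, hy]
  | tmul t c =>
    induction t with
    | zero => simp
    | add x y hx hy =>
      simp only [TensorProduct.add_tmul, map_add, LinearMap.comp_add, LinearMap.add_comp, hx, hy]
    | tmul a b =>
      ext m n p
      simp

theorem tensorAction_intertwine {f : A →ₐ[k] Module.End k M} {g : B →ₐ[k] Module.End k N}
    {f' : C →ₐ[k] Module.End k P} {g' : D →ₐ[k] Module.End k Q}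
    (p : A →ₐ[k] C) (q : B →ₐ[k] D) {d : M →ₗ[k] P} {e : N →ₗ[k] Q}
    (hd : ∀ a, d ∘ₗ f a = f' (p a) ∘ₗ d) (he : ∀ b, e ∘ₗ g b = g' (q b) ∘ₗ e)
    (t : A ⊗[k] B) :
    TensorProduct.map d e ∘ₗ tensorAction f g t =
      tensorAction f' g' (Algebra.TensorProduct.map p q t) ∘ₗ TensorProduct.map d e := by
  induction t with
  | zero => simp
  | add x y hx hy => simp only [map_add, LinearMap.comp_add, LinearMap.add_comp, hx, hy]
  | tmul a b =>
    simp only [tensorAction_tmul, Algebra.TensorProduct.map_tmul, ← TensorProduct.map_comp, hd, he]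

end Actions

/-- A quasi-bialgebra over a field `k`: an algebra `H` with an algebra map
`Δ : H → H ⊗ H`, a counit `ε : H → k` and an invertible associator `φ ∈ H ⊗ H ⊗ H`. -/
class QuasiBialgebra (k : Type u) (H : Type v) [Field k] [Ring H] [Algebra k H] where
  comul : H →ₐ[k] H ⊗[k] H
  counit : H →ₐ[k] k
  associator : (H ⊗[k] (H ⊗[k] H))ˣ
  /-- `(ε ⊗ id) Δ(h) = h` -/
  counit_left (h : H) : Algebra.TensorProduct.lid k H
    (Algebra.TensorProduct.map counit (AlgHom.id k H) (comul h)) = h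
  /-- `(id ⊗ ε) Δ(h) = h` -/
  counit_right (h : H) : Algebra.TensorProduct.rid k k H
    (Algebra.TensorProduct.map (AlgHom.id k H) counit (comul h)) = h
  /-- `(id ⊗ Δ) Δ(h) · φ = φ · (Δ ⊗ id) Δ(h)` -/
  quasi_coassoc (h : H) :
    Algebra.TensorProduct.map (AlgHom.id k H) comul (comul h) * associator.val =
      associator.val * Algebra.TensorProduct.assoc k k k H H H
        (Algebra.TensorProduct.map comul (AlgHom.id k H) (comul h))
  /-- `(1 ⊗ φ) · (id ⊗ Δ ⊗ id)(φ) · (φ ⊗ 1) = (id ⊗ id ⊗ Δ)(φ) · (Δ ⊗ id ⊗ id)(φ)`,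
  where all factors are regarded as elements of `H ⊗ (H ⊗ (H ⊗ H))`. -/
  pentagon :
    (1 : H) ⊗ₜ[k] associator.val *
      Algebra.TensorProduct.map (AlgHom.id k H)
        (Algebra.TensorProduct.assoc k k k H H H).toAlgHom
        (Algebra.TensorProduct.map (AlgHom.id k H)
          (Algebra.TensorProduct.map comul (AlgHom.id k H)) associator.val) *
      Algebra.TensorProduct.map (AlgHom.id k H)
        (Algebra.TensorProduct.assoc k k k H H H).toAlgHom
        (Algebra.TensorProduct.assoc k k k H (H ⊗[k] H) H (associator.val ⊗ₜ[k] (1 : H))) =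
    Algebra.TensorProduct.map (AlgHom.id k H)
        (Algebra.TensorProduct.map (AlgHom.id k H) comul) associator.val *
      Algebra.TensorProduct.assoc k k k H H (H ⊗[k] H)
        (Algebra.TensorProduct.map comul (AlgHom.id k (H ⊗[k] H)) associator.val)
  /-- `(id ⊗ ε ⊗ id)(φ) = 1` -/
  counit_middle : Algebra.TensorProduct.map (AlgHom.id k H)
    ((Algebra.TensorProduct.lid k H).toAlgHom.comp
      (Algebra.TensorProduct.map counit (AlgHom.id k H))) associator.val = 1

section Coherence

open QuasiBialgebra

variable {k : Type u} {H : Type v} [Field k] [Ring H] [Algebra k H] [QuasiBialgebra k H]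
  {M : Type*} {N : Type*} {P : Type*} {Q : Type*}
  [AddCommGroup M] [Module k M] [AddCommGroup N] [Module k N]
  [AddCommGroup P] [Module k P] [AddCommGroup Q] [Module k Q]
  {M' : Type*} {N' : Type*} {P' : Type*}
  [AddCommGroup M'] [Module k M'] [AddCommGroup N'] [Module k N'] [AddCommGroup P'] [Module k P']

/-- The action of `H` on `M ⊗ N` through the comultiplication. -/
def tensorRep (f : H →ₐ[k] Module.End k M) (g : H →ₐ[k] Module.End k N) :
    H →ₐ[k] Module.End k (M ⊗[k] N) :=
  (tensorAction f g).comp comul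

/-- The action of `H` on `k` through the counit. -/
def unitRep : H →ₐ[k] Module.End k k :=
  (Algebra.lmul k k).comp counit

/-- The action of an invertible element as a linear bijection. -/
def unitAction {A : Type*} [Ring A] [Algebra k A] (f : A →ₐ[k] Module.End k M) (a : Aˣ) :
    M ≃ₗ[k] M :=
  LinearEquiv.ofLinearMap (f a.val) (f a.inv)
    (by rw [← Module.End.mul_eq_comp, ← map_mul, a.val_inv, map_one]; rfl)
    (by rw [← Module.End.mul_eq_comp, ← map_mul, a.inv_val, map_one]; rfl)

/-- The associativity constraint `(m ⊗ n) ⊗ p ↦ φ · (m ⊗ (n ⊗ p))`. -/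
def assocMap (f : H →ₐ[k] Module.End k M) (g : H →ₐ[k] Module.End k N)
    (h : H →ₐ[k] Module.End k P) : (M ⊗[k] N) ⊗[k] P ≃ₗ[k] M ⊗[k] (N ⊗[k] P) :=
  (TensorProduct.assoc k M N P).trans
    (unitAction (tensorAction f (tensorAction g h)) associator)

theorem assocMap_eq (f : H →ₐ[k] Module.End k M) (g : H →ₐ[k] Module.End k N)
    (h : H →ₐ[k] Module.End k P) : (assocMap f g h).toLinearMap =
    tensorAction f (tensorAction g h) (associator (k := k) (H := H)).val ∘ₗ
      (TensorProduct.assoc k M N P).toLinearMap := rfl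

theorem assocMap_comm (f : H →ₐ[k] Module.End k M) (g : H →ₐ[k] Module.End k N)
    (h : H →ₐ[k] Module.End k P) (x : H) :
    (assocMap f g h).toLinearMap ∘ₗ tensorRep (tensorRep f g) h x =
      tensorRep f (tensorRep g h) x ∘ₗ (assocMap f g h).toLinearMap := by
  have h1 : tensorRep (tensorRep f g) h x = tensorAction (tensorAction f g) h
      (Algebra.TensorProduct.map comul (AlgHom.id k H) (comul x)) :=
    tensorAction_comp _ h comul (AlgHom.id k H) _
  have h2 : tensorRep f (tensorRep g h) x = tensorAction f (tensorAction g h)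
      (Algebra.TensorProduct.map (AlgHom.id k H) comul (comul x)) :=
    tensorAction_comp f _ (AlgHom.id k H) comul _
  rw [h1, h2, assocMap_eq, LinearMap.comp_assoc, assoc_comp_tensorAction, ← LinearMap.comp_assoc,
    ← LinearMap.comp_assoc, ← Module.End.mul_eq_comp, ← Module.End.mul_eq_comp, ← map_mul,
    ← map_mul, quasi_coassoc]

theorem assocMap_naturality {f : H →ₐ[k] Module.End k M} {g : H →ₐ[k] Module.End k N}
    {h : H →ₐ[k] Module.End k P} {f' : H →ₐ[k] Module.End k M'} {g' : H →ₐ[k] Module.End k N'}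
    {h' : H →ₐ[k] Module.End k P'} (a : M →ₗ[k] M') (b : N →ₗ[k] N') (c : P →ₗ[k] P')
    (ha : ∀ x, a ∘ₗ f x = f' x ∘ₗ a) (hb : ∀ x, b ∘ₗ g x = g' x ∘ₗ b)
    (hc : ∀ x, c ∘ₗ h x = h' x ∘ₗ c) :
    (assocMap f' g' h').toLinearMap ∘ₗ TensorProduct.map (TensorProduct.map a b) c =
      TensorProduct.map a (TensorProduct.map b c) ∘ₗ (assocMap f g h).toLinearMap := by
  have h1 (t : H ⊗[k] H) := tensorAction_intertwine (AlgHom.id k H) (AlgHom.id k H) hb hc t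
  rw [Algebra.TensorProduct.map_id] at h1
  have h2 := tensorAction_intertwine (AlgHom.id k H) (AlgHom.id k (H ⊗[k] H)) ha h1
    (associator (k := k) (H := H)).val
  rw [Algebra.TensorProduct.map_id, AlgHom.id_apply] at h2
  rw [assocMap_eq, assocMap_eq, ← LinearMap.comp_assoc, h2, LinearMap.comp_assoc,
    LinearMap.comp_assoc]
  congr 1
  ext u v w
  rfl

theorem lid_comm (f : H →ₐ[k] Module.End k M) (x : H) :
    (TensorProduct.lid k M).toLinearMap ∘ₗ tensorRep unitRep f x =
      f x ∘ₗ (TensorProduct.lid k M).toLinearMap := by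
  have key (t : H ⊗[k] H) : (TensorProduct.lid k M).toLinearMap ∘ₗ tensorAction unitRep f t =
      f (Algebra.TensorProduct.lid k H
        (Algebra.TensorProduct.map counit (AlgHom.id k H) t)) ∘ₗ
          (TensorProduct.lid k M).toLinearMap := by
    induction t with
    | zero => simp
    | add x y hx hy => simp only [map_add, LinearMap.comp_add, LinearMap.add_comp, hx, hy]
    | tmul a b =>
      ext m
      simp [unitRep]
  change _ ∘ₗ tensorAction unitRep f (comul x) = _
  rw [key, counit_left]

theorem rid_comm (f : H →ₐ[k] Module.End k M) (x : H) :
    (TensorProduct.rid k M).toLinearMap ∘ₗ tensorRep f unitRep x =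
      f x ∘ₗ (TensorProduct.rid k M).toLinearMap := by
  have key (t : H ⊗[k] H) : (TensorProduct.rid k M).toLinearMap ∘ₗ tensorAction f unitRep t =
      f (Algebra.TensorProduct.rid k k H
        (Algebra.TensorProduct.map (AlgHom.id k H) counit t)) ∘ₗ
          (TensorProduct.rid k M).toLinearMap := by
    induction t with
    | zero => simp
    | add x y hx hy => simp only [map_add, LinearMap.comp_add, LinearMap.add_comp, hx, hy]
    | tmul a b =>
      ext m
      simp [unitRep]
  change _ ∘ₗ tensorAction f unitRep (comul x) = _
  rw [key, counit_right]

theorem assocMap_triangle (f : H →ₐ[k] Module.End k M) (g : H →ₐ[k] Module.End k N) :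
    TensorProduct.map LinearMap.id (TensorProduct.lid k N).toLinearMap ∘ₗ
        (assocMap f unitRep g).toLinearMap =
      TensorProduct.map (TensorProduct.rid k M).toLinearMap LinearMap.id := by
  have h1 (t : H ⊗[k] H) : (TensorProduct.lid k N).toLinearMap ∘ₗ tensorAction unitRep g t =
      g (((Algebra.TensorProduct.lid k H).toAlgHom.comp
        (Algebra.TensorProduct.map counit (AlgHom.id k H))) t) ∘ₗ
          (TensorProduct.lid k N).toLinearMap := by
    induction t with
    | zero => simp
    | add x y hx hy => simp only [map_add, LinearMap.comp_add, LinearMap.add_comp, hx, hy]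
    | tmul a b =>
      ext m
      simp [unitRep]
  have h2 := tensorAction_intertwine (f := f) (f' := f) (d := LinearMap.id) (AlgHom.id k H) _
    (fun _ => rfl) h1 (associator (k := k) (H := H)).val
  rw [counit_middle, map_one] at h2
  rw [assocMap_eq, ← LinearMap.comp_assoc, h2]
  ext m n
  simp

/-- The pentagon identity for the associativity constraints. -/
theorem assocMap_pentagon (e : H →ₐ[k] Module.End k Q) (f : H →ₐ[k] Module.End k M)
    (g : H →ₐ[k] Module.End k N) (h : H →ₐ[k] Module.End k P) :
    TensorProduct.map LinearMap.id (assocMap f g h).toLinearMap ∘ₗ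
        ((assocMap e (tensorRep f g) h).toLinearMap ∘ₗ
          TensorProduct.map (assocMap e f g).toLinearMap LinearMap.id) =
      (assocMap e f (tensorRep g h)).toLinearMap ∘ₗ
        (assocMap (tensorRep e f) g h).toLinearMap := by
  set φ : H ⊗[k] (H ⊗[k] H) := (associator (k := k) (H := H)).val with hφ
  set T := tensorAction e (tensorAction f (tensorAction g h)) with hT
  have l1 : TensorProduct.map LinearMap.id (assocMap f g h).toLinearMap =
      T ((1 : H) ⊗ₜ φ) ∘ₗ
        TensorProduct.map LinearMap.id (TensorProduct.assoc k M N P).toLinearMap := by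
    rw [hT, tensorAction_tmul, ← TensorProduct.map_comp, map_one, assocMap_eq]
    rfl
  have l2 : tensorAction e (tensorAction (tensorRep f g) h) φ =
      tensorAction e (tensorAction (tensorAction f g) h)
        (Algebra.TensorProduct.map (AlgHom.id k H)
          (Algebra.TensorProduct.map comul (AlgHom.id k H)) φ) := by
    rw [← tensorAction_comp]
    congr 2
    exact AlgHom.ext fun t =>
      tensorAction_comp (tensorAction f g) h comul (AlgHom.id k H) t
  have l3 (t) : TensorProduct.map LinearMap.id (TensorProduct.assoc k M N P).toLinearMap ∘ₗ
      tensorAction e (tensorAction (tensorAction f g) h) t =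
      T (Algebra.TensorProduct.map (AlgHom.id k H)
        (Algebra.TensorProduct.assoc k k k H H H).toAlgHom t) ∘ₗ
      TensorProduct.map LinearMap.id (TensorProduct.assoc k M N P).toLinearMap :=
    tensorAction_intertwine (AlgHom.id k H) (Algebra.TensorProduct.assoc k k k H H H).toAlgHom
      (fun _ => rfl) (fun b => assoc_comp_tensorAction f g h b) t
  have l4 : TensorProduct.map (assocMap e f g).toLinearMap (LinearMap.id (M := P)) =
      tensorAction (tensorAction e (tensorAction f g)) h (φ ⊗ₜ (1 : H)) ∘ₗ
        TensorProduct.map (TensorProduct.assoc k Q M N).toLinearMap LinearMap.id := by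
    rw [tensorAction_tmul, ← TensorProduct.map_comp, map_one, assocMap_eq]
    rfl
  have r1 : tensorAction e (tensorAction f (tensorRep g h)) φ =
      T (Algebra.TensorProduct.map (AlgHom.id k H)
        (Algebra.TensorProduct.map (AlgHom.id k H) comul) φ) := by
    rw [hT, ← tensorAction_comp]
    congr 2
    exact AlgHom.ext fun t =>
      tensorAction_comp f (tensorAction g h) (AlgHom.id k H) comul t
  have r2 : tensorAction (tensorRep e f) (tensorAction g h) φ =
      tensorAction (tensorAction e f) (tensorAction g h)
        (Algebra.TensorProduct.map comul (AlgHom.id k (H ⊗[k] H)) φ) :=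
    tensorAction_comp (tensorAction e f) (tensorAction g h) comul (AlgHom.id k (H ⊗[k] H)) φ
  have key : TensorProduct.map LinearMap.id (TensorProduct.assoc k M N P).toLinearMap ∘ₗ
      (TensorProduct.assoc k Q (M ⊗[k] N) P).toLinearMap ∘ₗ
        TensorProduct.map (TensorProduct.assoc k Q M N).toLinearMap LinearMap.id =
      (TensorProduct.assoc k Q M (N ⊗[k] P)).toLinearMap ∘ₗ
        (TensorProduct.assoc k (Q ⊗[k] M) N P).toLinearMap := by
    ext q m n p
    rfl
  have lhs : TensorProduct.map LinearMap.id (assocMap f g h).toLinearMap ∘ₗ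
        ((assocMap e (tensorRep f g) h).toLinearMap ∘ₗ
          TensorProduct.map (assocMap e f g).toLinearMap LinearMap.id) =
      T ((1 : H) ⊗ₜ φ * Algebra.TensorProduct.map (AlgHom.id k H)
        (Algebra.TensorProduct.assoc k k k H H H).toAlgHom
        (Algebra.TensorProduct.map (AlgHom.id k H)
          (Algebra.TensorProduct.map comul (AlgHom.id k H)) φ) *
      Algebra.TensorProduct.map (AlgHom.id k H)
        (Algebra.TensorProduct.assoc k k k H H H).toAlgHom
        (Algebra.TensorProduct.assoc k k k H (H ⊗[k] H) H (φ ⊗ₜ[k] (1 : H)))) ∘ₗ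
      TensorProduct.map LinearMap.id (TensorProduct.assoc k M N P).toLinearMap ∘ₗ
      (TensorProduct.assoc k Q (M ⊗[k] N) P).toLinearMap ∘ₗ
        TensorProduct.map (TensorProduct.assoc k Q M N).toLinearMap LinearMap.id := by
    rw [l1, l4, assocMap_eq, ← hφ, l2]
    simp only [LinearMap.comp_assoc, map_mul, Module.End.mul_eq_comp]
    congr 1
    rw [← LinearMap.comp_assoc, l3, LinearMap.comp_assoc]
    congr 1
    rw [← LinearMap.comp_assoc _ _ (TensorProduct.assoc k Q (M ⊗[k] N) P).toLinearMap,
      assoc_comp_tensorAction, LinearMap.comp_assoc, ← LinearMap.comp_assoc, l3,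
      LinearMap.comp_assoc]
  have rhs : (assocMap e f (tensorRep g h)).toLinearMap ∘ₗ
        (assocMap (tensorRep e f) g h).toLinearMap =
      T (Algebra.TensorProduct.map (AlgHom.id k H)
        (Algebra.TensorProduct.map (AlgHom.id k H) comul) φ *
      Algebra.TensorProduct.assoc k k k H H (H ⊗[k] H)
        (Algebra.TensorProduct.map comul (AlgHom.id k (H ⊗[k] H)) φ)) ∘ₗ
      (TensorProduct.assoc k Q M (N ⊗[k] P)).toLinearMap ∘ₗ
        (TensorProduct.assoc k (Q ⊗[k] M) N P).toLinearMap := by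
    rw [assocMap_eq, assocMap_eq, ← hφ, r1, r2]
    simp only [LinearMap.comp_assoc, map_mul, Module.End.mul_eq_comp]
    congr 1
    rw [← LinearMap.comp_assoc, assoc_comp_tensorAction, LinearMap.comp_assoc]
  rw [lhs, rhs, key, QuasiBialgebra.pentagon]

end Coherence

/-- A finite-dimensional representation of a `k`-algebra `H`. -/
structure FinRep (k : Type u) (H : Type v) [Field k] [Ring H] [Algebra k H] where
  carrier : Type u
  [addCommGroup : AddCommGroup carrier]
  [module : Module k carrier]
  [finiteDimensional : FiniteDimensional k carrier]
  action : H →ₐ[k] Module.End k carrier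

namespace FinRep

variable {k : Type u} {H : Type v} [Field k] [Ring H] [Algebra k H]

attribute [instance] FinRep.addCommGroup FinRep.module FinRep.finiteDimensional

/-- An `H`-linear map. -/
@[ext]
structure Hom (V W : FinRep k H) where
  toLin : V.carrier →ₗ[k] W.carrier
  comm (h : H) : toLin ∘ₗ V.action h = W.action h ∘ₗ toLin

instance : Category (FinRep k H) where
  Hom := Hom
  id V := ⟨LinearMap.id, fun _ => rfl⟩
  comp f g := ⟨g.toLin ∘ₗ f.toLin, fun h => by
    rw [LinearMap.comp_assoc, f.comm, ← LinearMap.comp_assoc, g.comm, LinearMap.comp_assoc]⟩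

@[ext]
theorem hom_ext {V W : FinRep k H} {f g : V ⟶ W} (h : f.toLin = g.toLin) : f = g :=
  Hom.ext h

@[simp]
theorem id_toLin (V : FinRep k H) : Hom.toLin (𝟙 V) = LinearMap.id := rfl

@[simp]
theorem comp_toLin {U V W : FinRep k H} (f : U ⟶ V) (g : V ⟶ W) :
    (f ≫ g).toLin = g.toLin ∘ₗ f.toLin := rfl

instance (V W : FinRep k H) : AddCommGroup (V ⟶ W) :=
  letI : Zero (V ⟶ W) := ⟨⟨0, fun _ => by simp⟩⟩
  letI : Add (V ⟶ W) := ⟨fun f g => ⟨f.toLin + g.toLin, fun h => by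
    rw [LinearMap.add_comp, LinearMap.comp_add, f.comm, g.comm]⟩⟩
  letI : Neg (V ⟶ W) := ⟨fun f => ⟨-f.toLin, fun h => by
    rw [LinearMap.neg_comp, LinearMap.comp_neg, f.comm]⟩⟩
  letI : Sub (V ⟶ W) := ⟨fun f g => ⟨f.toLin - g.toLin, fun h => by
    rw [LinearMap.sub_comp, LinearMap.comp_sub, f.comm, g.comm]⟩⟩
  letI : SMul ℕ (V ⟶ W) := ⟨fun n f => ⟨n • f.toLin, fun h => by
    rw [LinearMap.smul_comp, LinearMap.comp_smul, f.comm]⟩⟩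
  letI : SMul ℤ (V ⟶ W) := ⟨fun n f => ⟨n • f.toLin, fun h => by
    rw [LinearMap.smul_comp, LinearMap.comp_smul, f.comm]⟩⟩
  Function.Injective.addCommGroup (fun f : V ⟶ W => f.toLin) (fun _ _ h => hom_ext h)
    rfl (fun _ _ => rfl) (fun _ => rfl) (fun _ _ => rfl) (fun _ _ => rfl) (fun _ _ => rfl)

@[simp]
theorem add_toLin {V W : FinRep k H} (f g : V ⟶ W) : (f + g).toLin = f.toLin + g.toLin := rfl

@[simp]
theorem zero_toLin {V W : FinRep k H} : (0 : V ⟶ W).toLin = 0 := rfl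

@[simp]
theorem neg_toLin {V W : FinRep k H} (f : V ⟶ W) : (-f).toLin = -f.toLin := rfl

@[simp]
theorem sub_toLin {V W : FinRep k H} (f g : V ⟶ W) : (f - g).toLin = f.toLin - g.toLin := rfl

instance : Preadditive (FinRep k H) where
  add_comp _ _ _ f f' g := hom_ext (LinearMap.comp_add f.toLin f'.toLin g.toLin)
  comp_add _ _ _ f g g' := hom_ext (LinearMap.add_comp f.toLin g'.toLin g.toLin)

/-- An `H`-linear bijection is an isomorphism. -/
def mkIso {V W : FinRep k H} (e : V.carrier ≃ₗ[k] W.carrier)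
    (comm : ∀ h, e.toLinearMap ∘ₗ V.action h = W.action h ∘ₗ e.toLinearMap) : V ≅ W where
  hom := ⟨e.toLinearMap, comm⟩
  inv := ⟨e.symm.toLinearMap, fun h => by
    ext w
    obtain ⟨v, rfl⟩ := e.surjective w
    have := LinearMap.congr_fun (comm h) v
    simp only [LinearMap.comp_apply, LinearEquiv.coe_coe] at this ⊢
    rw [← this]; simp⟩
  hom_inv_id := by ext v; simp
  inv_hom_id := by ext v; simp

@[simp]
theorem mkIso_hom_toLin {V W : FinRep k H} (e : V.carrier ≃ₗ[k] W.carrier)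
    (comm : ∀ h, e.toLinearMap ∘ₗ V.action h = W.action h ∘ₗ e.toLinearMap) :
    (mkIso e comm).hom.toLin = e.toLinearMap := rfl

variable [QuasiBialgebra k H]

/-- The tensor product of two representations. -/
abbrev tensor (V W : FinRep k H) : FinRep k H where
  carrier := V.carrier ⊗[k] W.carrier
  action := tensorRep V.action W.action

/-- The unit representation. -/
abbrev unit : FinRep k H where
  carrier := k
  action := unitRep

/-- The tensor product of two `H`-linear maps. -/
def tensorMap {V V' W W' : FinRep k H} (f : V ⟶ V') (g : W ⟶ W') : tensor V W ⟶ tensor V' W' :=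
  ⟨TensorProduct.map f.toLin g.toLin, fun h => by
    have := tensorAction_intertwine (AlgHom.id k H) (AlgHom.id k H)
      (f := V.action) (g := W.action) (f' := V'.action) (g' := W'.action) f.comm g.comm
      (QuasiBialgebra.comul h)
    rwa [Algebra.TensorProduct.map_id] at this⟩

/-- The monoidal category of finite-dimensional representations of a quasi-bialgebra; the
associativity is given by the action of the associator `φ`. -/
instance : MonoidalCategory (FinRep k H) where
  tensorObj := tensor
  whiskerLeft X _ _ f := tensorMap (𝟙 X) f
  whiskerRight f Y := tensorMap f (𝟙 Y)
  tensorHom f g := tensorMap f g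
  tensorUnit := unit
  associator U V W := mkIso (assocMap U.action V.action W.action)
    (assocMap_comm U.action V.action W.action)
  leftUnitor V := mkIso (TensorProduct.lid k V.carrier) (lid_comm V.action)
  rightUnitor V := mkIso (TensorProduct.rid k V.carrier) (rid_comm V.action)
  tensorHom_def f g := hom_ext (by
    change TensorProduct.map _ _ = TensorProduct.map _ _ ∘ₗ TensorProduct.map _ _
    rw [← TensorProduct.map_comp]
    rfl)
  id_tensorHom_id _ _ := hom_ext TensorProduct.map_id
  whiskerLeft_id _ _ := hom_ext TensorProduct.map_id
  id_whiskerRight _ _ := hom_ext TensorProduct.map_id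
  tensorHom_comp_tensorHom _ _ _ _ := hom_ext (TensorProduct.map_comp _ _ _ _).symm
  associator_naturality f g h := hom_ext
    (assocMap_naturality f.toLin g.toLin h.toLin f.comm g.comm h.comm)
  leftUnitor_naturality f := hom_ext (TensorProduct.ext' fun c v => (map_smul f.toLin c v).symm)
  rightUnitor_naturality f := hom_ext (TensorProduct.ext' fun v c => (map_smul f.toLin c v).symm)
  pentagon W X Y Z := hom_ext
    (assocMap_pentagon W.action X.action Y.action Z.action)
  triangle X Y := hom_ext (assocMap_triangle X.action Y.action)

end FinRep

section Exponent

variable {C : Type u} [Category.{v} C] [MonoidalCategory C]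

/-- The double braiding `β² : X ⊗ Y → Y ⊗ X → X ⊗ Y` of two objects of the Drinfeld center of
`C`, as an endomorphism of the underlying object of `C`. -/
def doubleBraiding (X Y : Center C) : End (X.1 ⊗ Y.1) :=
  Center.Hom.f ((β_ X Y).hom ≫ (β_ Y X).hom)

theorem doubleBraiding_eq (X Y : Center C) :
    doubleBraiding X Y = (X.2.β Y.1).hom ≫ (Y.2.β X.1).hom := rfl

variable (C) [Preadditive C]

/-- The exponent of a fusion category `C`: the smallest positive integer `N` such that the `N`-th
power of the double braiding of the Drinfeld center of `C` is unipotent. -/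
def exponent : ℕ :=
  sInf {N : ℕ | 0 < N ∧ ∀ X Y : Center C, IsNilpotent (doubleBraiding X Y ^ N - 1)}

end Exponent

section Cohomology

variable (G : Type v) (M : Type w) [Group G] [CommGroup M]

/-- The group `Z³(G, M)` of 3-cocycles, for the trivial action of `G` on `M`. -/
def threeCocycles : Subgroup (G → G → G → M) where
  carrier := {ω | ∀ a b c d,
    ω b c d * ω a (b * c) d * ω a b c = ω (a * b) c d * ω a b (c * d)}
  one_mem' := by intro a b c d; simp
  mul_mem' := by
    intro f g hf hg a b c d
    have := congrArg₂ (· * ·) (hf a b c d) (hg a b c d)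
    simp only [Pi.mul_apply] at this ⊢
    rw [mul_mul_mul_comm (f (a * b) c d), ← this]
    simp only [mul_assoc, mul_left_comm]
  inv_mem' := by
    intro f hf a b c d
    have := congrArg (·⁻¹) (hf a b c d)
    simpa only [Pi.inv_apply, mul_inv] using this

/-- The coboundary of a 2-cochain, `df(x, y, z) = f(xy, z) f(x, y) f(x, yz)⁻¹ f(y, z)⁻¹`. -/
def coboundaryMap : (G → G → M) →* (G → G → G → M) where
  toFun f x y z := f (x * y) z * f x y * (f x (y * z))⁻¹ * (f y z)⁻¹
  map_one' := by ext; simp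
  map_mul' f g := by
    ext x y z
    simp only [Pi.mul_apply, mul_inv]
    simp only [mul_assoc, mul_left_comm]

/-- The group `B³(G, M)` of 3-coboundaries. -/
def threeCoboundaries : Subgroup (G → G → G → M) := (coboundaryMap G M).range

theorem threeCoboundaries_le : threeCoboundaries G M ≤ threeCocycles G M := by
  rintro _ ⟨f, rfl⟩ a b c d
  simp only [coboundaryMap, MonoidHom.coe_mk, OneHom.coe_mk, mul_assoc]
  apply Additive.ofMul.injective
  simp only [ofMul_mul, ofMul_inv]
  abel

/-- The cohomology group `H³(G, M) = Z³(G, M) / B³(G, M)`. -/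
abbrev ThirdCohomology : Type _ :=
  threeCocycles G M ⧸ (threeCoboundaries G M).subgroupOf (threeCocycles G M)

variable {G M}

/-- The order `e(ω)` of the class of the 3-cocycle `ω` in `H³(G, M)`. -/
def cohomologicalOrder (ω : threeCocycles G M) : ℕ :=
  orderOf (QuotientGroup.mk ω : ThirdCohomology G M)

/-- The restriction of a 3-cocycle to a subgroup. -/
def restrictCocycle (ω : threeCocycles G M) (S : Subgroup G) : threeCocycles S M :=
  ⟨fun a b c => ω.val a b c, fun a b c d => ω.property a b c d⟩

variable (G M)

/-- A normalized 3-cocycle: it takes the value `1` as soon as one argument is the identity. -/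
structure NormalizedThreeCocycle where
  toCocycle : threeCocycles G M
  map_one_left (b c : G) : toCocycle.val 1 b c = 1
  map_one_middle (a c : G) : toCocycle.val a 1 c = 1
  map_one_right (a b : G) : toCocycle.val a b 1 = 1

instance : CoeFun (NormalizedThreeCocycle G M) (fun _ => G → G → G → M) :=
  ⟨fun ω => ω.toCocycle.val⟩

end Cohomology

section Cochains

variable {G : Type v} {M : Type w} [Group G] [CommGroup M] (ω : NormalizedThreeCocycle G M)

theorem cocycle_add (a b c d : G) :
    Additive.ofMul (ω b c d) + Additive.ofMul (ω a (b * c) d) + Additive.ofMul (ω a b c) =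
      Additive.ofMul (ω (a * b) c d) + Additive.ofMul (ω a b (c * d)) :=
  congrArg Additive.ofMul (ω.toCocycle.property a b c d)

/-- `θ_g(x, y) = ω(g, x, y) ω(x, y, (xy)⁻¹ g (xy)) / ω(x, x⁻¹ g x, y)` -/
def theta (g x y : G) : M :=
  ω g x y * ω x y ((x * y)⁻¹ * g * (x * y)) / ω x (x⁻¹ * g * x) y

/-- `γ_g(x, y) = ω(x, y, g) ω(g, g⁻¹ x g, g⁻¹ y g) / ω(x, g, g⁻¹ y g)` -/
def gamma (g x y : G) : M :=
  ω x y g * ω g (g⁻¹ * x * g) (g⁻¹ * y * g) / ω x g (g⁻¹ * y * g)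

@[simp]
theorem theta_one_left (g y : G) : theta ω g 1 y = 1 := by
  simp [theta, ω.map_one_left, ω.map_one_middle]

@[simp]
theorem theta_one_right (g x : G) : theta ω g x 1 = 1 := by
  simp [theta, ω.map_one_middle, ω.map_one_right]

@[simp]
theorem theta_one_base (x y : G) : theta ω 1 x y = 1 := by
  simp [theta, ω.map_one_left, ω.map_one_middle, ω.map_one_right]

@[simp]
theorem gamma_one_base (x y : G) : gamma ω 1 x y = 1 := by
  simp [gamma, ω.map_one_left, ω.map_one_middle, ω.map_one_right]

@[simp]
theorem gamma_one_left (g y : G) : gamma ω g 1 y = 1 := by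
  simp [gamma, ω.map_one_left, ω.map_one_middle]

@[simp]
theorem gamma_one_right (g x : G) : gamma ω g x 1 = 1 := by
  simp [gamma, ω.map_one_middle, ω.map_one_right]

theorem theta_mul (g x y z : G) :
    theta ω g x y * theta ω g (x * y) z =
      theta ω (x⁻¹ * g * x) y z * theta ω g x (y * z) := by
  have h1 := cocycle_add ω g x y z
  have h2 := cocycle_add ω x (x⁻¹ * g * x) y z
  have h3 := cocycle_add ω x y ((x * y)⁻¹ * g * (x * y)) z
  have h4 := cocycle_add ω x y z ((x * y * z)⁻¹ * g * (x * y * z))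
  apply Additive.ofMul.injective
  simp only [theta, ofMul_mul, ofMul_div]
  simp only [mul_assoc, mul_inv_rev, mul_inv_cancel_left] at *
  linear_combination (norm := module) h1 - h2 + h3 - h4

theorem gamma_mul (x a b c : G) :
    gamma ω x a (b * c) * gamma ω x b c * ω a b c =
      ω (x⁻¹ * a * x) (x⁻¹ * b * x) (x⁻¹ * c * x) * (gamma ω x (a * b) c * gamma ω x a b) := by
  have h1 := cocycle_add ω a b c x
  have h2 := cocycle_add ω a b x (x⁻¹ * c * x)
  have h3 := cocycle_add ω a x (x⁻¹ * b * x) (x⁻¹ * c * x)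
  have h4 := cocycle_add ω x (x⁻¹ * a * x) (x⁻¹ * b * x) (x⁻¹ * c * x)
  apply Additive.ofMul.injective
  simp only [gamma, ofMul_mul, ofMul_div]
  simp only [mul_assoc, mul_inv_cancel_left] at *
  linear_combination (norm := module) h1 - h2 + h3 - h4

theorem theta_gamma (g h x y : G) :
    theta ω g x y * theta ω h x y * (gamma ω x g h * gamma ω y (x⁻¹ * g * x) (x⁻¹ * h * x)) =
      gamma ω (x * y) g h * theta ω (g * h) x y := by
  have h1 := cocycle_add ω g h x y
  have h2 := cocycle_add ω g x (x⁻¹ * h * x) y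
  have h3 := cocycle_add ω g x y ((x * y)⁻¹ * h * (x * y))
  have h4 := cocycle_add ω x (x⁻¹ * g * x) (x⁻¹ * h * x) y
  have h5 := cocycle_add ω x (x⁻¹ * g * x) y ((x * y)⁻¹ * h * (x * y))
  have h6 := cocycle_add ω x y ((x * y)⁻¹ * g * (x * y)) ((x * y)⁻¹ * h * (x * y))
  apply Additive.ofMul.injective
  simp only [theta, gamma, ofMul_mul, ofMul_div]
  simp only [mul_assoc, mul_inv_rev, mul_inv_cancel_left] at *
  linear_combination (norm := module) h1 - h2 + h3 + h4 - h5 + h6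

end Cochains

section TwistedDouble

variable {k : Type u} [Field k] {G : Type v} [Group G]

/-- The underlying vector space `k^G ⊗ kG` of the twisted quantum double `D^ω G`; the element
`∑ f(g, x) e_g # x` is represented by its coefficient function `f`. -/
def TwistedDouble (_ω : NormalizedThreeCocycle G kˣ) : Type (max u v) := G × G → k

namespace TwistedDouble

/-- Reindexing a double sum over `g = st`. -/
theorem sum_reindex [Fintype G] {V : Type*} [AddCommMonoid V] (F : G → G → V) :
    ∑ g : G, ∑ s : G, F s (s⁻¹ * g) = ∑ s : G, ∑ t : G, F s t := by
  rw [Finset.sum_comm]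
  refine Finset.sum_congr rfl fun s _ => ?_
  rw [← Equiv.sum_comp (Equiv.mulLeft s)]
  simp

variable {ω : NormalizedThreeCocycle G kˣ}

@[ext]
theorem ext {a b : TwistedDouble ω} (h : ∀ p : G × G, a p = b p) : a = b := funext h

section Multiplication

variable [Fintype G]

/-- The multiplication, that is the bilinear map with
`(e_g # x)(e_h # y) = δ_{g, x h x⁻¹} θ_g(x, y) e_g # xy`; see `basisElt_mul`. -/
instance : Mul (TwistedDouble ω) :=
  ⟨fun a b p => ∑ x : G, a (p.1, x) * b (x⁻¹ * p.1 * x, x⁻¹ * p.2) * theta ω p.1 x (x⁻¹ * p.2)⟩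

theorem mul_apply (a b : TwistedDouble ω) (g z : G) : (a * b) (g, z) =
    ∑ x : G, a (g, x) * b (x⁻¹ * g * x, x⁻¹ * z) * theta ω g x (x⁻¹ * z) := rfl

end Multiplication

variable [DecidableEq G]

instance : One (TwistedDouble ω) := ⟨fun p => if p.2 = 1 then 1 else 0⟩

theorem one_apply (g z : G) : (1 : TwistedDouble ω) (g, z) = if z = 1 then 1 else 0 := rfl

/-- The basis element `e_g # x`. -/
def basisElt (ω : NormalizedThreeCocycle G kˣ) (g x : G) : TwistedDouble ω :=
  fun p => if p = (g, x) then 1 else 0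

theorem basisElt_apply (g x h y : G) :
    basisElt ω g x (h, y) = if h = g ∧ y = x then 1 else 0 := by
  simp [basisElt, Prod.ext_iff]

variable [Fintype G]

instance : Ring (TwistedDouble ω) where
  __ := (inferInstanceAs (AddCommGroup (G × G → k)) : AddCommGroup (TwistedDouble ω))
  left_distrib a b c := by
    ext ⟨g, z⟩
    change ∑ x, a (g, x) * (b (x⁻¹ * g * x, x⁻¹ * z) + c (x⁻¹ * g * x, x⁻¹ * z)) * _ =
      (∑ x, _) + ∑ x, _
    simp only [mul_add, add_mul, Finset.sum_add_distrib]
  right_distrib a b c := by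
    ext ⟨g, z⟩
    change ∑ x, (a (g, x) + b (g, x)) * c (x⁻¹ * g * x, x⁻¹ * z) * _ = (∑ x, _) + ∑ x, _
    simp only [add_mul, Finset.sum_add_distrib]
  zero_mul a := by
    ext ⟨g, z⟩
    exact Finset.sum_eq_zero fun x _ => by
      change (0 : k) * _ * _ = 0
      simp
  mul_zero a := by
    ext ⟨g, z⟩
    exact Finset.sum_eq_zero fun x _ => by
      change _ * (0 : k) * _ = 0
      simp
  mul_assoc a b c := by
    ext ⟨g, z⟩
    simp only [mul_apply, Finset.sum_mul, Finset.mul_sum]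
    rw [Finset.sum_comm]
    refine Finset.sum_congr rfl fun x _ => ?_
    rw [← Equiv.sum_comp (Equiv.mulLeft x)]
    refine Finset.sum_congr rfl fun y _ => ?_
    have h := congrArg (Units.val (α := k)) (theta_mul ω g x y (y⁻¹ * x⁻¹ * z))
    simp only [Units.val_mul] at h
    simp only [Equiv.coe_mulLeft, mul_inv_rev, inv_mul_cancel_left, mul_assoc] at h ⊢
    simp only [mul_inv_cancel_left] at h
    linear_combination (a (g, x) * b (x⁻¹ * (g * x), y) *
      c (y⁻¹ * (x⁻¹ * (g * (x * y))), y⁻¹ * (x⁻¹ * z))) * h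
  one_mul a := by
    ext ⟨g, z⟩
    simp [mul_apply, one_apply]
  mul_one a := by
    ext ⟨g, z⟩
    rw [mul_apply, Finset.sum_eq_single z]
    · simp [one_apply]
    · intro x _ hx
      have : x⁻¹ * z ≠ 1 := fun h => hx (inv_mul_eq_one.mp h)
      simp [one_apply, this]
    · simp


instance : Algebra k (TwistedDouble ω) :=
  letI : Module k (TwistedDouble ω) :=
    { (inferInstance : Module k (G × G → k)) with }
  Algebra.ofModule
    (fun c a b => by
      ext ⟨g, z⟩
      change ∑ x, (c * a (g, x)) * b (x⁻¹ * g * x, x⁻¹ * z) * _ = c * ∑ x, _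
      simp only [Finset.mul_sum, mul_assoc])
    (fun c a b => by
      ext ⟨g, z⟩
      change ∑ x, a (g, x) * (c * b (x⁻¹ * g * x, x⁻¹ * z)) * _ = c * ∑ x, _
      rw [Finset.mul_sum]
      exact Finset.sum_congr rfl fun x _ => by
        change _ = c * (a (g, x) * b (x⁻¹ * g * x, x⁻¹ * z) * _)
        ring)

@[simp]
theorem add_apply (a b : TwistedDouble ω) (p : G × G) : (a + b) p = a p + b p := rfl

@[simp]
theorem zero_apply (p : G × G) : (0 : TwistedDouble ω) p = 0 := rfl

@[simp]
theorem smul_apply (c : k) (a : TwistedDouble ω) (p : G × G) : (c • a) p = c * a p := rfl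

theorem basisElt_mul (g x h y : G) : basisElt ω g x * basisElt ω h y =
    if g = x * h * x⁻¹ then ((theta ω g x y : kˣ) : k) • basisElt ω g (x * y) else 0 := by
  ext ⟨g', z⟩
  rw [mul_apply, Finset.sum_eq_single x]
  · have e1 : x⁻¹ * g' * x = h ↔ g' = x * h * x⁻¹ := by
      constructor
      · rintro rfl; group
      · rintro rfl; group
    have e2 : x⁻¹ * z = y ↔ z = x * y := inv_mul_eq_iff_eq_mul
    simp only [basisElt_apply, e1, e2]
    by_cases h1 : g' = g
    · subst h1
      by_cases h2 : g' = x * h * x⁻¹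
      · by_cases h3 : z = x * y
        · subst h3; simp [← h2, basisElt_apply]
        · simp [← h2, h3, basisElt_apply]
      · simp [h2]
    · by_cases h2 : g = x * h * x⁻¹
      · simp [h1, ← h2, basisElt_apply]
      · simp [h1, h2]
  · intro x' _ hx'
    simp [basisElt_apply, hx']
  · simp

theorem eq_sum_basisElt (a : TwistedDouble ω) : a = ∑ p : G × G, a p • basisElt ω p.1 p.2 := by
  ext q
  have (s : Finset (G × G)) : (∑ p ∈ s, a p • basisElt ω p.1 p.2) q =
      ∑ p ∈ s, a p * (if q = p then 1 else 0) := by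
    induction s using Finset.induction_on with
    | empty => simp
    | insert p s hp ih => rw [Finset.sum_insert hp, Finset.sum_insert hp, add_apply, ih]; rfl
  rw [this, Finset.sum_eq_single q]
  · simp
  · intro p _ hp
    simp [hp.symm]
  · simp

theorem one_eq : (1 : TwistedDouble ω) = ∑ g : G, basisElt ω g 1 := by
  rw [eq_sum_basisElt (1 : TwistedDouble ω), Fintype.sum_prod_type]
  refine Finset.sum_congr rfl fun g _ => ?_
  rw [Finset.sum_eq_single 1]
  · simp [one_apply]
  · intro x _ hx; simp [one_apply, hx]
  · simp

/-- Two linear maps which agree on the elements `e_g # x` are equal. -/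
theorem linearMap_ext {V : Type*} [AddCommGroup V] [Module k V] {f f' : TwistedDouble ω →ₗ[k] V}
    (h : ∀ g x, f (basisElt ω g x) = f' (basisElt ω g x)) : f = f' := by
  ext a
  rw [eq_sum_basisElt a]
  simp [h]

/-- The linear map with prescribed values on the basis `e_g # x`. -/
def lift {V : Type*} [AddCommGroup V] [Module k V] (F : G → G → V) : TwistedDouble ω →ₗ[k] V where
  toFun a := ∑ p : G × G, a p • F p.1 p.2
  map_add' a b := by simp [add_smul, Finset.sum_add_distrib]
  map_smul' c a := by simp [Finset.smul_sum, mul_smul]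

@[simp]
theorem lift_basisElt {V : Type*} [AddCommGroup V] [Module k V] (F : G → G → V) (g x : G) :
    lift F (basisElt ω g x) = F g x := by
  simp [lift, basisElt]

/-- Multiplicativity of a linear map may be checked on the elements `e_g # x`. -/
theorem map_mul_of_basisElt {A : Type*} [Ring A] [Algebra k A] (f : TwistedDouble ω →ₗ[k] A)
    (h : ∀ g x g' x', f (basisElt ω g x * basisElt ω g' x') =
      f (basisElt ω g x) * f (basisElt ω g' x')) (a b : TwistedDouble ω) :
    f (a * b) = f a * f b := by
  rw [eq_sum_basisElt a, eq_sum_basisElt b]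
  simp only [Finset.sum_mul, Finset.mul_sum, map_sum, smul_mul_assoc, mul_smul_comm, map_smul, h]

/-- `Δ(e_g # x) = ∑_{st = g} γ_x(s, t) (e_s # x) ⊗ (e_t # x)`, as a linear map. -/
def comulLin : TwistedDouble ω →ₗ[k] TwistedDouble ω ⊗[k] TwistedDouble ω :=
  lift fun g x => ∑ s : G, ((gamma ω x s (s⁻¹ * g) : kˣ) : k) •
    (basisElt ω s x ⊗ₜ[k] basisElt ω (s⁻¹ * g) x)

theorem comulLin_basisElt (g x : G) : comulLin (basisElt ω g x) =
    ∑ s : G, ((gamma ω x s (s⁻¹ * g) : kˣ) : k) • (basisElt ω s x ⊗ₜ[k] basisElt ω (s⁻¹ * g) x) :=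
  lift_basisElt _ g x

/-- `ε(e_g # x) = δ_{g, 1}`, as a linear map. -/
def counitLin : TwistedDouble ω →ₗ[k] k :=
  lift fun g _ => if g = 1 then 1 else 0

theorem counitLin_basisElt (g x : G) :
    counitLin (basisElt ω g x) = if g = 1 then 1 else 0 :=
  lift_basisElt _ g x

/-- The counit as an algebra map. -/
def counitHom (ω : NormalizedThreeCocycle G kˣ) : TwistedDouble ω →ₐ[k] k :=
  AlgHom.ofLinearMap counitLin
    (by rw [one_eq]; simp [counitLin_basisElt])
    (map_mul_of_basisElt _ fun g x h y => by
      rw [basisElt_mul, counitLin_basisElt, counitLin_basisElt]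
      by_cases h1 : g = x * h * x⁻¹
      · rw [if_pos h1, map_smul, counitLin_basisElt]
        by_cases h2 : h = 1
        · subst h2
          have : g = 1 := by simpa using h1
          simp [this]
        · have : g ≠ 1 := by
            rintro rfl
            apply h2
            have := h1.symm
            rwa [mul_inv_eq_one, mul_eq_left] at this
          simp [this]
      · rw [if_neg h1, map_zero]
        by_cases h2 : h = 1
        · subst h2
          have : g ≠ 1 := by simpa using h1
          simp [this]
        · simp [h2])

/-- The comultiplication as an algebra map. -/
def comulHom (ω : NormalizedThreeCocycle G kˣ) :
    TwistedDouble ω →ₐ[k] TwistedDouble ω ⊗[k] TwistedDouble ω :=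
  AlgHom.ofLinearMap comulLin
    (by
      rw [one_eq, map_sum]
      simp only [comulLin_basisElt, gamma_one_base, Units.val_one, one_smul]
      rw [sum_reindex (fun s t => basisElt ω s 1 ⊗ₜ[k] basisElt ω t 1),
        Algebra.TensorProduct.one_def, one_eq, TensorProduct.sum_tmul]
      simp only [TensorProduct.tmul_sum])
    (map_mul_of_basisElt _ fun g x h y => by
      rw [comulLin_basisElt, comulLin_basisElt, Finset.sum_mul_sum]
      have step (s : G) : ∑ t : G,
          (((gamma ω x s (s⁻¹ * g) : kˣ) : k) • (basisElt ω s x ⊗ₜ[k] basisElt ω (s⁻¹ * g) x)) *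
          (((gamma ω y t (t⁻¹ * h) : kˣ) : k) • (basisElt ω t y ⊗ₜ[k] basisElt ω (t⁻¹ * h) y)) =
          if g = x * h * x⁻¹ then ((theta ω g x y : kˣ) : k) • ((gamma ω (x * y) s (s⁻¹ * g) : kˣ) : k) •
            (basisElt ω s (x * y) ⊗ₜ[k] basisElt ω (s⁻¹ * g) (x * y)) else 0 := by
        rw [Finset.sum_eq_single (x⁻¹ * s * x)]
        · simp only [smul_mul_smul_comm, Algebra.TensorProduct.tmul_mul_tmul, basisElt_mul]
          rw [if_pos (by group)]
          by_cases h1 : g = x * h * x⁻¹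
          · rw [if_pos h1, if_pos (by rw [h1]; group)]
            have e : (x⁻¹ * s * x)⁻¹ * h = x⁻¹ * (s⁻¹ * g) * x := by rw [h1]; group
            have key := congrArg (Units.val (α := k)) (theta_gamma ω s (s⁻¹ * g) x y)
            rw [e]
            simp only [Units.val_mul, mul_inv_cancel_left] at key
            rw [TensorProduct.smul_tmul_smul, smul_smul, smul_smul]
            congr 1
            linear_combination key
          · rw [if_neg h1, if_neg, TensorProduct.tmul_zero, smul_zero]
            intro h2
            apply h1
            have := congrArg (s * ·) h2
            simp only [mul_inv_cancel_left] at this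
            rw [this]; group
        · intro t _ ht
          rw [smul_mul_smul_comm, Algebra.TensorProduct.tmul_mul_tmul, basisElt_mul, if_neg,
            TensorProduct.zero_tmul, smul_zero]
          rintro rfl
          apply ht
          group
        · simp
      simp only [step]
      rw [basisElt_mul]
      by_cases h1 : g = x * h * x⁻¹
      · simp only [if_pos h1, map_smul, comulLin_basisElt, Finset.smul_sum]
      · simp only [if_neg h1, map_zero, Finset.sum_const_zero])

theorem comulHom_basisElt (g x : G) : comulHom ω (basisElt ω g x) =
    ∑ s : G, ((gamma ω x s (s⁻¹ * g) : kˣ) : k) • (basisElt ω s x ⊗ₜ[k] basisElt ω (s⁻¹ * g) x) :=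
  comulLin_basisElt g x

theorem counitHom_basisElt (g x : G) :
    counitHom ω (basisElt ω g x) = if g = 1 then 1 else 0 :=
  counitLin_basisElt g x

theorem comulHom_idem (g : G) : comulHom ω (basisElt ω g 1) =
    ∑ s : G, basisElt ω s 1 ⊗ₜ[k] basisElt ω (s⁻¹ * g) 1 := by
  simp [comulHom_basisElt]

theorem idem_mul_basisElt (a g x : G) : basisElt ω a 1 * basisElt ω g x =
    if a = g then basisElt ω g x else 0 := by
  rw [basisElt_mul]
  simp only [one_mul, inv_one, mul_one, theta_one_left, Units.val_one, one_smul]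
  split_ifs with h
  · rw [h]
  · rfl

theorem basisElt_mul_idem (g x a : G) : basisElt ω g x * basisElt ω a 1 =
    if a = x⁻¹ * g * x then basisElt ω g x else 0 := by
  rw [basisElt_mul]
  have : g = x * a * x⁻¹ ↔ a = x⁻¹ * g * x := by
    constructor
    · rintro rfl; group
    · rintro rfl; group
  simp [this]

/-- The element `∑ F(a, b, c) e_a ⊗ e_b ⊗ e_c`. -/
def diag₃ (ω : NormalizedThreeCocycle G kˣ) (F : G → G → G → k) :
    TwistedDouble ω ⊗[k] (TwistedDouble ω ⊗[k] TwistedDouble ω) :=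
  ∑ a : G, ∑ b : G, ∑ c : G, F a b c •
    (basisElt ω a 1 ⊗ₜ[k] (basisElt ω b 1 ⊗ₜ[k] basisElt ω c 1))

/-- The element `∑ F(a, b, c, d) e_a ⊗ e_b ⊗ e_c ⊗ e_d`. -/
def diag₄ (ω : NormalizedThreeCocycle G kˣ) (F : G → G → G → G → k) :
    TwistedDouble ω ⊗[k] (TwistedDouble ω ⊗[k] (TwistedDouble ω ⊗[k] TwistedDouble ω)) :=
  ∑ a : G, ∑ b : G, ∑ c : G, ∑ d : G, F a b c d •
    (basisElt ω a 1 ⊗ₜ[k] (basisElt ω b 1 ⊗ₜ[k] (basisElt ω c 1 ⊗ₜ[k] basisElt ω d 1)))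

theorem diag₃_mul_tmul (F : G → G → G → k) (g h l x y z : G) :
    diag₃ ω F * (basisElt ω g x ⊗ₜ[k] (basisElt ω h y ⊗ₜ[k] basisElt ω l z)) =
      F g h l • (basisElt ω g x ⊗ₜ[k] (basisElt ω h y ⊗ₜ[k] basisElt ω l z)) := by
  simp only [diag₃, Finset.sum_mul, smul_mul_assoc, Algebra.TensorProduct.tmul_mul_tmul,
    idem_mul_basisElt]
  rw [Finset.sum_eq_single g, Finset.sum_eq_single h, Finset.sum_eq_single l]
  · simp
  · intro c _ hc; simp [hc]
  · simp
  · intro c _ hc; simp [hc]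
  · simp
  · intro c _ hc; simp [hc]
  · simp

theorem tmul_mul_diag₃ (F : G → G → G → k) (g h l x y z : G) :
    (basisElt ω g x ⊗ₜ[k] (basisElt ω h y ⊗ₜ[k] basisElt ω l z)) * diag₃ ω F =
      F (x⁻¹ * g * x) (y⁻¹ * h * y) (z⁻¹ * l * z) •
        (basisElt ω g x ⊗ₜ[k] (basisElt ω h y ⊗ₜ[k] basisElt ω l z)) := by
  simp only [diag₃, Finset.mul_sum, mul_smul_comm, Algebra.TensorProduct.tmul_mul_tmul,
    basisElt_mul_idem]
  rw [Finset.sum_eq_single (x⁻¹ * g * x), Finset.sum_eq_single (y⁻¹ * h * y),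
    Finset.sum_eq_single (z⁻¹ * l * z)]
  · simp
  · intro c _ hc; rw [if_neg hc]; simp
  · simp
  · intro c _ hc; simp [if_neg hc]
  · simp
  · intro c _ hc; simp [if_neg hc]
  · simp

theorem diag₃_mul (F F' : G → G → G → k) :
    diag₃ ω F * diag₃ ω F' = diag₃ ω (fun a b c => F a b c * F' a b c) := by
  conv_lhs => rw [diag₃.eq_1 ω F']
  simp only [Finset.mul_sum, mul_smul_comm, diag₃_mul_tmul, smul_smul]
  simp only [diag₃, mul_comm]

theorem idem_tmul_sum_mul {B : Type*} [Ring B] [Algebra k B] (f f' : G → B) :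
    (∑ a : G, basisElt ω a 1 ⊗ₜ[k] f a) * (∑ a : G, basisElt ω a 1 ⊗ₜ[k] f' a) =
      ∑ a : G, basisElt ω a 1 ⊗ₜ[k] (f a * f' a) := by
  rw [Finset.sum_mul_sum]
  refine Finset.sum_congr rfl fun a _ => ?_
  rw [Finset.sum_eq_single a]
  · rw [Algebra.TensorProduct.tmul_mul_tmul, idem_mul_basisElt, if_pos rfl]
  · intro b _ hb
    rw [Algebra.TensorProduct.tmul_mul_tmul, idem_mul_basisElt, if_neg hb.symm,
      TensorProduct.zero_tmul]
  · simp

theorem diag₄_eq (F : G → G → G → G → k) :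
    diag₄ ω F = ∑ a : G, basisElt ω a 1 ⊗ₜ[k] diag₃ ω (F a) := by
  simp only [diag₄, diag₃, TensorProduct.tmul_sum, TensorProduct.tmul_smul]

theorem diag₄_mul (F F' : G → G → G → G → k) :
    diag₄ ω F * diag₄ ω F' = diag₄ ω (fun a b c d => F a b c d * F' a b c d) := by
  rw [diag₄_eq, diag₄_eq, diag₄_eq, idem_tmul_sum_mul]
  simp only [diag₃_mul]

theorem diag₃_one : diag₃ ω (fun _ _ _ => 1) = 1 := by
  simp only [diag₃, one_smul, Algebra.TensorProduct.one_def, one_eq, TensorProduct.sum_tmul]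
  refine Finset.sum_congr rfl fun a _ => ?_
  rw [TensorProduct.tmul_sum]
  refine Finset.sum_congr rfl fun b _ => ?_
  rw [TensorProduct.tmul_sum, TensorProduct.tmul_sum]

/-- The associator `φ = ∑ ω(a, b, c)⁻¹ e_a ⊗ e_b ⊗ e_c`. -/
def phi (ω : NormalizedThreeCocycle G kˣ) :
    (TwistedDouble ω ⊗[k] (TwistedDouble ω ⊗[k] TwistedDouble ω))ˣ where
  val := diag₃ ω fun a b c => ((ω a b c)⁻¹ : kˣ)
  inv := diag₃ ω fun a b c => (ω a b c : kˣ)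
  val_inv := by simp [diag₃_mul, diag₃_one]
  inv_val := by simp [diag₃_mul, diag₃_one]

theorem phi_val : (phi ω).val = diag₃ ω fun a b c => (((ω a b c)⁻¹ : kˣ) : k) := rfl

theorem one_tmul_diag₃ (F : G → G → G → k) : (1 : TwistedDouble ω) ⊗ₜ[k] diag₃ ω F =
    diag₄ ω fun _ b c d => F b c d := by
  rw [one_eq, TensorProduct.sum_tmul]
  simp only [diag₃, diag₄, TensorProduct.tmul_sum, TensorProduct.tmul_smul]

theorem diag₃_tmul_one (F : G → G → G → k) :
    Algebra.TensorProduct.map (AlgHom.id k (TwistedDouble ω))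
      (Algebra.TensorProduct.assoc k k k (TwistedDouble ω) (TwistedDouble ω)
        (TwistedDouble ω)).toAlgHom
      (Algebra.TensorProduct.assoc k k k (TwistedDouble ω)
        (TwistedDouble ω ⊗[k] TwistedDouble ω) (TwistedDouble ω)
        (diag₃ ω F ⊗ₜ[k] (1 : TwistedDouble ω))) =
    diag₄ ω fun a b c _ => F a b c := by
  have hassoc (x y z t : TwistedDouble ω) :
      Algebra.TensorProduct.map (AlgHom.id k (TwistedDouble ω))
        (Algebra.TensorProduct.assoc k k k (TwistedDouble ω) (TwistedDouble ω)
          (TwistedDouble ω)).toAlgHom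
        (Algebra.TensorProduct.assoc k k k (TwistedDouble ω)
          (TwistedDouble ω ⊗[k] TwistedDouble ω) (TwistedDouble ω)
          ((x ⊗ₜ[k] (y ⊗ₜ[k] z)) ⊗ₜ[k] t)) = x ⊗ₜ[k] (y ⊗ₜ[k] (z ⊗ₜ[k] t)) := rfl
  simp only [diag₃, TensorProduct.sum_tmul, ← TensorProduct.smul_tmul', map_sum, map_smul]
  rw [diag₄]
  refine Finset.sum_congr rfl fun a _ => Finset.sum_congr rfl fun b _ =>
    Finset.sum_congr rfl fun c _ => ?_
  rw [one_eq, TensorProduct.tmul_sum]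
  simp only [map_sum, hassoc, Finset.smul_sum]

theorem comul_first (F : G → G → G → k) :
    Algebra.TensorProduct.assoc k k k (TwistedDouble ω) (TwistedDouble ω)
      (TwistedDouble ω ⊗[k] TwistedDouble ω)
      (Algebra.TensorProduct.map (comulHom ω)
        (AlgHom.id k (TwistedDouble ω ⊗[k] TwistedDouble ω)) (diag₃ ω F)) =
    diag₄ ω fun a b c d => F (a * b) c d := by
  simp only [diag₃, map_sum, map_smul, Algebra.TensorProduct.map_tmul, comulHom_idem,
    TensorProduct.sum_tmul, AlgHom.id_apply, Finset.smul_sum,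
    Algebra.TensorProduct.assoc_tmul]
  rw [diag₄, ← sum_reindex (fun a b => ∑ c : G, ∑ d : G, F (a * b) c d •
    (basisElt ω a 1 ⊗ₜ[k] (basisElt ω b 1 ⊗ₜ[k] (basisElt ω c 1 ⊗ₜ[k] basisElt ω d 1))))]
  refine Finset.sum_congr rfl fun p _ => ?_
  rw [Finset.sum_congr rfl fun b _ => Finset.sum_comm, Finset.sum_comm]
  simp only [mul_inv_cancel_left]

theorem comul_middle (F : G → G → G → k) :
    Algebra.TensorProduct.map (AlgHom.id k (TwistedDouble ω))
      (Algebra.TensorProduct.assoc k k k (TwistedDouble ω) (TwistedDouble ω)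
        (TwistedDouble ω)).toAlgHom
      (Algebra.TensorProduct.map (AlgHom.id k (TwistedDouble ω))
        (Algebra.TensorProduct.map (comulHom ω) (AlgHom.id k (TwistedDouble ω))) (diag₃ ω F)) =
    diag₄ ω fun a b c d => F a (b * c) d := by
  have (x y z : TwistedDouble ω) : (Algebra.TensorProduct.assoc k k k (TwistedDouble ω)
    (TwistedDouble ω) (TwistedDouble ω)).toAlgHom ((x ⊗ₜ[k] y) ⊗ₜ[k] z) =
      x ⊗ₜ[k] (y ⊗ₜ[k] z) := rfl
  simp only [diag₃, map_sum, map_smul, Algebra.TensorProduct.map_tmul, comulHom_idem,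
    TensorProduct.sum_tmul, TensorProduct.tmul_sum, AlgHom.id_apply, Finset.smul_sum, this]
  rw [diag₄]
  refine Finset.sum_congr rfl fun a _ => ?_
  rw [← sum_reindex (fun b c => ∑ d : G, F a (b * c) d •
    (basisElt ω a 1 ⊗ₜ[k] (basisElt ω b 1 ⊗ₜ[k] (basisElt ω c 1 ⊗ₜ[k] basisElt ω d 1))))]
  refine Finset.sum_congr rfl fun p _ => ?_
  rw [Finset.sum_comm]
  simp only [mul_inv_cancel_left]

theorem comul_last (F : G → G → G → k) :
    Algebra.TensorProduct.map (AlgHom.id k (TwistedDouble ω))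
      (Algebra.TensorProduct.map (AlgHom.id k (TwistedDouble ω)) (comulHom ω)) (diag₃ ω F) =
    diag₄ ω fun a b c d => F a b (c * d) := by
  simp only [diag₃, map_sum, map_smul, Algebra.TensorProduct.map_tmul, comulHom_idem,
    TensorProduct.tmul_sum, AlgHom.id_apply, Finset.smul_sum]
  rw [diag₄]
  refine Finset.sum_congr rfl fun a _ => Finset.sum_congr rfl fun b _ => ?_
  rw [← sum_reindex (fun c d => F a b (c * d) •
    (basisElt ω a 1 ⊗ₜ[k] (basisElt ω b 1 ⊗ₜ[k] (basisElt ω c 1 ⊗ₜ[k] basisElt ω d 1))))]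
  simp only [mul_inv_cancel_left]

theorem comulHom_quasi_coassoc (a : TwistedDouble ω) :
    Algebra.TensorProduct.map (AlgHom.id k (TwistedDouble ω)) (comulHom ω) (comulHom ω a) *
        (phi ω).val =
      (phi ω).val * Algebra.TensorProduct.assoc k k k (TwistedDouble ω) (TwistedDouble ω)
        (TwistedDouble ω)
        (Algebra.TensorProduct.map (comulHom ω) (AlgHom.id k (TwistedDouble ω)) (comulHom ω a)) := by
  have hb (g x : G) :
      Algebra.TensorProduct.map (AlgHom.id k (TwistedDouble ω)) (comulHom ω)
          (comulHom ω (basisElt ω g x)) * (phi ω).val =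
        (phi ω).val * Algebra.TensorProduct.assoc k k k (TwistedDouble ω) (TwistedDouble ω)
          (TwistedDouble ω) (Algebra.TensorProduct.map (comulHom ω) (AlgHom.id k (TwistedDouble ω))
            (comulHom ω (basisElt ω g x))) := by
    simp only [comulHom_basisElt, map_sum, map_smul, Algebra.TensorProduct.map_tmul,
      AlgHom.id_apply, TensorProduct.sum_tmul, TensorProduct.tmul_sum, TensorProduct.tmul_smul,
      ← TensorProduct.smul_tmul', Finset.smul_sum, Algebra.TensorProduct.assoc_tmul,
      Finset.sum_mul, Finset.mul_sum, smul_mul_assoc, mul_smul_comm, phi_val, diag₃_mul_tmul,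
      tmul_mul_diag₃, smul_smul]
    have hR := Finset.sum_comm (s := (Finset.univ : Finset G)) (t := (Finset.univ : Finset G))
      (f := fun p s => (((gamma ω x p (p⁻¹ * g) : kˣ) : k) *
        ((gamma ω x s (s⁻¹ * p) : kˣ) : k) *
          (((ω s (s⁻¹ * p) (p⁻¹ * g))⁻¹ : kˣ) : k)) •
        (basisElt ω s x ⊗ₜ[k] (basisElt ω (s⁻¹ * p) x ⊗ₜ[k] basisElt ω (p⁻¹ * g) x)))
    rw [hR]
    refine Finset.sum_congr rfl fun s _ => ?_
    conv_rhs => rw [← Equiv.sum_comp (Equiv.mulLeft s)]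
    refine Finset.sum_congr rfl fun t _ => ?_
    have key := congrArg (Units.val (α := k)) (gamma_mul ω x s t (t⁻¹ * (s⁻¹ * g)))
    simp only [Equiv.coe_mulLeft, inv_mul_cancel_left, mul_inv_rev, mul_assoc,
      mul_inv_cancel_left, Units.val_mul, Units.val_inv_eq_inv_val] at key ⊢
    congr 1
    have n1 := (ω s t (t⁻¹ * (s⁻¹ * g))).ne_zero
    have n2 := (ω (x⁻¹ * (s * x)) (x⁻¹ * (t * x)) (x⁻¹ * (t⁻¹ * (s⁻¹ * (g * x))))).ne_zero
    field_simp
    linear_combination key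
  rw [eq_sum_basisElt a]
  simp only [map_sum, map_smul, Finset.sum_mul, Finset.mul_sum, smul_mul_assoc, mul_smul_comm, hb]

/-- The quasi-bialgebra structure of the twisted quantum double `D^ω G`. -/
instance : QuasiBialgebra k (TwistedDouble ω) where
  comul := comulHom ω
  counit := counitHom ω
  associator := phi ω
  counit_left a := by
    have hb (g x : G) : Algebra.TensorProduct.lid k (TwistedDouble ω)
        (Algebra.TensorProduct.map (counitHom ω) (AlgHom.id k (TwistedDouble ω))
          (comulHom ω (basisElt ω g x))) = basisElt ω g x := by
      simp only [comulHom_basisElt, map_sum, map_smul, Algebra.TensorProduct.map_tmul,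
        counitHom_basisElt, AlgHom.id_apply, Algebra.TensorProduct.lid_tmul]
      rw [Finset.sum_eq_single 1]
      · simp
      · intro s _ hs; simp [hs]
      · simp
    rw [eq_sum_basisElt a]
    simp only [map_sum, map_smul, hb]
  counit_right a := by
    have hb (g x : G) : Algebra.TensorProduct.rid k k (TwistedDouble ω)
        (Algebra.TensorProduct.map (AlgHom.id k (TwistedDouble ω)) (counitHom ω)
          (comulHom ω (basisElt ω g x))) = basisElt ω g x := by
      simp only [comulHom_basisElt, map_sum, map_smul, Algebra.TensorProduct.map_tmul,
        counitHom_basisElt, AlgHom.id_apply, Algebra.TensorProduct.rid_tmul]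
      rw [Finset.sum_eq_single g]
      · simp
      · intro s _ hs
        have : s⁻¹ * g ≠ 1 := fun h => hs (inv_mul_eq_one.mp h)
        simp [this]
      · simp
    rw [eq_sum_basisElt a]
    simp only [map_sum, map_smul, hb]
  quasi_coassoc := comulHom_quasi_coassoc
  pentagon := by
    rw [phi_val, one_tmul_diag₃, comul_middle, diag₃_tmul_one, comul_last, comul_first,
      diag₄_mul, diag₄_mul, diag₄_mul]
    congr 1
    funext a b c d
    have key := congrArg (fun u : kˣ => (u⁻¹ : kˣ).val) (ω.toCocycle.property a b c d)
    simp only [mul_inv, Units.val_mul] at key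
    rw [key, mul_comm]
  counit_middle := by
    have (a b : TwistedDouble ω) : ((Algebra.TensorProduct.lid k (TwistedDouble ω)).toAlgHom.comp
        (Algebra.TensorProduct.map (counitHom ω) (AlgHom.id k (TwistedDouble ω)))) (a ⊗ₜ[k] b) =
        counitHom ω a • b := rfl
    rw [phi_val]
    simp only [diag₃, map_sum, map_smul, Algebra.TensorProduct.map_tmul, this, AlgHom.id_apply,
      counitHom_basisElt, Algebra.TensorProduct.one_def]
    conv_rhs => rw [one_eq, TensorProduct.sum_tmul]
    refine Finset.sum_congr rfl fun a _ => ?_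
    rw [TensorProduct.tmul_sum]
    rw [Finset.sum_eq_single 1]
    · simp [ω.map_one_middle]
    · intro b _ hb; simp [hb]
    · simp

end TwistedDouble

end TwistedDouble

namespace TwistedDouble

variable {k : Type u} [Field k] {G : Type v} [Group G] [Fintype G] [DecidableEq G]

/-- The exponent of `D^ω G`, that is the exponent of the fusion category `Rep D^ω G`. -/
def exp (ω : NormalizedThreeCocycle G kˣ) : ℕ :=
  exponent (FinRep k (TwistedDouble ω))

end TwistedDouble

end TensorExponent

end

/-! Write P(g) = ∏_{i<|G|} ω(g, gⁱ, g), which is `cyclicProd ω (Fintype.card G) g`. Both conditions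
are compared with the statement P = 1.

On the cyclic group ⟨g⟩ the product of ω(g, gⁱ, g) over one period decides whether a normalized
3-cocycle is a coboundary. Applied to the power of ω_g whose exponent is the index of ⟨g⟩, this
turns (i) into P = 1 (`cohomologicalOrder_dvd_index_iff`).

A representation of D^ω G is G-graded with a projective action of G, and C = Rep D^ω G is braided by
v ⊗ w ↦ gw ⊗ v for v of degree g. The twist acts on degree g as g does, so its |G|-th power is the
scalar P(g) there. By the balancing identity `twist_tmul`, the |G|-th power of the double braiding
is the scalar P(gh)P(g)⁻¹P(h)⁻¹ on V_g ⊗ W_h (`braidSq_pow_card`).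

The exponent, however, concerns the center of C, which one expects to be C ⊠ C^rev. Only two
consequences are needed: the copies of C given by the braiding and by its inverse centralize each
other, and every object of the center is spanned by images of morphisms from reg⁺ ⊗ reg⁻, where reg⁺
and reg⁻ are the regular representation in the two copies (`span_range_hom`). If P = 1, the |G|-th
power of the double braiding is the identity on such mixed products (`braidSq_mixed_pow`), hence
everywhere by naturality. The spanning statement rests on an averaging argument: a component of
degree l = ab of an object X is tensored with vectors of degrees a⁻¹ and b⁻¹ to reach degree 1,
averaged to a morphism from the unit object, and recovered by contracting with a pairing on reg
(`exists_coverHom_eq`).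

Conversely, if exp divides |G|, the copy reg⁺ shows that P is multiplicative
(`cyclicProd_mul_of_isNilpotent`). Always P(g⁻¹) = P(g) (`cyclicProd_inv`), so P(g)² = 1, while
P(g)^|G| = 1. For |G| odd this gives P = 1. -/

noncomputable section

/-! ### Representations of D^ω G as graded spaces with a projective action of G -/

namespace TensorExponent.TwistedDouble

variable {k : Type u} [Field k] {G : Type v} [Group G] [Fintype G] [DecidableEq G]
  {ω : NormalizedThreeCocycle G kˣ}

/-- The element `∑ e_h # x` of `D^ω G`. -/
def groupElt (ω : NormalizedThreeCocycle G kˣ) (x : G) : TwistedDouble ω := ∑ h, basisElt ω h x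

/-- The action of `∑ e_h # x`. -/
def trans (V : FinRep k (TwistedDouble ω)) (x : G) : V.carrier →ₗ[k] V.carrier :=
  V.action (groupElt ω x)

/-- The projection to the homogeneous part of degree `g`. -/
def proj (V : FinRep k (TwistedDouble ω)) (g : G) : V.carrier →ₗ[k] V.carrier :=
  V.action (basisElt ω g 1)

/-- The vector `v` is homogeneous of degree `g`. -/
def IsHomog (V : FinRep k (TwistedDouble ω)) (g : G) (v : V.carrier) : Prop := proj V g v = v

variable {V W U : FinRep k (TwistedDouble ω)}

theorem action_mul_apply (V : FinRep k (TwistedDouble ω)) (a b : TwistedDouble ω) (v : V.carrier) :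
    V.action (a * b) v = V.action a (V.action b v) := by
  rw [map_mul]; rfl

theorem proj_proj (V : FinRep k (TwistedDouble ω)) (g h : G) (v : V.carrier) :
    proj V g (proj V h v) = if g = h then proj V h v else 0 := by
  simp only [proj, ← action_mul_apply, idem_mul_basisElt]
  split_ifs <;> simp

theorem isHomog_proj (V : FinRep k (TwistedDouble ω)) (g : G) (v : V.carrier) :
    IsHomog V g (proj V g v) := by
  simp [IsHomog, proj_proj]

theorem sum_proj (V : FinRep k (TwistedDouble ω)) (v : V.carrier) : ∑ g, proj V g v = v := by
  simp only [proj, ← LinearMap.sum_apply, ← map_sum, ← one_eq, map_one]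
  rfl

theorem IsHomog.proj_eq {g : G} {v : V.carrier} (hv : IsHomog V g v) (h : G) :
    proj V h v = if h = g then v else 0 := by
  rw [← hv, proj_proj, hv]

theorem IsHomog.smul {g : G} {v : V.carrier} (hv : IsHomog V g v) (c : k) :
    IsHomog V g (c • v) := by
  rw [IsHomog, map_smul, hv]

theorem IsHomog.sum {ι : Type*} {s : Finset ι} {g : G} {v : ι → V.carrier}
    (hv : ∀ i ∈ s, IsHomog V g (v i)) : IsHomog V g (∑ i ∈ s, v i) := by
  rw [IsHomog, map_sum]
  exact Finset.sum_congr rfl hv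

theorem basisElt_eq_mul (h x : G) : basisElt ω h x = basisElt ω h 1 * groupElt ω x := by
  simp only [groupElt, Finset.mul_sum, idem_mul_basisElt, Finset.sum_ite_eq, Finset.mem_univ,
    if_true]

theorem groupElt_mul_idem (x g : G) :
    groupElt ω x * basisElt ω g 1 = basisElt ω (x * g * x⁻¹) x := by
  simp only [groupElt, Finset.sum_mul, basisElt_mul_idem]
  rw [Finset.sum_eq_single (x * g * x⁻¹)]
  · rw [if_pos (by group)]
  · intro b _ hb
    rw [if_neg]
    rintro rfl
    exact hb (by group)
  · simp

theorem groupElt_one : groupElt ω 1 = 1 := one_eq.symm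

theorem groupElt_mul_basisElt (x h y : G) : groupElt ω x * basisElt ω h y =
    ((theta ω (x * h * x⁻¹) x y : kˣ) : k) • basisElt ω (x * h * x⁻¹) (x * y) := by
  simp only [groupElt, Finset.sum_mul, basisElt_mul, Finset.sum_ite_eq', Finset.mem_univ, if_true]

theorem action_basisElt (V : FinRep k (TwistedDouble ω)) (h x : G) (v : V.carrier) :
    V.action (basisElt ω h x) v = proj V h (trans V x v) := by
  rw [basisElt_eq_mul, action_mul_apply]; rfl

@[simp]
theorem trans_one (V : FinRep k (TwistedDouble ω)) : trans V 1 = LinearMap.id := by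
  rw [trans, groupElt_one, map_one]; rfl

theorem IsHomog.trans_eq {g : G} {v : V.carrier} (hv : IsHomog V g v) (x : G) :
    trans V x v = V.action (basisElt ω (x * g * x⁻¹) x) v := by
  conv_lhs => rw [← hv]
  rw [trans, proj, ← action_mul_apply, groupElt_mul_idem]

theorem IsHomog.trans {g : G} {v : V.carrier} (hv : IsHomog V g v) (x : G) :
    IsHomog V (x * g * x⁻¹) (trans V x v) := by
  rw [IsHomog, hv.trans_eq, proj, ← action_mul_apply, idem_mul_basisElt, if_pos rfl]

theorem IsHomog.trans' {g h : G} {v : V.carrier} (hv : IsHomog V g v) (x : G)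
    (hh : h = x * g * x⁻¹) : IsHomog V h (TwistedDouble.trans V x v) := hh ▸ hv.trans x

theorem IsHomog.action_basisElt_eq {g : G} {v : V.carrier} (hv : IsHomog V g v) (h x : G) :
    V.action (basisElt ω h x) v = if h = x * g * x⁻¹ then TwistedDouble.trans V x v else 0 := by
  rw [action_basisElt, (hv.trans x).proj_eq]

/-- The projective action rule. The scalar θ is taken at the degree of the result, because e_h # x
has its image in degree h. -/
theorem IsHomog.trans_trans {g : G} {v : V.carrier} (hv : IsHomog V g v) (x y : G) :
    TwistedDouble.trans V x (TwistedDouble.trans V y v) =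
      ((theta ω (x * y * g * (x * y)⁻¹) x y : kˣ) : k) • TwistedDouble.trans V (x * y) v := by
  have h : x * (y * g * y⁻¹) * x⁻¹ = x * y * g * (x * y)⁻¹ := by group
  rw [hv.trans_eq y, hv.trans_eq (x * y), TwistedDouble.trans, ← action_mul_apply,
    groupElt_mul_basisElt, map_smul, h, LinearMap.smul_apply]

theorem exists_trans_eq (V : FinRep k (TwistedDouble ω)) {h : G} {w : V.carrier}
    (hw : IsHomog V h w) (x : G) :
    ∃ c : k, trans V x (c • trans V x⁻¹ w) = w := by
  refine ⟨((theta ω (x * x⁻¹ * h * (x * x⁻¹)⁻¹) x x⁻¹)⁻¹ : kˣ), ?_⟩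
  rw [map_smul, hw.trans_trans, smul_smul, ← Units.val_mul]
  simp

theorem trans_surjective (V : FinRep k (TwistedDouble ω)) (x : G) :
    Function.Surjective (trans V x) := by
  intro w
  choose c hc using fun h => exists_trans_eq V (isHomog_proj V h w) x
  exact ⟨∑ h, c h • trans V x⁻¹ (proj V h w), by rw [map_sum]; simp only [hc, sum_proj]⟩

theorem linearMap_ext_homog {M : Type*} [AddCommGroup M] [Module k M]
    {f f' : V.carrier →ₗ[k] M} (h : ∀ g v, IsHomog V g v → f v = f' v) : f = f' := by
  ext v
  rw [← sum_proj V v, map_sum, map_sum]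
  exact Finset.sum_congr rfl fun g _ => h g _ (isHomog_proj V g v)

theorem tensor_ext_homog {M : Type*} [AddCommGroup M] [Module k M]
    {f f' : V.carrier ⊗[k] W.carrier →ₗ[k] M}
    (h : ∀ g g' v w, IsHomog V g v → IsHomog W g' w → f (v ⊗ₜ w) = f' (v ⊗ₜ w)) : f = f' := by
  apply TensorProduct.ext
  refine linearMap_ext_homog fun g v hv => ?_
  exact linearMap_ext_homog fun g' w hw => h g g' v w hv hw

theorem tensor_left_ext_homog {M : Type*} [AddCommGroup M] [Module k M]
    {f f' : (V.carrier ⊗[k] W.carrier) ⊗[k] U.carrier →ₗ[k] M}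
    (h : ∀ g g' g'' v w u, IsHomog V g v → IsHomog W g' w → IsHomog U g'' u →
      f ((v ⊗ₜ w) ⊗ₜ u) = f' ((v ⊗ₜ w) ⊗ₜ u)) : f = f' := by
  apply TensorProduct.ext
  refine tensor_ext_homog fun g g' v w hv hw => ?_
  exact linearMap_ext_homog fun g'' u hu => h g g' g'' v w u hv hw hu

theorem tensor_right_ext_homog {M : Type*} [AddCommGroup M] [Module k M]
    {f f' : V.carrier ⊗[k] (W.carrier ⊗[k] U.carrier) →ₗ[k] M}
    (h : ∀ g g' g'' v w u, IsHomog V g v → IsHomog W g' w → IsHomog U g'' u →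
      f (v ⊗ₜ (w ⊗ₜ u)) = f' (v ⊗ₜ (w ⊗ₜ u))) : f = f' := by
  apply TensorProduct.ext
  refine linearMap_ext_homog fun g v hv => ?_
  exact tensor_ext_homog fun g' g'' w u hw hu => h g g' g'' v w u hv hw hu

theorem hom_apply_action (f : V ⟶ W) (a : TwistedDouble ω) (v : V.carrier) :
    f.toLin (V.action a v) = W.action a (f.toLin v) := LinearMap.congr_fun (f.comm a) v

theorem hom_trans (f : V ⟶ W) (x : G) (v : V.carrier) :
    f.toLin (trans V x v) = trans W x (f.toLin v) := hom_apply_action f _ v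

theorem IsHomog.map {g : G} {v : V.carrier} (hv : IsHomog V g v) (f : V ⟶ W) :
    IsHomog W g (f.toLin v) := by
  rw [IsHomog, proj, ← hom_apply_action]
  exact congrArg _ hv

theorem tensor_action_basisElt (V W : FinRep k (TwistedDouble ω)) (g x : G) (v : V.carrier)
    (w : W.carrier) : (V ⊗ W).action (basisElt ω g x) (v ⊗ₜ[k] w) =
    ∑ s : G, ((gamma ω x s (s⁻¹ * g) : kˣ) : k) •
      (V.action (basisElt ω s x) v ⊗ₜ[k] W.action (basisElt ω (s⁻¹ * g) x) w) := by
  change tensorAction V.action W.action (comulHom ω (basisElt ω g x)) (v ⊗ₜ[k] w) = _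
  rw [comulHom_basisElt, map_sum, LinearMap.sum_apply]
  simp only [map_smul, tensorAction_tmul, LinearMap.smul_apply, TensorProduct.map_tmul]

theorem tensor_action_homog {g h : G} {v : V.carrier} {w : W.carrier} (hv : IsHomog V g v)
    (hw : IsHomog W h w) (l x : G) : (V ⊗ W).action (basisElt ω l x) (v ⊗ₜ[k] w) =
    if l = x * (g * h) * x⁻¹ then
      ((gamma ω x (x * g * x⁻¹) (x * h * x⁻¹) : kˣ) : k) • (trans V x v ⊗ₜ[k] trans W x w)
    else 0 := by
  rw [tensor_action_basisElt, Finset.sum_eq_single (x * g * x⁻¹)]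
  · rw [hv.action_basisElt_eq, hw.action_basisElt_eq, if_pos rfl]
    have e : (x * g * x⁻¹)⁻¹ * l = x * h * x⁻¹ ↔ l = x * (g * h) * x⁻¹ := by
      rw [inv_mul_eq_iff_eq_mul]
      constructor
      · rintro rfl; group
      · rintro rfl; group
    by_cases hl : l = x * (g * h) * x⁻¹
    · rw [if_pos hl, if_pos (e.mpr hl), e.mpr hl]
    · rw [if_neg hl, if_neg fun h => hl (e.mp h), TensorProduct.tmul_zero, smul_zero]
  · intro s _ hs
    rw [hv.action_basisElt_eq, if_neg hs, TensorProduct.zero_tmul, smul_zero]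
  · simp

theorem IsHomog.tmul {g h : G} {v : V.carrier} {w : W.carrier} (hv : IsHomog V g v)
    (hw : IsHomog W h w) : IsHomog (V ⊗ W) (g * h) (v ⊗ₜ[k] w) := by
  rw [IsHomog, proj, tensor_action_homog hv hw]
  simp

theorem trans_tmul {g h : G} {v : V.carrier} {w : W.carrier} (hv : IsHomog V g v)
    (hw : IsHomog W h w) (x : G) : trans (V ⊗ W) x (v ⊗ₜ[k] w) =
      ((gamma ω x (x * g * x⁻¹) (x * h * x⁻¹) : kˣ) : k) • (trans V x v ⊗ₜ[k] trans W x w) := by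
  rw [(hv.tmul hw).trans_eq, tensor_action_homog hv hw, if_pos rfl]

/-- On homogeneous vectors φ reduces to the single summand e_g ⊗ e_h ⊗ e_l, so every coherence
condition becomes an identity between values of ω. -/
theorem associator_hom_tmul {g h l : G} {v : V.carrier} {w : W.carrier} {u : U.carrier}
    (hv : IsHomog V g v) (hw : IsHomog W h w) (hu : IsHomog U l u) :
    (α_ V W U).hom.toLin ((v ⊗ₜ[k] w) ⊗ₜ[k] u) =
      (((ω g h l)⁻¹ : kˣ) : k) • (v ⊗ₜ[k] (w ⊗ₜ[k] u)) := by
  change tensorAction V.action (tensorAction W.action U.action) (phi ω).val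
    (v ⊗ₜ[k] (w ⊗ₜ[k] u)) = _
  rw [phi_val, diag₃]
  simp only [map_sum, map_smul, tensorAction_tmul, LinearMap.sum_apply, LinearMap.smul_apply,
    TensorProduct.map_tmul]
  have e1 := hv.proj_eq
  have e2 := hw.proj_eq
  have e3 := hu.proj_eq
  simp only [proj] at e1 e2 e3
  simp only [e1, e2, e3]
  rw [Finset.sum_eq_single g, Finset.sum_eq_single h, Finset.sum_eq_single l]
  · simp
  · intro b _ hb; simp [hb]
  · simp
  · intro b _ hb; simp [hb]
  · simp
  · intro b _ hb; simp [hb]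
  · simp

theorem associator_inv_tmul {g h l : G} {v : V.carrier} {w : W.carrier} {u : U.carrier}
    (hv : IsHomog V g v) (hw : IsHomog W h w) (hu : IsHomog U l u) :
    (α_ V W U).inv.toLin (v ⊗ₜ[k] (w ⊗ₜ[k] u)) =
      ((ω g h l : kˣ) : k) • ((v ⊗ₜ[k] w) ⊗ₜ[k] u) := by
  have h1 := associator_hom_tmul hv hw hu
  have h2 : v ⊗ₜ[k] (w ⊗ₜ[k] u) =
      (α_ V W U).hom.toLin (((ω g h l : kˣ) : k) • ((v ⊗ₜ[k] w) ⊗ₜ[k] u)) := by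
    rw [map_smul, h1, smul_smul, ← Units.val_mul, mul_inv_cancel, Units.val_one, one_smul]
  rw [h2, ← LinearMap.comp_apply, ← FinRep.comp_toLin, Iso.hom_inv_id]
  rfl

end TensorExponent.TwistedDouble

end

/-! ### The braiding of Rep D^ω G -/

noncomputable section

namespace TensorExponent

namespace FinRep

variable {k : Type u} [Field k] {H : Type v} [Ring H] [Algebra k H]

@[simp]
theorem comp_apply {X Y Z : FinRep k H} (f : X ⟶ Y) (g : Y ⟶ Z) (x : X.carrier) :
    (f ≫ g).toLin x = g.toLin (f.toLin x) := rfl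

@[simp]
theorem inv_hom_apply {X Y : FinRep k H} (e : X ≅ Y) (y : Y.carrier) :
    e.hom.toLin (e.inv.toLin y) = y := by
  rw [← comp_apply, e.inv_hom_id]; rfl

@[simp]
theorem hom_inv_apply {X Y : FinRep k H} (e : X ≅ Y) (x : X.carrier) :
    e.inv.toLin (e.hom.toLin x) = x := by
  rw [← comp_apply, e.hom_inv_id]; rfl

theorem pow_toLin {X : FinRep k H} (f : End X) (n : ℕ) :
    Hom.toLin (f ^ n) = (Hom.toLin f ^ n : Module.End k X.carrier) := by
  induction n with
  | zero => rfl
  | succ n ih => rw [pow_succ, pow_succ, ← ih, End.mul_def]; rfl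

variable [QuasiBialgebra k H]

@[simp]
theorem whiskerLeft_apply (X : FinRep k H) {Y Z : FinRep k H} (f : Y ⟶ Z) (x : X.carrier)
    (y : Y.carrier) : (X ◁ f).toLin (x ⊗ₜ[k] y) = x ⊗ₜ[k] f.toLin y := rfl

@[simp]
theorem whiskerRight_apply {X Y : FinRep k H} (f : X ⟶ Y) (Z : FinRep k H) (x : X.carrier)
    (z : Z.carrier) : (f ▷ Z).toLin (x ⊗ₜ[k] z) = f.toLin x ⊗ₜ[k] z := rfl

end FinRep

namespace TwistedDouble

/-- The scalar identity making the braiding equivariant. All values of ω cancel by the definitions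
of γ and θ; the cocycle condition is not needed. -/
theorem gamma_mul_theta {G : Type v} [Group G] {M : Type w} [CommGroup M]
    (ω : NormalizedThreeCocycle G M) (g h x : G) :
    gamma ω x (x * g * x⁻¹) (x * h * x⁻¹) *
        theta ω (x * g * x⁻¹ * x * h * (x * g * x⁻¹ * x)⁻¹) (x * g * x⁻¹) x =
      gamma ω x (x * (g * h * g⁻¹) * x⁻¹) (x * g * x⁻¹) *
        theta ω (x * g * h * (x * g)⁻¹) x g := by
  apply Additive.ofMul.injective
  simp only [gamma, theta, ofMul_mul, ofMul_div, mul_assoc, mul_inv_rev, inv_mul_cancel_left,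
    inv_mul_cancel, mul_one, inv_inv]
  abel

variable {k : Type u} [Field k] {G : Type v} [Group G] [Fintype G] [DecidableEq G]
  {ω : NormalizedThreeCocycle G kˣ} {V W U : FinRep k (TwistedDouble ω)}

/-- A linear map on a tensor product which preserves degrees and commutes with the elements
`∑ e_h # x` on tensors of homogeneous vectors is a morphism of representations. -/
def tensorHomOfHomog (f : V.carrier ⊗[k] W.carrier →ₗ[k] U.carrier)
    (h₁ : ∀ g h v w, IsHomog V g v → IsHomog W h w → IsHomog U (g * h) (f (v ⊗ₜ w)))
    (h₂ : ∀ g h v w x, IsHomog V g v → IsHomog W h w →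
      ((gamma ω x (x * g * x⁻¹) (x * h * x⁻¹) : kˣ) : k) • f (trans V x v ⊗ₜ[k] trans W x w) =
        trans U x (f (v ⊗ₜ w))) : V ⊗ W ⟶ U :=
  ⟨f, fun a => tensor_ext_homog fun g h v w hv hw => by
    rw [eq_sum_basisElt a]
    simp only [LinearMap.comp_apply, map_sum, map_smul, LinearMap.sum_apply, LinearMap.smul_apply]
    refine Finset.sum_congr rfl fun p _ => congrArg _ ?_
    have key := tensor_action_homog hv hw p.1 p.2
    simp only [(h₁ g h v w hv hw).action_basisElt_eq]
    refine (congrArg f key).trans ?_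
    split_ifs
    · rw [map_smul]
      exact h₂ g h v w _ hv hw
    · simp⟩

/-- The braiding `v ⊗ w ↦ g w ⊗ v`, for `v` of degree `g`, as a linear map. -/
def braidLin (V W : FinRep k (TwistedDouble ω)) :
    V.carrier ⊗[k] W.carrier →ₗ[k] W.carrier ⊗[k] V.carrier :=
  (∑ g, TensorProduct.map (trans W g) (proj V g)) ∘ₗ
    (TensorProduct.comm k V.carrier W.carrier).toLinearMap

theorem braidLin_tmul {g : G} {v : V.carrier} (hv : IsHomog V g v) (w : W.carrier) :
    braidLin V W (v ⊗ₜ w) = trans W g w ⊗ₜ v := by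
  simp only [braidLin, LinearMap.comp_apply, LinearEquiv.coe_coe, TensorProduct.comm_tmul,
    LinearMap.sum_apply, TensorProduct.map_tmul, hv.proj_eq]
  rw [Finset.sum_eq_single g]
  · simp
  · intro b _ hb; simp [hb]
  · simp

theorem braidLin_surjective (V W : FinRep k (TwistedDouble ω)) :
    Function.Surjective (braidLin V W) := by
  intro t
  induction t with
  | zero => exact ⟨0, map_zero _⟩
  | add x y hx hy =>
    obtain ⟨a, rfl⟩ := hx
    obtain ⟨b, rfl⟩ := hy
    exact ⟨a + b, map_add _ _ _⟩
  | tmul w v =>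
    -- The braiding translates w by the degree of v, so a preimage is chosen for each degree and v
    -- is split into its homogeneous parts.
    choose u hu using fun g => trans_surjective W g w
    refine ⟨∑ g, proj V g v ⊗ₜ u g, ?_⟩
    rw [map_sum]
    simp only [braidLin_tmul (isHomog_proj V _ v), hu, ← TensorProduct.tmul_sum, sum_proj]

/-- The braiding as a linear bijection. -/
def braidEquiv (V W : FinRep k (TwistedDouble ω)) :
    V.carrier ⊗[k] W.carrier ≃ₗ[k] W.carrier ⊗[k] V.carrier :=
  LinearEquiv.ofBijective (braidLin V W)
    ⟨(LinearMap.injective_iff_surjective_of_finrank_eq_finrank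
      (TensorProduct.comm k V.carrier W.carrier).finrank_eq).mpr (braidLin_surjective V W),
      braidLin_surjective V W⟩

/-- The braiding of two representations of the twisted double. -/
def braidIso (V W : FinRep k (TwistedDouble ω)) : V ⊗ W ≅ W ⊗ V :=
  FinRep.mkIso (V := V ⊗ W) (W := W ⊗ V) (braidEquiv V W)
    (tensorHomOfHomog (V := V) (W := W) (U := W ⊗ V) (braidLin V W)
      (fun g h v w hv hw => by
        rw [braidLin_tmul hv]
        have := (hw.trans g).tmul hv
        rwa [inv_mul_cancel_right] at this)
      (fun g h v w x hv hw => by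
        rw [braidLin_tmul hv, braidLin_tmul (hv.trans x), trans_tmul (hw.trans g) hv,
          hw.trans_trans, hw.trans_trans, ← TensorProduct.smul_tmul', ← TensorProduct.smul_tmul',
          smul_smul, smul_smul, ← Units.val_mul, ← Units.val_mul, gamma_mul_theta]
        simp)).comm

theorem braidIso_hom_tmul {g : G} {v : V.carrier} (hv : IsHomog V g v) (w : W.carrier) :
    (braidIso V W).hom.toLin (v ⊗ₜ[k] w) = trans W g w ⊗ₜ[k] v := braidLin_tmul hv w

/-- On homogeneous tensors the forward hexagon is the definition of γ and the reverse hexagon the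
definition of θ. -/
instance : BraidedCategory (FinRep k (TwistedDouble ω)) where
  braiding := braidIso
  braiding_naturality_right X Y Z f := FinRep.hom_ext <| tensor_ext_homog fun g h v w hv hw => by
    rw [FinRep.comp_apply, FinRep.comp_apply, braidIso_hom_tmul hv, FinRep.whiskerLeft_apply,
      braidIso_hom_tmul hv, FinRep.whiskerRight_apply, hom_trans]
  braiding_naturality_left f Z := FinRep.hom_ext <| tensor_ext_homog fun g h v w hv hw => by
    rw [FinRep.comp_apply, FinRep.comp_apply, braidIso_hom_tmul hv, FinRep.whiskerRight_apply,
      braidIso_hom_tmul (hv.map f), FinRep.whiskerLeft_apply]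
  hexagon_forward X Y Z := FinRep.hom_ext <| tensor_left_ext_homog fun g h l v w u hv hw hu => by
    rw [FinRep.comp_apply, FinRep.comp_apply, FinRep.comp_apply, FinRep.comp_apply,
      associator_hom_tmul hv hw hu, map_smul, map_smul, braidIso_hom_tmul hv,
      FinRep.whiskerRight_apply, braidIso_hom_tmul hv, trans_tmul hw hu,
      ← TensorProduct.smul_tmul', map_smul, associator_hom_tmul (hw.trans g) (hu.trans g) hv,
      associator_hom_tmul (hw.trans g) hv hu, map_smul, FinRep.whiskerLeft_apply,
      braidIso_hom_tmul hv, smul_smul, smul_smul, ← Units.val_mul, ← Units.val_mul]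
    congr 2
    apply Additive.ofMul.injective
    simp only [gamma, ofMul_mul, ofMul_div, ofMul_inv, mul_assoc, inv_mul_cancel_left,
      inv_mul_cancel, mul_one]
    abel
  hexagon_reverse X Y Z := FinRep.hom_ext <| tensor_right_ext_homog fun g h l v w u hv hw hu => by
    rw [FinRep.comp_apply, FinRep.comp_apply, FinRep.comp_apply, FinRep.comp_apply,
      associator_inv_tmul hv hw hu, map_smul, map_smul, braidIso_hom_tmul (hv.tmul hw),
      associator_inv_tmul (hu.trans (g * h)) hv hw, FinRep.whiskerLeft_apply,
      braidIso_hom_tmul hw, associator_inv_tmul hv (hu.trans h) hw, map_smul,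
      FinRep.whiskerRight_apply, braidIso_hom_tmul hv, hu.trans_trans,
      ← TensorProduct.smul_tmul', ← TensorProduct.smul_tmul', smul_smul, smul_smul,
      ← Units.val_mul, ← Units.val_mul]
    congr 2
    apply Additive.ofMul.injective
    simp only [theta, ofMul_mul, ofMul_div, mul_assoc, inv_mul_cancel_left,
      inv_mul_cancel, mul_one, mul_inv_rev]
    abel

theorem braiding_hom_tmul {g : G} {v : V.carrier} (hv : IsHomog V g v) (w : W.carrier) :
    (β_ V W).hom.toLin (v ⊗ₜ[k] w) = trans W g w ⊗ₜ[k] v := braidLin_tmul hv w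

theorem braiding_inv_tmul {g : G} {v : V.carrier} (hv : IsHomog V g v) (w : W.carrier) :
    (β_ V W).inv.toLin (trans W g w ⊗ₜ[k] v) = v ⊗ₜ[k] w := by
  rw [← braiding_hom_tmul hv, FinRep.hom_inv_apply]

end TwistedDouble

end TensorExponent

end

/-! ### The twist and the powers of the double braiding -/

noncomputable section

namespace TensorExponent

/-- The double braiding in a braided category. -/
def braidSq {C : Type u} [Category.{v} C] [MonoidalCategory C] [BraidedCategory C] (X Y : C) :
    End (X ⊗ Y) := (β_ X Y).hom ≫ (β_ Y X).hom

/-- The product `∏_{i < n} ω(g, gⁱ, g)`. -/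
def cyclicProd {G : Type v} [Group G] {M : Type w} [CommGroup M] (ω : G → G → G → M) (n : ℕ)
    (g : G) : M := ∏ i ∈ Finset.range n, ω g (g ^ i) g

namespace TwistedDouble

/-- The scalar part of the balancing identity. A single instance of the cocycle condition suffices,
at (x, ghg⁻¹, g, h) with x the conjugate of g by gh. -/
theorem gamma_eq_theta_mul_theta {G : Type v} [Group G] {M : Type w} [CommGroup M]
    (ω : NormalizedThreeCocycle G M) (g h : G) :
    gamma ω (g * h) (g * h * g * (g * h)⁻¹) (g * h * h * (g * h)⁻¹) =
      theta ω (g * h * g⁻¹ * g * g * (g * h * g⁻¹ * g)⁻¹) (g * h * g⁻¹) g *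
        theta ω (g * h * h * (g * h)⁻¹) g h := by
  have key := cocycle_add ω (g * h * g * (g * h)⁻¹) (g * h * g⁻¹) g h
  apply Additive.ofMul.injective
  simp only [gamma, theta, ofMul_mul, ofMul_div, mul_assoc, mul_inv_rev, inv_mul_cancel_left,
    inv_mul_cancel, mul_inv_cancel_left, mul_one, inv_inv, mul_inv_cancel] at key ⊢
  linear_combination (norm := module) -key

/-- Since g commutes with its powers, two of the three factors of θ cancel. This is where the
products of ω(g, gⁱ, g) come from. -/
theorem theta_self {G : Type v} [Group G] {M : Type w} [CommGroup M]
    (ω : NormalizedThreeCocycle G M) (g : G) (i : ℕ) :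
    theta ω (g * g ^ i * g * (g * g ^ i)⁻¹) g (g ^ i) = ω g (g ^ i) g := by
  have : g * g ^ i * g * (g * g ^ i)⁻¹ = g := by
    rw [← pow_succ', ← pow_succ, pow_succ', mul_inv_cancel_right]
  have h2 : (g * g ^ i)⁻¹ * g * (g * g ^ i) = g := by
    rw [← pow_succ', mul_assoc, ← pow_succ', pow_succ g (i + 1), inv_mul_cancel_left]
  rw [theta, this, h2, inv_mul_cancel, one_mul]
  simp

variable {k : Type u} [Field k] {G : Type v} [Group G] [Fintype G] [DecidableEq G]
  {ω : NormalizedThreeCocycle G kˣ} {V W U : FinRep k (TwistedDouble ω)}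

/-- The twist, the action of `∑ e_g # g`. -/
def twist (V : FinRep k (TwistedDouble ω)) : Module.End k V.carrier :=
  V.action (∑ g, basisElt ω g g)

theorem twist_apply {g : G} {v : V.carrier} (hv : IsHomog V g v) : twist V v = trans V g v := by
  simp only [twist, map_sum, LinearMap.sum_apply, hv.action_basisElt_eq]
  rw [Finset.sum_eq_single g]
  · simp
  · intro h _ hh
    rw [if_neg]
    intro h1
    apply hh
    rwa [eq_mul_inv_iff_mul_eq, mul_right_inj] at h1
  · simp

theorem twist_pow_apply {g : G} {v : V.carrier} (hv : IsHomog V g v) (n : ℕ) :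
    (twist V ^ n) v = ((cyclicProd ω n g : kˣ) : k) • trans V (g ^ n) v := by
  induction n with
  | zero => simp [cyclicProd]
  | succ n ih =>
    have h1 : IsHomog V g (trans V (g ^ n) v) := hv.trans' _ (by
      rw [← pow_succ, pow_succ', mul_inv_cancel_right])
    rw [pow_succ', Module.End.mul_apply, ih, map_smul, twist_apply h1, hv.trans_trans, theta_self,
      smul_smul, ← Units.val_mul, cyclicProd, cyclicProd, Finset.prod_range_succ, ← pow_succ']

/-- The balancing identity: both sides translate v and w by gh, the left with scalar γ, the right
with a product of two values of θ. -/
theorem twist_tmul {g h : G} {v : V.carrier} {w : W.carrier} (hv : IsHomog V g v)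
    (hw : IsHomog W h w) : twist (V ⊗ W) (v ⊗ₜ[k] w) =
      (braidSq V W).toLin (twist V v ⊗ₜ[k] twist W w) := by
  have h1 : IsHomog V g (trans V g v) := hv.trans' _ (by simp)
  have h2 : IsHomog W (g * h * g⁻¹) (trans W g (trans W h w)) := (hw.trans' h (by simp)).trans g
  have e : g * h * g⁻¹ * g = g * h := by group
  rw [twist_apply (hv.tmul hw), twist_apply hv, twist_apply hw, braidSq, FinRep.comp_apply,
    braiding_hom_tmul h1, braiding_hom_tmul h2, trans_tmul hv hw, hv.trans_trans, hw.trans_trans,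
    TensorProduct.smul_tmul_smul, ← Units.val_mul, ← gamma_eq_theta_mul_theta, e]

theorem twist_comm (f : V ⟶ W) : f.toLin ∘ₗ twist V = twist W ∘ₗ f.toLin := f.comm _

theorem isUnit_toLin_iso (e : V ≅ V) : IsUnit (e.hom.toLin : Module.End k V.carrier) :=
  ⟨⟨e.hom.toLin, e.inv.toLin, LinearMap.ext fun x => FinRep.inv_hom_apply e x,
    LinearMap.ext fun x => FinRep.hom_inv_apply e x⟩, rfl⟩

/-- Let c be the double braiding, S the tensor product of the twists and T = cS the twist of V ⊗ W.
The twist commutes with morphisms, so c commutes with T; being invertible, c commutes with S, and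
powers may be taken factor by factor. -/
theorem braidSq_pow_mul (V W : FinRep k (TwistedDouble ω)) (n : ℕ) :
    (((braidSq V W).toLin : Module.End k (V.carrier ⊗[k] W.carrier)) ^ n) *
      TensorProduct.map (twist V ^ n) (twist W ^ n) =
        (twist (V ⊗ W) : Module.End k (V.carrier ⊗[k] W.carrier)) ^ n := by
  set c : Module.End k (V.carrier ⊗[k] W.carrier) := (braidSq V W).toLin
  set T : Module.End k (V.carrier ⊗[k] W.carrier) := twist (V ⊗ W)
  set S : Module.End k (V.carrier ⊗[k] W.carrier) := TensorProduct.map (twist V) (twist W)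
  have hc : IsUnit c := isUnit_toLin_iso (β_ V W ≪≫ β_ W V)
  have h1 : c * S = T := tensor_ext_homog fun g h v w hv hw => (twist_tmul hv hw).symm
  have h2 : c * T = T * c := twist_comm (braidSq V W)
  have h3 : Commute c S := by
    apply hc.mul_left_cancel
    rw [← mul_assoc, ← mul_assoc, mul_assoc, h1, h2]
  rw [← h1, h3.mul_pow]
  congr 1
  exact TensorProduct.map_pow (twist V) (twist W) n |>.symm

/-- Because g^|G| = 1, the |G|-th powers of all three twists are scalars, and `braidSq_pow_mul` can
be solved for the double braiding. -/
theorem braidSq_pow_card {g h : G} {v : V.carrier} {w : W.carrier} (hv : IsHomog V g v)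
    (hw : IsHomog W h w) :
    FinRep.Hom.toLin (braidSq V W ^ Fintype.card G) (v ⊗ₜ[k] w) =
      ((cyclicProd ω (Fintype.card G) (g * h) * (cyclicProd ω (Fintype.card G) g)⁻¹ *
        (cyclicProd ω (Fintype.card G) h)⁻¹ : kˣ) : k) • (v ⊗ₜ[k] w) := by
  have key := LinearMap.congr_fun (braidSq_pow_mul V W (Fintype.card G)) (v ⊗ₜ[k] w)
  rw [Module.End.mul_apply, TensorProduct.map_tmul, twist_pow_apply hv, twist_pow_apply hw,
    pow_card_eq_one, pow_card_eq_one, trans_one, trans_one, LinearMap.id_apply, LinearMap.id_apply,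
    TensorProduct.smul_tmul_smul, map_smul] at key
  have h2 := twist_pow_apply (hv.tmul hw) (Fintype.card G)
  rw [pow_card_eq_one, trans_one, LinearMap.id_apply] at h2
  rw [FinRep.pow_toLin]
  have h3 := congrArg (fun t => (((cyclicProd ω (Fintype.card G) g)⁻¹ *
        (cyclicProd ω (Fintype.card G) h)⁻¹ : kˣ) : k) • t) (key.trans h2)
  beta_reduce at h3
  rw [smul_smul, smul_smul, ← Units.val_mul, ← Units.val_mul, ← Units.val_mul] at h3
  have e1 : (cyclicProd ω (Fintype.card G) g)⁻¹ * (cyclicProd ω (Fintype.card G) h)⁻¹ *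
      (cyclicProd ω (Fintype.card G) g * cyclicProd ω (Fintype.card G) h) = 1 := by
    rw [← mul_inv, inv_mul_cancel]
  rw [e1, Units.val_one, one_smul] at h3
  rw [mul_assoc, mul_comm (cyclicProd ω (Fintype.card G) (g * h))]
  exact h3

end TwistedDouble

end TensorExponent

end

/-! ### Cyclic products and third cohomology of cyclic groups -/

noncomputable section

namespace TensorExponent

section Cyclic

variable {G : Type v} {M : Type w} [Group G] [CommGroup M]

/-- Multiplication by g rotates the range of powers: the term gained at gⁿ equals the term lost at
1. -/
theorem prod_range_mul_self {g : G} {n : ℕ} (hg : g ^ n = 1) (F : G → M) :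
    ∏ i ∈ Finset.range n, F (g ^ i * g) = ∏ i ∈ Finset.range n, F (g ^ i) := by
  have h1 := Finset.prod_range_succ (fun i => F (g ^ i)) n
  rw [Finset.prod_range_succ', pow_zero, hg] at h1
  simpa only [← pow_succ] using mul_right_cancel h1

theorem prod_range_pow_mul {g : G} {n : ℕ} (hg : g ^ n = 1) (F : G → M) (j : ℕ) :
    ∏ i ∈ Finset.range n, F (g ^ j * g ^ i) = ∏ i ∈ Finset.range n, F (g ^ i) := by
  induction j with
  | zero => simp
  | succ j ih =>
    rw [← ih, ← prod_range_mul_self hg (fun x => F (g ^ j * x))]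
    refine Finset.prod_congr rfl fun i _ => congrArg F ?_
    rw [pow_succ, mul_assoc, ← pow_succ, ← pow_succ']

theorem prod_range_inv_pow {g : G} {n : ℕ} (hg : g ^ n = 1) (F : G → M) :
    ∏ i ∈ Finset.range n, F (g⁻¹ ^ i) = ∏ i ∈ Finset.range n, F (g ^ i) := by
  rw [← prod_range_mul_self (g := g⁻¹) (by rw [inv_pow, hg, inv_one]),
    ← Finset.prod_range_reflect (fun i => F (g ^ i))]
  refine Finset.prod_congr rfl fun i hi => congrArg F ?_
  have : g ^ (n - 1 - i) * g ^ (i + 1) = 1 := by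
    rw [← pow_add, ← hg]
    congr 1
    have := Finset.mem_range.mp hi
    omega
  rw [eq_inv_of_mul_eq_one_left this, ← pow_succ, inv_pow]

/-- The product `∏_{i < n} ψ(x, gⁱ, g)`. -/
def partialProd (ψ : G → G → G → M) (g x : G) (n : ℕ) : M :=
  ∏ i ∈ Finset.range n, ψ x (g ^ i) g

theorem partialProd_self (ψ : G → G → G → M) (g : G) (n : ℕ) :
    partialProd ψ g g n = cyclicProd ψ n g := rfl

/-- Multiply the cocycle condition at (a, gʲ, gⁱ, g) over i. The factors ω(a, gʲ, ·) on the two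
sides differ by a rotation and cancel. -/
theorem partialProd_mul {ψ : G → G → G → M} (hψ : ψ ∈ threeCocycles G M) {g : G} {n : ℕ}
    (hg : g ^ n = 1) (a : G) (j : ℕ) :
    partialProd ψ g (a * g ^ j) n = partialProd ψ g a n * partialProd ψ g (g ^ j) n := by
  have key := Finset.prod_congr (M := M) (rfl : Finset.range n = Finset.range n)
    fun i _ => hψ a (g ^ j) (g ^ i) g
  simp only [Finset.prod_mul_distrib] at key
  rw [prod_range_pow_mul hg (fun x => ψ a x g), prod_range_mul_self hg (ψ a (g ^ j))] at key
  rw [mul_comm (partialProd ψ g a n)]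
  exact (mul_right_cancel key).symm

theorem partialProd_one {ψ : G → G → G → M} (h : ∀ b c, ψ 1 b c = 1) (g : G) (n : ℕ) :
    partialProd ψ g 1 n = 1 := by
  simp [partialProd, h]

theorem partialProd_pow {ψ : G → G → G → M} (hψ : ψ ∈ threeCocycles G M)
    (h : ∀ b c, ψ 1 b c = 1) {g : G} {n : ℕ} (hg : g ^ n = 1) (j : ℕ) :
    partialProd ψ g (g ^ j) n = partialProd ψ g g n ^ j := by
  induction j with
  | zero => rw [pow_zero, pow_zero, partialProd_one h]
  | succ j ih =>
    have := partialProd_mul hψ hg (g ^ j) 1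
    rw [pow_one, ← pow_succ] at this
    rw [this, ih, pow_succ]

theorem cyclicProd_pow_eq_one {ψ : G → G → G → M} (hψ : ψ ∈ threeCocycles G M)
    (h : ∀ b c, ψ 1 b c = 1) {g : G} {n : ℕ} (hg : g ^ n = 1) : cyclicProd ψ n g ^ n = 1 := by
  rw [← partialProd_self, ← partialProd_pow hψ h hg, hg, partialProd_one h]

/-- Multiplying the cocycle condition at (g⁻¹, gⁱ, g⁻¹, g) over i leaves `partialProd ψ g g⁻¹ n *
cyclicProd ψ n g⁻¹ = 1`. By `partialProd_mul` the first factor is also inverse to the cyclic product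
at g. -/
theorem cyclicProd_inv {ψ : G → G → G → M} (hψ : ψ ∈ threeCocycles G M)
    (h₁ : ∀ b c, ψ 1 b c = 1) (h₃ : ∀ a b, ψ a b 1 = 1) {g : G} {n : ℕ} (hg : g ^ n = 1) :
    cyclicProd ψ n g⁻¹ = cyclicProd ψ n g := by
  have key := Finset.prod_congr (M := M) (rfl : Finset.range n = Finset.range n)
    fun i _ => hψ g⁻¹ (g ^ i) g⁻¹ g
  have e1 (i : ℕ) : g⁻¹ * g ^ i = g ^ i * g⁻¹ := by
    rw [← zpow_natCast, ← zpow_neg_one, ← zpow_add, ← zpow_add, add_comm]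
  simp only [Finset.prod_mul_distrib, inv_mul_cancel, h₃, mul_one, e1] at key
  have e2 (F : G → M) :
      ∏ i ∈ Finset.range n, F (g ^ i * g⁻¹) = ∏ i ∈ Finset.range n, F (g ^ i) := by
    rw [← prod_range_mul_self hg (fun x => F (x * g⁻¹))]
    simp only [mul_inv_cancel_right]
  rw [e2 (fun x => ψ g⁻¹ x g), e2 (fun x => ψ x g⁻¹ g),
    ← prod_range_inv_pow hg (fun x => ψ g⁻¹ x g⁻¹),
    mul_assoc] at key
  have h2 : partialProd ψ g g⁻¹ n * cyclicProd ψ n g⁻¹ = 1 := mul_eq_left.mp key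
  have h3 := partialProd_mul hψ hg g⁻¹ 1
  rw [pow_one, inv_mul_cancel, partialProd_one h₁, partialProd_self] at h3
  exact mul_left_cancel (h2.trans h3)

/-- The four factors of the coboundary cancel in pairs after a rotation. -/
theorem cyclicProd_coboundaryMap (f : G → G → M) {g : G} {n : ℕ} (hg : g ^ n = 1) :
    cyclicProd (coboundaryMap G M f) n g = 1 := by
  have e (i : ℕ) : g * g ^ i = g ^ i * g := by rw [← pow_succ, ← pow_succ']
  simp only [cyclicProd, coboundaryMap, MonoidHom.coe_mk, OneHom.coe_mk, Finset.prod_mul_distrib,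
    Finset.prod_inv_distrib, e]
  rw [prod_range_mul_self hg (fun x => f x g), prod_range_mul_self hg (fun x => f g x),
    mul_inv_cancel_right, mul_inv_cancel]

/-- An explicit cochain f(x, gʲ) = ∏_{i<j} ψ(x, gⁱ, g) trivializes ψ. It is well defined because the
product over a full period is 1 for every x, not only for x = g, by `partialProd_pow`. -/
theorem mem_threeCoboundaries_of_cyclicProd_eq_one {ψ : G → G → G → M}
    (hψ : ψ ∈ threeCocycles G M) (h₁ : ∀ b c, ψ 1 b c = 1) (h₂ : ∀ a c, ψ a 1 c = 1) {g : G}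
    (hgen : ∀ x, ∃ j : ℕ, g ^ j = x) (h : cyclicProd ψ (orderOf g) g = 1) :
    ψ ∈ threeCoboundaries G M := by
  have hg := pow_orderOf_eq_one g
  have hP (x : G) : partialProd ψ g x (orderOf g) = 1 := by
    obtain ⟨j, rfl⟩ := hgen x
    rw [partialProd_pow hψ h₁ hg, partialProd_self, h, one_pow]
  have hper (x : G) (j : ℕ) : partialProd ψ g x (j + orderOf g) = partialProd ψ g x j := by
    rw [partialProd, Finset.prod_range_add]
    simp only [pow_add]
    rw [prod_range_pow_mul hg (fun y => ψ x y g)]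
    exact (congrArg _ (hP x)).trans (mul_one _)
  have hmod (x : G) (j : ℕ) : partialProd ψ g x (j % orderOf g) = partialProd ψ g x j := by
    conv_rhs => rw [← Nat.mod_add_div j (orderOf g)]
    induction j / orderOf g with
    | zero => simp
    | succ m ih => rw [mul_add, mul_one, ← add_assoc, hper, ih]
  choose J hJ using hgen
  have hF (x y : G) (j : ℕ) (hj : g ^ j = y) : partialProd ψ g x (J y) = partialProd ψ g x j := by
    rw [← hmod x j, ← hmod x (J y)]
    congr 1
    exact pow_eq_pow_iff_modEq.mp ((hJ y).trans hj.symm)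
  set f : G → G → M := fun x y => partialProd ψ g x (J y)
  have f_gen (x : G) : f x g = 1 := by
    refine (hF x g 1 (pow_one g)).trans ?_
    simp [partialProd, h₂]
  have f_succ (x y : G) : f x (y * g) = f x y * ψ x y g := by
    refine (hF x (y * g) (J y + 1) (by rw [pow_succ, hJ])).trans ?_
    rw [partialProd, Finset.prod_range_succ, hJ]
    rfl
  -- The correction by f makes the cocycle trivial when its last argument is g.
  set ψ' := ψ * coboundaryMap G M f with hψ'
  have mem' : ψ' ∈ threeCocycles G M :=
    mul_mem hψ (threeCoboundaries_le G M ⟨f, rfl⟩)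
  have gen' (x y : G) : ψ' x y g = 1 := by
    simp only [hψ', Pi.mul_apply, coboundaryMap, MonoidHom.coe_mk, OneHom.coe_mk, f_gen, f_succ]
    rw [one_mul, inv_one, mul_one, mul_inv, mul_inv_cancel_left, mul_inv_cancel]
  -- In the cocycle condition at (a, b, c, g) three factors end in g and vanish; the rest says that
  -- the last argument may be shifted by g.
  have step (a b c : G) : ψ' a b (c * g) = ψ' a b c := by
    have := mem' a b c g
    rw [gen', gen', gen', one_mul, one_mul, one_mul] at this
    exact this.symm
  have triv (a b : G) (j : ℕ) : ψ' a b (g ^ j * g) = 1 := by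
    induction j with
    | zero => rw [pow_zero, one_mul, gen']
    | succ j ih => rw [pow_succ, step, ih]
  have triv' : ψ' = 1 := by
    funext a b c
    have := triv a b (J c)
    rwa [step, hJ] at this
  rw [show ψ = (coboundaryMap G M f)⁻¹ from eq_inv_of_mul_eq_one_left triv']
  exact inv_mem ⟨f, rfl⟩

/-- The order of the class of `ω_g` divides the index of `⟨g⟩` if and only if
`∏_{i < |G|} ω(g, gⁱ, g) = 1`. -/
theorem cohomologicalOrder_dvd_index_iff [Fintype G] (ω : NormalizedThreeCocycle G M) (g : G) :
    cohomologicalOrder (restrictCocycle ω.toCocycle (Subgroup.zpowers g)) ∣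
      (Subgroup.zpowers g).index ↔ cyclicProd ω (Fintype.card G) g = 1 := by
  set S := Subgroup.zpowers g
  set m := S.index
  set s : S := ⟨g, Subgroup.mem_zpowers g⟩ with hs
  have hcard : Fintype.card G = m * orderOf g := by
    rw [← Nat.card_eq_fintype_card, ← Nat.card_zpowers, S.index_mul_card]
  set ψ : S → S → S → M := (restrictCocycle ω.toCocycle S ^ m : threeCocycles S M).val with hψ
  have hψ_apply (a b c : S) : ψ a b c = ω a b c ^ m := rfl
  have hord : orderOf s = orderOf g := by
    rw [← orderOf_injective S.subtype S.subtype_injective s]; rfl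
  -- As |G| is m times the order of g, the product over |G| terms is the m-th power of the product
  -- over one period, which is the cyclic product of ωᵐ.
  have hcyc : cyclicProd ω (Fintype.card G) g = cyclicProd ψ (orderOf s) s := by
    have hper (j : ℕ) : cyclicProd ω (j * orderOf g) g = cyclicProd ω (orderOf g) g ^ j := by
      induction j with
      | zero => simp [cyclicProd]
      | succ j ih =>
        rw [add_mul, one_mul, cyclicProd, Finset.prod_range_add, pow_succ, ← ih]
        simp only [pow_add]
        rw [prod_range_pow_mul (pow_orderOf_eq_one g) (fun x => ω g x g)]
        rfl
    rw [hcard, hper, hord]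
    simp only [cyclicProd, hψ_apply, Finset.prod_pow]
    rfl
  rw [cohomologicalOrder, orderOf_dvd_iff_pow_eq_one, ← QuotientGroup.mk_pow,
    QuotientGroup.eq_one_iff, Subgroup.mem_subgroupOf, hcyc]
  constructor
  · rintro ⟨f, hf⟩
    rw [hψ, ← hf]
    exact cyclicProd_coboundaryMap f (pow_orderOf_eq_one s)
  · intro h
    refine mem_threeCoboundaries_of_cyclicProd_eq_one (Subtype.property _) (fun b c => ?_)
      (fun a c => ?_) (g := s) (fun x => ?_) h
    · exact (congrArg (· ^ m) (ω.map_one_left b c)).trans (one_pow m)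
    · exact (congrArg (· ^ m) (ω.map_one_middle a c)).trans (one_pow m)
    · obtain ⟨x, hx⟩ := x
      obtain ⟨j, hj⟩ := (mem_powers_iff_mem_zpowers (x := g)).mpr hx
      exact ⟨j, Subtype.ext hj⟩

end Cyclic

end TensorExponent

end

/-! ### Divisibility by the exponent; the regular representation; the case of odd order -/

noncomputable section

namespace TensorExponent

section Exponent

theorem isNilpotent_pow_mul_sub_one {R : Type*} [Ring R] {b : R} {m : ℕ}
    (h : IsNilpotent (b ^ m - 1)) (j : ℕ) : IsNilpotent (b ^ (m * j) - 1) := by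
  have e := mul_geom_sum (b ^ m) j
  rw [pow_mul, ← e]
  exact Commute.isNilpotent_mul_right (Commute.sum_right _ _ _ fun i _ =>
    ((Commute.refl (b ^ m)).pow_right i).sub_left (Commute.one_left _)) h

/-- With n = mq + r, the difference of bⁿ and b^{mq} is b^{mq}(bʳ − 1), and b^{mq} is a unit because
it is unipotent. -/
theorem isNilpotent_pow_mod_sub_one {R : Type*} [Ring R] {b : R} {m n : ℕ}
    (hm : IsNilpotent (b ^ m - 1)) (hn : IsNilpotent (b ^ n - 1)) :
    IsNilpotent (b ^ (n % m) - 1) := by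
  have h1 := isNilpotent_pow_mul_sub_one hm (n / m)
  have hu : IsUnit (b ^ (m * (n / m))) := by
    have := h1.isUnit_add_one
    rwa [sub_add_cancel] at this
  have comm (i j : ℕ) : Commute (b ^ i) (b ^ j - 1) :=
    (Commute.pow_pow (Commute.refl b) i j).sub_right (Commute.one_right _)
  have h2 : IsNilpotent (b ^ (m * (n / m)) * (b ^ (n % m) - 1)) := by
    have e : b ^ (m * (n / m)) * (b ^ (n % m) - 1) = (b ^ n - 1) - (b ^ (m * (n / m)) - 1) := by
      rw [mul_sub, ← pow_add, Nat.div_add_mod, mul_one, sub_sub_sub_cancel_right]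
    rw [e]
    exact Commute.isNilpotent_sub ((comm n _).sub_left (Commute.one_left _)) hn h1
  exact ((comm _ _).isNilpotent_mul_left_iff hu.mem_nonZeroDivisors.1).mp h2

/-- The admissible exponents are closed under multiples and nonzero remainders, so the least one
divides all others. -/
theorem exponent_dvd_iff (C : Type u) [Category.{v} C] [MonoidalCategory C] [Preadditive C] {n : ℕ}
    (hn : 0 < n) :
    exponent C ∣ n ↔ ∀ X Y : Center C, IsNilpotent (doubleBraiding X Y ^ n - 1) := by
  constructor
  · rintro ⟨j, hj⟩ X Y
    -- The infimum of an empty set is 0, which does not divide the positive n; so some admissible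
    -- exponent exists.
    have h0 : 0 < exponent C := Nat.pos_of_ne_zero fun h => by simp [h] at hj; omega
    have hne := Nat.nonempty_of_pos_sInf h0
    rw [hj]
    exact isNilpotent_pow_mul_sub_one ((Nat.sInf_mem hne).2 X Y) j
  · intro h
    have hmem := Nat.sInf_mem (⟨n, hn, h⟩ : {N : ℕ | 0 < N ∧
      ∀ X Y : Center C, IsNilpotent (doubleBraiding X Y ^ N - 1)}.Nonempty)
    rw [Nat.dvd_iff_mod_eq_zero]
    by_contra h0
    have h1 : n % exponent C ∈ {N : ℕ | 0 < N ∧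
        ∀ X Y : Center C, IsNilpotent (doubleBraiding X Y ^ N - 1)} :=
      ⟨Nat.pos_of_ne_zero h0, fun X Y => isNilpotent_pow_mod_sub_one (hmem.2 X Y) (h X Y)⟩
    exact absurd (Nat.sInf_le h1) (not_le.mpr (Nat.mod_lt _ hmem.1))

end Exponent

namespace TwistedDouble

variable {k : Type u} [Field k] {G : Type v} [Group G] [Fintype G] [DecidableEq G]
  {ω : NormalizedThreeCocycle G kˣ} {V W U : FinRep k (TwistedDouble ω)}

instance : FiniteDimensional k (TwistedDouble ω) :=
  Module.Finite.of_surjective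
    (Fintype.linearCombination k fun p : G × G => basisElt ω p.1 p.2)
    fun a => ⟨a, (Fintype.linearCombination_apply ..).trans (eq_sum_basisElt a).symm⟩

/-- Coordinates on the twisted double, with values in the universe of `k`. -/
def coord (ω : NormalizedThreeCocycle G kˣ) :
    TwistedDouble ω ≃ₗ[k] (Fin (Module.finrank k (TwistedDouble ω)) → k) :=
  (Module.finBasis k (TwistedDouble ω)).equivFun

/-- The regular representation of the twisted double. -/
def reg (ω : NormalizedThreeCocycle G kˣ) : FinRep k (TwistedDouble ω) where
  carrier := Fin (Module.finrank k (TwistedDouble ω)) → k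
  action := ((coord ω).conjAlgEquiv k).toAlgHom.comp (Algebra.lmul k (TwistedDouble ω))

/-- The linear bijection between the twisted double and its regular representation. -/
def toReg (ω : NormalizedThreeCocycle G kˣ) : TwistedDouble ω ≃ₗ[k] (reg ω).carrier := coord ω

theorem reg_action (a b : TwistedDouble ω) :
    (reg ω).action a (toReg ω b) = toReg ω (a * b) := by
  change coord ω (a * (coord ω).symm (coord ω b)) = _
  rw [LinearEquiv.symm_apply_apply]
  rfl

/-- The vector `e_g # x` of the regular representation. -/
def regElt (ω : NormalizedThreeCocycle G kˣ) (g x : G) : (reg ω).carrier := toReg ω (basisElt ω g x)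

theorem isHomog_regElt (g x : G) : IsHomog (reg ω) g (regElt ω g x) := by
  rw [IsHomog, proj, regElt, reg_action, idem_mul_basisElt, if_pos rfl]

theorem trans_regElt (g x y : G) : trans (reg ω) y (regElt ω g x) =
    ((theta ω (y * g * y⁻¹) y x : kˣ) : k) • regElt ω (y * g * y⁻¹) (y * x) := by
  rw [trans, regElt, reg_action, groupElt_mul_basisElt, map_smul]
  rfl

/-- The coordinate with respect to the basis vector `e_g # x` of the regular representation. -/
def regCoord (ω : NormalizedThreeCocycle G kˣ) (g x : G) : (reg ω).carrier →ₗ[k] k where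
  toFun r := (toReg ω).symm r (g, x)
  map_add' r s := by rw [map_add, add_apply]
  map_smul' c r := by rw [map_smul, smul_apply]; rfl

theorem regCoord_regElt (g x h y : G) :
    regCoord ω g x (regElt ω h y) = if g = h ∧ x = y then 1 else 0 := by
  rw [← basisElt_apply]
  change (toReg ω).symm (toReg ω _) (g, x) = _
  rw [LinearEquiv.symm_apply_apply]

theorem sum_regCoord (r : (reg ω).carrier) :
    ∑ p : G × G, regCoord ω p.1 p.2 r • regElt ω p.1 p.2 = r := by
  obtain ⟨a, rfl⟩ := (toReg ω).surjective r
  conv_rhs => rw [eq_sum_basisElt a, map_sum]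
  refine Finset.sum_congr rfl fun p _ => ?_
  rw [map_smul]
  change (toReg ω).symm (toReg ω a) p • _ = _
  rw [LinearEquiv.symm_apply_apply]
  rfl

theorem sub_one_pow_apply {X : FinRep k (TwistedDouble ω)} (f : End X) {x : X.carrier} {c : k}
    (h : FinRep.Hom.toLin f x = c • x) (n : ℕ) :
    FinRep.Hom.toLin ((f - 1) ^ n) x = (c - 1) ^ n • x := by
  induction n with
  | zero => rw [pow_zero, pow_zero, one_smul]; rfl
  | succ n ih =>
    have : FinRep.Hom.toLin (f - 1) x = (c - 1) • x := by
      rw [sub_smul, one_smul, ← h]; rfl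
    rw [pow_succ', End.mul_def, FinRep.comp_apply, ih, map_smul, this, smul_smul, pow_succ]

/-- If a power of an endomorphism is unipotent, its eigenvalues are `1`. -/
theorem eq_one_of_isNilpotent {X : FinRep k (TwistedDouble ω)} {f : End X} {x : X.carrier} {c : k}
    (hx : x ≠ 0) (h : FinRep.Hom.toLin f x = c • x) (hf : IsNilpotent (f - 1)) : c = 1 := by
  obtain ⟨n, hn⟩ := hf
  have := sub_one_pow_apply f h n
  rw [hn] at this
  have h2 : (c - 1) ^ n • x = 0 := this.symm
  rcases smul_eq_zero.mp h2 with h3 | h3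
  · exact sub_eq_zero.mp (eq_zero_of_pow_eq_zero h3)
  · exact absurd h3 hx

/-- In the copy of the regular representation given by the braiding, the tensor of e_g # 1 and
e_{g'} # 1 is an eigenvector for P(gg')P(g)⁻¹P(g')⁻¹, and a unipotent operator has only the
eigenvalue 1. -/
theorem cyclicProd_mul_of_isNilpotent
    (h : ∀ X Y : Center (FinRep k (TwistedDouble ω)),
      IsNilpotent (doubleBraiding X Y ^ Fintype.card G - 1)) (g g' : G) :
    cyclicProd ω (Fintype.card G) (g * g') =
      cyclicProd ω (Fintype.card G) g * cyclicProd ω (Fintype.card G) g' := by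
  have h1 := h (Center.ofBraidedObj (reg ω)) (Center.ofBraidedObj (reg ω))
  have h2 := braidSq_pow_card (isHomog_regElt (ω := ω) g 1) (isHomog_regElt g' 1)
  have hne : regElt ω g 1 ⊗ₜ[k] regElt ω g' 1 ≠ 0 := fun h0 => by
    have := congrArg (LinearMap.mul' k k ∘ₗ
      TensorProduct.map (regCoord ω g 1) (regCoord ω g' 1)) h0
    rw [LinearMap.comp_apply, TensorProduct.map_tmul, map_zero] at this
    simp [regCoord_regElt] at this
  have h3 := eq_one_of_isNilpotent (X := reg ω ⊗ reg ω) hne h2 h1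
  have h4 := Units.ext (h3.trans Units.val_one.symm)
  rwa [mul_assoc, ← mul_inv, mul_inv_eq_one] at h4

/-- A homomorphism of odd order which is invariant under inversion is trivial. -/
theorem cyclicProd_eq_one_of_odd (hodd : Odd (Fintype.card G))
    (h : ∀ X Y : Center (FinRep k (TwistedDouble ω)),
      IsNilpotent (doubleBraiding X Y ^ Fintype.card G - 1)) (g : G) :
    cyclicProd ω (Fintype.card G) g = 1 := by
  have hmul := cyclicProd_mul_of_isNilpotent h
  have hinv := cyclicProd_inv ω.toCocycle.property ω.map_one_left ω.map_one_right
    (pow_card_eq_one (x := g))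
  have hpow := cyclicProd_pow_eq_one ω.toCocycle.property ω.map_one_left
    (pow_card_eq_one (x := g))
  have hone : cyclicProd ω (Fintype.card G) (1 : G) = 1 := by simp [cyclicProd, ω.map_one_left]
  -- Multiplicativity at g and g⁻¹, together with invariance under inversion.
  have hsq : cyclicProd ω (Fintype.card G) g ^ 2 = 1 := by
    have := hmul g g⁻¹
    rw [mul_inv_cancel, hone, hinv, ← pow_two] at this
    exact this.symm
  have hco : Nat.Coprime 2 (Fintype.card G) := (Nat.coprime_two_left).mpr hodd
  exact (pow_eq_one_iff_of_coprime hco).mp ⟨hsq, hpow⟩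

end TwistedDouble

end TensorExponent

end

/-! ### Double braidings in braided categories and in their centers -/

noncomputable section

namespace TensorExponent

section Braided

theorem comp_pow_eq {C : Type u} [Category.{v} C] {X Y : C} {h : X ⟶ Y} {f : End X} {g : End Y}
    (w : h ≫ g = f ≫ h) (n : ℕ) :
    h ≫ (g ^ n : End Y) = (f ^ n : End X) ≫ h := by
  induction n with
  | zero => rw [pow_zero, pow_zero, End.one_def, End.one_def, Category.comp_id, Category.id_comp]
  | succ n ih =>
    rw [pow_succ, pow_succ, End.mul_def, End.mul_def, ← Category.assoc, w, Category.assoc, ih,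
      Category.assoc]

variable {C : Type u} [Category.{v} C] [MonoidalCategory C] [BraidedCategory C]

theorem braidSq_naturality {X X' Y Y' : C} (f : X ⟶ X') (g : Y ⟶ Y') :
    (f ⊗ₘ g) ≫ braidSq X' Y' = braidSq X Y ≫ (f ⊗ₘ g) := by
  simp [braidSq]

theorem braidSq_pow_swap {X Y : C} {n : ℕ} (h : braidSq X Y ^ n = 1) : braidSq Y X ^ n = 1 := by
  have e : braidSq Y X = (β_ X Y).conj (braidSq X Y) := by
    simp [braidSq, Iso.conj_apply]
  rw [e, ← Iso.conj_pow, h]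
  exact map_one (β_ X Y).conj

/-- If `P` and `Q` centralize each other and the `n`-th powers of the double braidings of `P` and
`Q` with `Y` are trivial, then so is the `n`-th power of the double braiding of `P ⊗ Q` with `Y`. -/
theorem braidSq_tensor_pow {P Q Y : C} {n : ℕ} (hPQ : braidSq P Q = 1) (hP : braidSq P Y ^ n = 1)
    (hQ : braidSq Q Y ^ n = 1) : braidSq (P ⊗ Q) Y ^ n = 1 := by
  set D : End (P ⊗ (Q ⊗ Y)) := (tensorLeft P).mapEnd _ (braidSq Q Y) with hD
  set E : End (P ⊗ (Q ⊗ Y)) := braidSq P (Q ⊗ Y) with hE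
  -- By the hexagons P crosses Y, then Q, and returns; the two crossings of P with Q are adjacent
  -- and cancel by `hPQ`.
  have e1 : braidSq P (Y ⊗ Q) = (α_ P Y Q).conj ((tensorRight Q).mapEnd _ (braidSq P Y)) := by
    change _ = (α_ P Y Q).inv ≫ braidSq P Y ▷ Q ≫ (α_ P Y Q).hom
    have hPQ' : (β_ P Q).hom ≫ (β_ Q P).hom = 𝟙 _ := hPQ
    simp only [braidSq, BraidedCategory.braiding_tensor_right_hom,
      BraidedCategory.braiding_tensor_left_hom, Category.assoc, Iso.inv_hom_id_assoc]
    rw [← MonoidalCategory.whiskerLeft_comp_assoc, hPQ', MonoidalCategory.whiskerLeft_id,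
      Category.id_comp, Iso.hom_inv_id_assoc, MonoidalCategory.comp_whiskerRight_assoc]
  have e2 : E = (whiskerLeftIso P (β_ Q Y)).symm.conj (braidSq P (Y ⊗ Q)) := by
    have := braidSq_naturality (𝟙 P) (β_ Q Y).hom
    rw [MonoidalCategory.id_tensorHom] at this
    change E = P ◁ (β_ Q Y).hom ≫ braidSq P (Y ⊗ Q) ≫ P ◁ (β_ Q Y).inv
    rw [← Category.assoc, this, Category.assoc, ← MonoidalCategory.whiskerLeft_comp,
      Iso.hom_inv_id, MonoidalCategory.whiskerLeft_id, Category.comp_id]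
  have hEn : E ^ n = 1 := by
    rw [e2, e1, ← map_pow, ← map_pow, ← map_pow, hP, map_one, map_one, map_one]
  have hDn : D ^ n = 1 := by
    rw [hD, ← map_pow, hQ, map_one]
  -- Naturality of the double braiding of P, along the double braiding of Q with Y.
  have hDE : Commute D E := by
    have := braidSq_naturality (𝟙 P) (braidSq Q Y : Q ⊗ Y ⟶ Q ⊗ Y)
    rw [MonoidalCategory.id_tensorHom] at this
    exact this.symm
  -- Up to reassociation, going around P ⊗ Q means going around Q and P separately.
  have e3 : braidSq (P ⊗ Q) Y = (α_ P Q Y).symm.conj (D * E) := by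
    rw [e2, e1, hD]
    simp [braidSq, Iso.conj_apply, End.mul_def, Functor.mapEnd]
  rw [e3, ← Iso.conj_pow, hDE.mul_pow, hDn, hEn, mul_one]
  exact map_one _

end Braided

section Center

variable {C : Type u} [Category.{v} C] [MonoidalCategory C]

theorem doubleBraiding_pow (X Y : Center C) (n : ℕ) :
    doubleBraiding X Y ^ n = Center.Hom.f (braidSq X Y ^ n) :=
  (map_pow ((Center.forget C).mapEnd (X ⊗ Y)) (braidSq X Y) n).symm

variable [BraidedCategory C]

/-- An object of a braided category with the half braiding given by the inverse braiding. -/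
def ofReverse (X : C) : Center C :=
  letI := reverseBraiding C
  Center.ofBraidedObj X

theorem ofBraidedObj_braidSq_pow {X Y : C} {n : ℕ} (h : braidSq X Y ^ n = 1) :
    braidSq (Center.ofBraidedObj X) (Center.ofBraidedObj Y) ^ n = 1 := by
  apply Center.ext
  rw [← doubleBraiding_pow]
  exact h

/-- The double braiding formed from the inverse braiding is the inverse of the original one. -/
theorem ofReverse_braidSq_pow {X Y : C} {n : ℕ} (h : braidSq X Y ^ n = 1) :
    braidSq (ofReverse X) (ofReverse Y) ^ n = 1 := by
  apply Center.ext
  rw [← doubleBraiding_pow]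
  let d : End (X ⊗ Y) := doubleBraiding (ofReverse X) (ofReverse Y)
  change d ^ n = 1
  have e : d * braidSq X Y = 1 := by
    change ((β_ X Y).hom ≫ (β_ Y X).hom) ≫ (β_ Y X).inv ≫ (β_ X Y).inv = 𝟙 _
    simp
  have e' : braidSq X Y * d = 1 := by
    change ((β_ Y X).inv ≫ (β_ X Y).inv) ≫ (β_ X Y).hom ≫ (β_ Y X).hom = 𝟙 _
    simp
  have comm : Commute d (braidSq X Y) := e.trans e'.symm
  have := comm.mul_pow n
  rw [e, one_pow, h, mul_one] at this
  exact this.symm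

theorem ofBraidedObj_ofReverse_braidSq (X Y : C) :
    braidSq (Center.ofBraidedObj X) (ofReverse Y) = 1 := by
  apply Center.ext
  change (β_ X Y).hom ≫ (β_ X Y).inv = 𝟙 _
  simp

/-- `braidSq_tensor_pow` in both variables reduces the claim to four pairs of factors: the two pairs
within one copy are covered by `h`, and in the two mixed pairs the factors centralize each other. -/
theorem braidSq_mixed_pow {X X' Y Y' : C} {n : ℕ} (h : ∀ A B : C, braidSq A B ^ n = 1) :
    braidSq (Center.ofBraidedObj X ⊗ ofReverse X') (Center.ofBraidedObj Y ⊗ ofReverse Y') ^ n =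
      1 := by
  have h1 (A B : C) : braidSq (Center.ofBraidedObj A) (ofReverse B) ^ n = 1 := by
    rw [ofBraidedObj_ofReverse_braidSq, one_pow]
  have h2 (A B : C) := ofBraidedObj_braidSq_pow (h A B)
  have h3 (A B : C) := ofReverse_braidSq_pow (h A B)
  have h4 (A B : C) := ofBraidedObj_ofReverse_braidSq A B
  exact braidSq_tensor_pow (h4 X X')
    (braidSq_pow_swap (braidSq_tensor_pow (h4 Y Y') (h2 _ _) (braidSq_pow_swap (h1 _ _))))
    (braidSq_pow_swap (braidSq_tensor_pow (h4 Y Y') (h1 _ _) (h3 _ _)))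

end Center

end TensorExponent

end

/-! ### Half braidings encoded by linear operators -/

noncomputable section

namespace TensorExponent.TwistedDouble

variable {k : Type u} [Field k] {G : Type v} [Group G] [Fintype G] [DecidableEq G]
  {ω : NormalizedThreeCocycle G kˣ} {V W U : FinRep k (TwistedDouble ω)}

theorem reg_ext {M : Type*} [AddCommGroup M] [Module k M] {f f' : (reg ω).carrier →ₗ[k] M}
    (h : ∀ g x, f (regElt ω g x) = f' (regElt ω g x)) : f = f' := by
  ext1 r
  rw [← sum_regCoord r, map_sum, map_sum]
  simp only [map_smul, h]

theorem trans_regElt_one (g y : G) :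
    trans (reg ω) y (regElt ω g 1) = regElt ω (y * g * y⁻¹) y := by
  rw [trans_regElt, theta_one_right, Units.val_one, one_smul, mul_one]

/-- The coefficient in `V` of `e_g # x` of an element of `reg ⊗ V`. -/
def tcoord (V : FinRep k (TwistedDouble ω)) (g x : G) :
    (reg ω).carrier ⊗[k] V.carrier →ₗ[k] V.carrier :=
  (TensorProduct.lid k V.carrier).toLinearMap ∘ₗ
    TensorProduct.map (regCoord ω g x) LinearMap.id

theorem tcoord_tmul (g x : G) (r : (reg ω).carrier) (v : V.carrier) :
    tcoord V g x (r ⊗ₜ v) = regCoord ω g x r • v := by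
  simp [tcoord]

theorem sum_tcoord (t : (reg ω).carrier ⊗[k] V.carrier) :
    ∑ p : G × G, regElt ω p.1 p.2 ⊗ₜ[k] tcoord V p.1 p.2 t = t := by
  induction t with
  | zero => simp
  | add s t hs ht =>
    simp only [map_add, TensorProduct.tmul_add, Finset.sum_add_distrib, hs, ht]
  | tmul r v =>
    simp only [tcoord_tmul, TensorProduct.tmul_smul]
    conv_rhs => rw [← sum_regCoord r, TensorProduct.sum_tmul]
    rfl

theorem proj_tcoord (g x m : G) (t : (reg ω).carrier ⊗[k] V.carrier) :
    proj V (g⁻¹ * m) (tcoord V g x t) =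
      tcoord V g x ((proj (reg ω ⊗ V) m : Module.End k ((reg ω).carrier ⊗[k] V.carrier)) t) := by
  rw [← LinearMap.comp_apply, ← LinearMap.comp_apply]
  congr 1
  apply TensorProduct.ext
  refine reg_ext fun h y => linearMap_ext_homog fun l v hv => ?_
  have h1 := (isHomog_regElt (ω := ω) h y).tmul hv
  have h2 := h1.proj_eq m
  change proj V (g⁻¹ * m) (tcoord V g x (regElt ω h y ⊗ₜ v)) =
    tcoord V g x ((proj (reg ω ⊗ V) m) (regElt ω h y ⊗ₜ[k] v))
  refine Eq.trans ?_ (congrArg (tcoord V g x) h2).symm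
  rw [tcoord_tmul, map_smul, hv.proj_eq, regCoord_regElt]
  by_cases hg : g = h
  · subst hg
    by_cases hm : m = g * l
    · rw [if_pos hm, if_pos (c := g⁻¹ * m = l) (by rw [hm, inv_mul_cancel_left]), tcoord_tmul,
        regCoord_regElt]
    · rw [if_neg hm, if_neg (c := g⁻¹ * m = l) (fun h => hm (by rw [← h, mul_inv_cancel_left])),
        smul_zero, map_zero]
  · rw [if_neg (fun h => hg h.1), zero_smul]
    split_ifs
    · rw [tcoord_tmul, regCoord_regElt, if_neg (fun h => hg h.1), zero_smul]
    · rw [map_zero]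

theorem isHomog_tcoord {m : G} {t : (reg ω).carrier ⊗[k] V.carrier}
    (ht : IsHomog (reg ω ⊗ V) m t) (g x : G) : IsHomog V (g⁻¹ * m) (tcoord V g x t) := by
  rw [IsHomog, proj_tcoord]
  exact congrArg _ ht

/-- The morphism `a ↦ a w` from the regular representation. -/
def orbit (w : W.carrier) : reg ω ⟶ W where
  toLin := (LinearMap.applyₗ w ∘ₗ W.action.toLinearMap) ∘ₗ (toReg ω).symm.toLinearMap
  comm a := by
    ext1 r
    obtain ⟨b, rfl⟩ := (toReg ω).surjective r
    change W.action ((toReg ω).symm ((reg ω).action a (toReg ω b))) w =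
      W.action a (W.action ((toReg ω).symm (toReg ω b)) w)
    rw [reg_action, LinearEquiv.symm_apply_apply, LinearEquiv.symm_apply_apply, action_mul_apply]

theorem orbit_toReg (w : W.carrier) (a : TwistedDouble ω) :
    (orbit w).toLin (toReg ω a) = W.action a w := by
  change W.action ((toReg ω).symm (toReg ω a)) w = _
  rw [LinearEquiv.symm_apply_apply]

section HalfBraiding

variable (X : Center (FinRep k (TwistedDouble ω)))

/-- The half braiding of an object of the center, as a linear map. -/
def halfLin (W : FinRep k (TwistedDouble ω)) :
    X.1.carrier ⊗[k] W.carrier →ₗ[k] W.carrier ⊗[k] X.1.carrier := (X.2.β W).hom.toLin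

/-- The operators which determine a half braiding. -/
def halfOp (g x : G) : X.1.carrier →ₗ[k] X.1.carrier :=
  tcoord X.1 g x ∘ₗ halfLin X (reg ω) ∘ₗ
    (TensorProduct.mk k X.1.carrier (reg ω).carrier).flip (toReg ω 1)

variable {X}

/-- Naturality along `orbit w`, which carries 1 to w: a half braiding is determined by its values on
v ⊗ 1 in X ⊗ reg. -/
theorem halfLin_tmul (v : X.1.carrier) (w : W.carrier) : halfLin X W (v ⊗ₜ w) =
    ∑ p : G × G, W.action (basisElt ω p.1 p.2) w ⊗ₜ[k] halfOp X p.1 p.2 v := by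
  have h1 := congrArg (fun f : (X.1 ⊗ reg ω) ⟶ (W ⊗ X.1) => f.toLin (v ⊗ₜ[k] toReg ω 1))
    (X.2.naturality (orbit w))
  have h2 : halfLin X W (v ⊗ₜ (orbit w).toLin (toReg ω 1)) =
    TensorProduct.map (orbit w).toLin LinearMap.id (halfLin X (reg ω) (v ⊗ₜ toReg ω 1)) := h1
  rw [orbit_toReg, map_one] at h2
  refine h2.trans ?_
  rw [← sum_tcoord (halfLin X (reg ω) (v ⊗ₜ toReg ω 1)), map_sum]
  refine Finset.sum_congr rfl fun p _ => ?_
  rw [TensorProduct.map_tmul, regElt, orbit_toReg]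
  rfl

theorem halfLin_tmul_homog {g : G} (v : X.1.carrier) {w : W.carrier} (hw : IsHomog W g w) :
    halfLin X W (v ⊗ₜ w) = ∑ x : G, trans W x w ⊗ₜ[k] halfOp X (x * g * x⁻¹) x v := by
  rw [halfLin_tmul, Fintype.sum_prod_type, Finset.sum_comm]
  refine Finset.sum_congr rfl fun x _ => ?_
  rw [Finset.sum_eq_single (x * g * x⁻¹)]
  · rw [hw.action_basisElt_eq, if_pos rfl]
  · intro h _ hh
    rw [hw.action_basisElt_eq, if_neg hh, TensorProduct.zero_tmul]
  · simp

theorem tcoord_halfLin (v : X.1.carrier) (g x : G) :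
    tcoord X.1 (x * g * x⁻¹) x (halfLin X (reg ω) (v ⊗ₜ regElt ω g 1)) =
      halfOp X (x * g * x⁻¹) x v := by
  rw [halfLin_tmul_homog v (isHomog_regElt g 1), map_sum, Finset.sum_eq_single x]
  · rw [tcoord_tmul, trans_regElt_one, regCoord_regElt, if_pos ⟨rfl, rfl⟩, one_smul]
  · intro y _ hy
    rw [tcoord_tmul, trans_regElt_one, regCoord_regElt, if_neg fun h => hy h.2.symm, zero_smul]
  · simp

theorem isHomog_halfLin {g h : G} {v : X.1.carrier} {w : W.carrier} (hv : IsHomog X.1 g v)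
    (hw : IsHomog W h w) : IsHomog (W ⊗ X.1) (g * h) (halfLin X W (v ⊗ₜ w)) :=
  (hv.tmul hw).map (X.2.β W).hom

theorem isHomog_halfOp {l : G} {v : X.1.carrier} (hv : IsHomog X.1 l v) (g x : G) :
    IsHomog X.1 ((x * g * x⁻¹)⁻¹ * (l * g)) (halfOp X (x * g * x⁻¹) x v) := by
  rw [← tcoord_halfLin]
  exact isHomog_tcoord (isHomog_halfLin hv (isHomog_regElt g 1)) _ _

/-- The monoidality axiom of the half braiding on homogeneous vectors; the three values of ω come
from the three associators. -/
theorem halfLin_tensor {g h l : G} {v : X.1.carrier} {w : W.carrier} {u : U.carrier}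
    (hv : IsHomog X.1 l v) (hw : IsHomog W g w) (hu : IsHomog U h u) :
    halfLin X (W ⊗ U) (v ⊗ₜ[k] (w ⊗ₜ[k] u)) = ∑ x : G, ∑ y : G,
      (((ω l g h) * (ω (x * g * x⁻¹) ((x * g * x⁻¹)⁻¹ * (l * g)) h)⁻¹ *
        ω (x * g * x⁻¹) (y * h * y⁻¹)
          ((y * h * y⁻¹)⁻¹ * ((x * g * x⁻¹)⁻¹ * (l * g) * h)) : kˣ) : k) •
      ((trans W x w ⊗ₜ[k] trans U y u) ⊗ₜ[k]
        halfOp X (y * h * y⁻¹) y (halfOp X (x * g * x⁻¹) x v)) := by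
  have h1 := congrArg (fun f => FinRep.Hom.toLin f (v ⊗ₜ[k] (w ⊗ₜ[k] u))) (X.2.monoidal W U)
  refine h1.trans ?_
  rw [FinRep.comp_apply, FinRep.comp_apply, FinRep.comp_apply, FinRep.comp_apply,
    associator_inv_tmul hv hw hu, map_smul, FinRep.whiskerRight_apply]
  have h2 : (X.2.β W).hom.toLin (v ⊗ₜ[k] w) =
    ∑ x : G, trans W x w ⊗ₜ[k] halfOp X (x * g * x⁻¹) x v := halfLin_tmul_homog v hw
  rw [h2, TensorProduct.sum_tmul]
  simp only [map_sum, map_smul, Finset.smul_sum]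
  refine Finset.sum_congr rfl fun x _ => ?_
  have hv1 := isHomog_halfOp hv g x
  rw [associator_hom_tmul (hw.trans x) hv1 hu, map_smul, FinRep.whiskerLeft_apply]
  have h3 : (X.2.β U).hom.toLin (halfOp X (x * g * x⁻¹) x v ⊗ₜ[k] u) =
    ∑ y : G, trans U y u ⊗ₜ[k] halfOp X (y * h * y⁻¹) y (halfOp X (x * g * x⁻¹) x v) :=
    halfLin_tmul_homog _ hu
  rw [h3, TensorProduct.tmul_sum]
  simp only [map_sum, map_smul, Finset.smul_sum]
  refine Finset.sum_congr rfl fun y _ => ?_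
  rw [associator_inv_tmul (hw.trans x) (hu.trans y) (isHomog_halfOp hv1 h y), smul_smul, smul_smul,
    ← Units.val_mul, ← Units.val_mul, mul_assoc]

/-- The composition rule for the operators of a half braiding. -/
theorem halfOp_halfOp {l : G} {v : X.1.carrier} (hv : IsHomog X.1 l v) (g h x y : G) :
    (((ω l g h) * (ω (x * g * x⁻¹) ((x * g * x⁻¹)⁻¹ * (l * g)) h)⁻¹ *
        ω (x * g * x⁻¹) (y * h * y⁻¹)
          ((y * h * y⁻¹)⁻¹ * ((x * g * x⁻¹)⁻¹ * (l * g) * h)) : kˣ) : k) •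
      halfOp X (y * h * y⁻¹) y (halfOp X (x * g * x⁻¹) x v) =
    if x = y then ((gamma ω x (x * g * x⁻¹) (x * h * x⁻¹) : kˣ) : k) •
      halfOp X (x * (g * h) * x⁻¹) x v else 0 := by
  have hg := isHomog_regElt (ω := ω) g 1
  have hh := isHomog_regElt (ω := ω) h 1
  have h1 := halfLin_tensor hv hg hh
  have h2 := halfLin_tmul_homog (X := X) v (hg.tmul hh)
  have h3 := h2.symm.trans h1
  -- This functional extracts the coefficient of (e_{xgx⁻¹} # x) ⊗ (e_{yhy⁻¹} # y). Acting directly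
  -- on W ⊗ U involves one group element for both factors, so that side contributes only for x = y.
  set F : ((reg ω).carrier ⊗[k] (reg ω).carrier) ⊗[k] X.1.carrier →ₗ[k] X.1.carrier :=
    (TensorProduct.lid k X.1.carrier).toLinearMap ∘ₗ TensorProduct.map
      (LinearMap.mul' k k ∘ₗ
        TensorProduct.map (regCoord ω (x * g * x⁻¹) x) (regCoord ω (y * h * y⁻¹) y)) LinearMap.id
    with hF
  have F_apply (r s : (reg ω).carrier) (u : X.1.carrier) : F ((r ⊗ₜ s) ⊗ₜ u) =
      (regCoord ω (x * g * x⁻¹) x r * regCoord ω (y * h * y⁻¹) y s) • u := by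
    simp [hF]
  have h4 := congrArg F h3
  rw [map_sum, map_sum, Finset.sum_eq_single x, Finset.sum_eq_single x, map_sum,
    Finset.sum_eq_single y] at h4
  · rw [map_smul, F_apply, trans_regElt_one, trans_regElt_one, regCoord_regElt, regCoord_regElt,
      if_pos ⟨rfl, rfl⟩, if_pos ⟨rfl, rfl⟩, one_mul, one_smul] at h4
    rw [← h4, trans_tmul hg hh, ← TensorProduct.smul_tmul', map_smul, F_apply, trans_regElt_one,
      trans_regElt_one, regCoord_regElt, regCoord_regElt, if_pos ⟨rfl, rfl⟩, one_mul]
    by_cases hxy : x = y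
    · subst hxy
      rw [if_pos ⟨rfl, rfl⟩, if_pos rfl, one_smul]
    · rw [if_neg hxy, if_neg fun h => hxy h.2.symm, zero_smul, smul_zero]
  · intro z _ hz
    rw [map_smul, F_apply, trans_regElt_one, trans_regElt_one, regCoord_regElt, regCoord_regElt,
      if_neg (c := _ ∧ y = z) (fun h => hz h.2.symm), mul_zero, zero_smul, smul_zero]
  · simp
  · intro z _ hz
    rw [map_sum]
    refine Finset.sum_eq_zero fun y' _ => ?_
    rw [map_smul, F_apply, trans_regElt_one, regCoord_regElt,
      if_neg (fun h => hz h.2.symm), zero_mul, zero_smul, smul_zero]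
  · simp
  · intro z _ hz
    rw [trans_tmul hg hh, ← TensorProduct.smul_tmul', map_smul, F_apply, trans_regElt_one,
      regCoord_regElt, if_neg (fun h => hz h.2.symm), zero_mul, zero_smul, smul_zero]
  · simp

/-- For g = 1 normalization removes all scalars. At h = 1 this says that the operators `halfOp X 1
x` are orthogonal idempotents on each homogeneous part. -/
theorem halfOp_halfOp_one {l : G} {v : X.1.carrier} (hv : IsHomog X.1 l v) (h x y : G) :
    halfOp X h y (halfOp X 1 x v) = if x = y then halfOp X h y v else 0 := by
  have key := halfOp_halfOp hv 1 (y⁻¹ * h * y) x y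
  have e : y * (y⁻¹ * h * y) * y⁻¹ = h := by group
  simp only [mul_one, mul_inv_cancel, ω.map_one_left, ω.map_one_middle, inv_one, Units.val_one,
    one_smul, gamma_one_left, one_mul, e] at key
  rw [key]
  split_ifs with hxy
  · subst hxy
    rw [e]
  · rfl

end HalfBraiding

end TensorExponent.TwistedDouble

end

/-! ### Averaging to a morphism from the unit; evaluation and contraction -/

noncomputable section

namespace TensorExponent

namespace TwistedDouble

variable {k : Type u} [Field k] {G : Type v} [Group G] [Fintype G] [DecidableEq G]
  {ω : NormalizedThreeCocycle G kˣ} {V W U : FinRep k (TwistedDouble ω)}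

section Invariant

variable {Z : Center (FinRep k (TwistedDouble ω))} {z : Z.1.carrier}

theorem isHomog_halfOp_one (hz : IsHomog Z.1 1 z) (g : G) : IsHomog Z.1 1 (halfOp Z g 1 z) := by
  simpa using isHomog_halfOp hz g 1

theorem halfOp_eq_zero {l a : G} {v : Z.1.carrier} (hv : IsHomog Z.1 l v)
    (h : ∀ x, halfOp Z 1 x v = if x = a then v else 0) {y : G} (hy : y ≠ a) (g : G) :
    halfOp Z g y v = 0 := by
  have := halfOp_halfOp_one hv g a y
  rwa [h, if_pos rfl, if_neg hy.symm] at this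

/-- In degree 1 every value of ω in `halfOp_halfOp` has an argument equal to 1, so these operators
compose without scalars and can be averaged. -/
theorem halfOp_mul (hz : IsHomog Z.1 1 z) (g h : G) :
    halfOp Z h 1 (halfOp Z g 1 z) = halfOp Z (g * h) 1 z := by
  have := halfOp_halfOp hz g h 1 1
  simpa [ω.map_one_left, ω.map_one_middle, ω.map_one_right] using this

theorem halfOp_halfOp_eq_zero (hz : IsHomog Z.1 1 z) (g h : G) {y : G} (hy : y ≠ 1) :
    halfOp Z h y (halfOp Z g 1 z) = 0 := by
  have := halfOp_halfOp hz g (y⁻¹ * h * y) 1 y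
  have e : y * (y⁻¹ * h * y) * y⁻¹ = h := by group
  rw [if_neg hy.symm, e, one_mul, inv_one, mul_one] at this
  exact (smul_eq_zero.mp this).resolve_left (Units.ne_zero _)

theorem trans_tmul_of_isHomog_one {v : V.carrier} {w : W.carrier} (hv : IsHomog V 1 v)
    (x : G) : trans (V ⊗ W) x (v ⊗ₜ[k] w) = trans V x v ⊗ₜ[k] trans W x w := by
  rw [← sum_proj W w, TensorProduct.tmul_sum, map_sum, map_sum, TensorProduct.tmul_sum]
  refine Finset.sum_congr rfl fun h _ => ?_
  rw [trans_tmul hv (isHomog_proj W h w)]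
  simp

theorem trans_tmul_of_isHomog_one' {v : V.carrier} {w : W.carrier} (hw : IsHomog W 1 w)
    (x : G) : trans (V ⊗ W) x (v ⊗ₜ[k] w) = trans V x v ⊗ₜ[k] trans W x w := by
  rw [← sum_proj V v, TensorProduct.sum_tmul, map_sum, map_sum, TensorProduct.sum_tmul]
  refine Finset.sum_congr rfl fun h _ => ?_
  rw [trans_tmul (isHomog_proj V h v) hw]
  simp

theorem trans_trans_of_isHomog_one {v : V.carrier} (hv : IsHomog V 1 v) (x y : G) :
    trans V x (trans V y v) = trans V (x * y) v := by
  rw [hv.trans_trans]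
  simp

/-- The average of a vector over the operators of the half braiding and over the group. -/
def average (Z : Center (FinRep k (TwistedDouble ω))) (z : Z.1.carrier) : Z.1.carrier :=
  ∑ x, ∑ g, trans Z.1 x (halfOp Z g 1 z)

theorem isHomog_average (hz : IsHomog Z.1 1 z) : IsHomog Z.1 1 (average Z z) :=
  IsHomog.sum fun x _ => IsHomog.sum fun g _ => (isHomog_halfOp_one hz g).trans' x (by simp)

theorem trans_average (hz : IsHomog Z.1 1 z) (y : G) :
    trans Z.1 y (average Z z) = average Z z := by
  rw [average, map_sum]
  simp only [map_sum, trans_trans_of_isHomog_one (isHomog_halfOp_one hz _)]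
  exact Equiv.sum_comp (Equiv.mulLeft y) (fun x => ∑ g, trans Z.1 x (halfOp Z g 1 z))

/-- The inner sum over g commutes trivially past w by reindexing. The half braiding commutes with
translations, which act on tensors with a degree 1 vector without scalars; so each translate of the
inner sum has the same property. -/
theorem halfLin_average (hz : IsHomog Z.1 1 z) (w : W.carrier) :
    halfLin Z W (average Z z ⊗ₜ w) = w ⊗ₜ average Z z := by
  have h0 (x g : G) : IsHomog Z.1 1 (trans Z.1 x (halfOp Z g 1 z)) :=
    (isHomog_halfOp_one hz g).trans' x (by simp)
  have h1 (w : W.carrier) : halfLin Z W ((∑ g, halfOp Z g 1 z) ⊗ₜ w) =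
      w ⊗ₜ ∑ g, halfOp Z g 1 z := by
    rw [halfLin_tmul, Fintype.sum_prod_type]
    conv_rhs => rw [← sum_proj W w, TensorProduct.sum_tmul]
    refine Finset.sum_congr rfl fun h _ => ?_
    rw [Finset.sum_eq_single 1]
    · rw [map_sum]
      simp only [halfOp_mul hz]
      exact congrArg _ (Equiv.sum_comp (Equiv.mulRight h) (fun g => halfOp Z g 1 z))
    · intro y _ hy
      rw [map_sum, Finset.sum_eq_zero fun g _ => halfOp_halfOp_eq_zero hz g h hy,
        TensorProduct.tmul_zero]
    · simp
  have h2 : IsHomog Z.1 1 (∑ g, halfOp Z g 1 z) := IsHomog.sum fun g _ => isHomog_halfOp_one hz g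
  rw [average, TensorProduct.sum_tmul, map_sum, TensorProduct.tmul_sum]
  refine Finset.sum_congr rfl fun x _ => ?_
  -- Writing w as a translate lets x act on the whole tensor.
  obtain ⟨w, rfl⟩ := trans_surjective W x w
  rw [← map_sum, ← trans_tmul_of_isHomog_one h2, ← trans_tmul_of_isHomog_one' h2, ← h1]
  exact hom_trans (Z.2.β W).hom x _

theorem action_average (hz : IsHomog Z.1 1 z) (a : TwistedDouble ω) :
    Z.1.action a (average Z z) = counitHom ω a • average Z z := by
  rw [eq_sum_basisElt a]
  simp only [map_sum, map_smul, LinearMap.sum_apply, LinearMap.smul_apply, counitHom_basisElt,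
    (isHomog_average hz).action_basisElt_eq, trans_average hz, Finset.sum_smul, smul_assoc]
  refine Finset.sum_congr rfl fun p _ => congrArg _ ?_
  by_cases hp : p.1 = 1 <;> simp [hp]

/-- The average of a suitable vector defines a morphism from the unit object of the center. -/
def averageHom (hz : IsHomog Z.1 1 z) : 𝟙_ (Center (FinRep k (TwistedDouble ω))) ⟶ Z where
  f :=
    { toLin := LinearMap.toSpanSingleton k Z.1.carrier (average Z z)
      comm := fun a => LinearMap.ext_ring (by
        change (counitHom ω a * 1) • average Z z = Z.1.action a ((1 : k) • average Z z)
        rw [one_smul, action_average hz, mul_one]) }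
  comm U := FinRep.hom_ext <| TensorProduct.ext' fun (c : k) u => by
    change halfLin Z U ((c • average Z z) ⊗ₜ u) = (c • u) ⊗ₜ ((1 : k) • average Z z)
    rw [← TensorProduct.smul_tmul', map_smul, halfLin_average hz, one_smul,
      TensorProduct.smul_tmul']

theorem averageHom_apply (hz : IsHomog Z.1 1 z) (c : k) :
    (averageHom hz).f.toLin c = c • average Z z := rfl

end Invariant

section Evaluation

/-- The pairing `(e_g # x) ⊗ (e_h # y) ↦ δ_{x, y} δ_{gh, 1} γ_x(g, h)⁻¹`. -/
def evalLin (ω : NormalizedThreeCocycle G kˣ) : (reg ω).carrier ⊗[k] (reg ω).carrier →ₗ[k] k :=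
  ∑ g, ∑ x, (((gamma ω x g g⁻¹)⁻¹ : kˣ) : k) •
    (LinearMap.mul' k k ∘ₗ TensorProduct.map (regCoord ω g x) (regCoord ω g⁻¹ x))

theorem evalLin_regElt (g x h y : G) : evalLin ω (regElt ω g x ⊗ₜ regElt ω h y) =
    if h = g⁻¹ ∧ x = y then (((gamma ω x g g⁻¹)⁻¹ : kˣ) : k) else 0 := by
  simp only [evalLin, LinearMap.sum_apply, LinearMap.smul_apply, LinearMap.comp_apply,
    TensorProduct.map_tmul, LinearMap.mul'_apply, regCoord_regElt]
  rw [Finset.sum_eq_single g, Finset.sum_eq_single x]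
  · by_cases h1 : h = g⁻¹ <;> by_cases h2 : x = y <;> simp [h1, h2, eq_comm]
  · intro b _ hb; simp [hb]
  · simp
  · intro b _ hb; simp [hb]
  · simp

/-- When g and h are inverse, `theta_gamma` has θ₁ = 1 on one side, and the normalization by γ_x(g,
g⁻¹)⁻¹ absorbs the remaining scalars. -/
theorem evalLin_trans (g x h y z : G) :
    ((gamma ω z (z * g * z⁻¹) (z * h * z⁻¹) : kˣ) : k) •
      evalLin ω (trans (reg ω) z (regElt ω g x) ⊗ₜ trans (reg ω) z (regElt ω h y)) =
        evalLin ω (regElt ω g x ⊗ₜ regElt ω h y) := by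
  rw [trans_regElt, trans_regElt, TensorProduct.smul_tmul_smul, map_smul, evalLin_regElt,
    evalLin_regElt]
  by_cases hxy : x = y
  · by_cases hgh : h = g⁻¹
    · subst hxy hgh
      have e : z * g⁻¹ * z⁻¹ = (z * g * z⁻¹)⁻¹ := by group
      rw [if_pos ⟨e, rfl⟩, if_pos ⟨rfl, rfl⟩, smul_eq_mul, smul_eq_mul, ← Units.val_mul,
        ← Units.val_mul, ← Units.val_mul]
      congr 1
      have key := theta_gamma ω (z * g * z⁻¹) (z * g⁻¹ * z⁻¹) z x
      have e1 : z⁻¹ * (z * g * z⁻¹) * z = g := by group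
      have e2 : z⁻¹ * (z * g⁻¹ * z⁻¹) * z = g⁻¹ := by group
      have e3 : z * g * z⁻¹ * (z * g⁻¹ * z⁻¹) = 1 := by group
      rw [e1, e2, e3, theta_one_base, mul_one] at key
      rw [← e, eq_inv_iff_mul_eq_one,
        ← mul_inv_cancel (gamma ω (z * x) (z * g * z⁻¹) (z * g⁻¹ * z⁻¹)),
        ← key]
      apply Additive.ofMul.injective
      simp only [ofMul_mul, ofMul_inv]
      abel
    · rw [if_neg (c := h = g⁻¹ ∧ _) fun h => hgh h.1, if_neg, smul_zero, smul_zero]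
      rintro ⟨h1, -⟩
      apply hgh
      have := congrArg (fun t => z⁻¹ * t * z) h1
      simpa [mul_assoc] using this
  · rw [if_neg fun h => hxy (mul_left_cancel h.2), if_neg fun h => hxy h.2, smul_zero, smul_zero]

/-- The pairing as a morphism to the unit object. -/
def evalHom (ω : NormalizedThreeCocycle G kˣ) : reg ω ⊗ reg ω ⟶
    𝟙_ (FinRep k (TwistedDouble ω)) where
  toLin := evalLin ω
  comm a := by
    apply TensorProduct.ext
    refine reg_ext fun g x => reg_ext fun h y => ?_
    change evalLin ω ((reg ω ⊗ reg ω).action a (regElt ω g x ⊗ₜ[k] regElt ω h y)) =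
      counitHom ω a * evalLin ω (regElt ω g x ⊗ₜ[k] regElt ω h y)
    rw [eq_sum_basisElt a]
    simp only [map_sum, map_smul, LinearMap.sum_apply, LinearMap.smul_apply, counitHom_basisElt,
      Finset.sum_mul, smul_mul_assoc]
    refine Finset.sum_congr rfl fun p _ => congrArg _ ?_
    have key := tensor_action_homog (isHomog_regElt (ω := ω) g x) (isHomog_regElt h y) p.1 p.2
    refine (congrArg (evalLin ω) key).trans ?_
    by_cases hgh : g * h = 1
    · rw [hgh, mul_one, mul_inv_cancel]
      split_ifs
      · rw [map_smul, evalLin_trans, one_mul]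
      · rw [map_zero, zero_mul]
    · have h0 : evalLin ω (regElt ω g x ⊗ₜ[k] regElt ω h y) = 0 := by
        rw [evalLin_regElt, if_neg]
        rintro ⟨rfl, -⟩
        exact hgh (mul_inv_cancel g)
      rw [h0, mul_zero]
      split_ifs
      · rw [map_smul, evalLin_trans, h0]
      · rw [map_zero]

end Evaluation

end TwistedDouble

section Contraction

variable {C : Type u} [Category.{v} C] [MonoidalCategory C] [BraidedCategory C]

/-- A pairing in a braided category defines a contraction in the center. -/
def contraction {X Y : C} (e : X ⊗ Y ⟶ 𝟙_ C) (Z : Center C) :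
    Center.ofBraidedObj X ⊗ (Center.ofBraidedObj Y ⊗ Z) ⟶ Z :=
  (α_ _ _ _).inv ≫ (Functor.LaxMonoidal.μ (Center.ofBraided C) X Y ≫ (Center.ofBraided C).map e ≫
    Functor.OplaxMonoidal.η (Center.ofBraided C)) ▷ Z ≫ (λ_ Z).hom

theorem contraction_f {X Y : C} (e : X ⊗ Y ⟶ 𝟙_ C) (Z : Center C) :
    (contraction e Z).f = (α_ X Y Z.1).inv ≫ e ▷ Z.1 ≫ (λ_ Z.1).hom := by
  have : (Functor.LaxMonoidal.μ (Center.ofBraided C) X Y ≫ (Center.ofBraided C).map e ≫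
    Functor.OplaxMonoidal.η (Center.ofBraided C)).f = e := by
    change 𝟙 _ ≫ e ≫ 𝟙 _ = e
    simp
  have h2 : (contraction e Z).f = (α_ X Y Z.1).inv ≫
      (Functor.LaxMonoidal.μ (Center.ofBraided C) X Y ≫ (Center.ofBraided C).map e ≫
        Functor.OplaxMonoidal.η (Center.ofBraided C)).f ▷ Z.1 ≫ (λ_ Z.1).hom :=
    congrArg (· ≫ _) (Center.associator_inv_f (X := Center.ofBraidedObj X)
      (Y := Center.ofBraidedObj Y) (Z := Z))
  exact h2.trans (congrArg (fun t => (α_ X Y Z.1).inv ≫ t ▷ Z.1 ≫ (λ_ Z.1).hom) this)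

/-- The contraction for the inverse braiding. -/
def contractionReverse {X Y : C} (e : X ⊗ Y ⟶ 𝟙_ C) (Z : Center C) :
    ofReverse X ⊗ (ofReverse Y ⊗ Z) ⟶ Z :=
  letI := reverseBraiding C
  contraction e Z

theorem contractionReverse_f {X Y : C} (e : X ⊗ Y ⟶ 𝟙_ C) (Z : Center C) :
    (contractionReverse e Z).f = (α_ X Y Z.1).inv ≫ e ▷ Z.1 ≫ (λ_ Z.1).hom :=
  letI := reverseBraiding C
  contraction_f e Z

end Contraction

end TensorExponent

end

/-! ### Half braidings and contractions on homogeneous tensors -/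

noncomputable section

namespace TensorExponent.TwistedDouble

variable {k : Type u} [Field k] {G : Type v} [Group G] [Fintype G] [DecidableEq G]
  {ω : NormalizedThreeCocycle G kˣ} {V W U P : FinRep k (TwistedDouble ω)}
  {X Y : Center (FinRep k (TwistedDouble ω))}

theorem halfLin_ofBraidedObj_tensor {d l m g g' : G} {p : P.carrier} {v v' : X.1.carrier}
    {w w' : W.carrier} (hp : IsHomog P d p) (hv : IsHomog X.1 l v) (hv' : IsHomog X.1 m v')
    (hw : IsHomog W g w) (hw' : IsHomog W g' w') (h : halfLin X W (v ⊗ₜ w) = w' ⊗ₜ v') :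
    halfLin (Center.ofBraidedObj P ⊗ X) W ((p ⊗ₜ[k] v) ⊗ₜ[k] w) =
      (((ω d l g)⁻¹ * ω d g' m * (ω (d * g' * d⁻¹) d m)⁻¹ : kˣ) : k) •
        (trans W d w' ⊗ₜ[k] (p ⊗ₜ[k] v')) := by
  change ((α_ P X.1 W).hom ≫ P ◁ (X.2.β W).hom ≫ (α_ P W X.1).inv ≫
    (β_ P W).hom ▷ X.1 ≫ (α_ W P X.1).hom).toLin ((p ⊗ₜ[k] v) ⊗ₜ[k] w) = _
  rw [FinRep.comp_apply, FinRep.comp_apply, FinRep.comp_apply, FinRep.comp_apply,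
    associator_hom_tmul hp hv hw, map_smul, FinRep.whiskerLeft_apply]
  have h1 : (X.2.β W).hom.toLin (v ⊗ₜ[k] w) = w' ⊗ₜ[k] v' := h
  rw [h1, map_smul, associator_inv_tmul hp hw' hv', map_smul, map_smul, map_smul,
    FinRep.whiskerRight_apply, braiding_hom_tmul hp, map_smul, associator_hom_tmul (hw'.trans d) hp hv',
    smul_smul, smul_smul, ← Units.val_mul, ← Units.val_mul, mul_assoc]

/-- The inverse braiding replaces p by its preimage p' under translation by the degree of w',
without moving w'. The braiding itself would translate w' instead. -/
theorem halfLin_ofReverse_tensor {d d' l m g g' : G} {p p' : P.carrier} {v v' : X.1.carrier}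
    {w w' : W.carrier} (hp : IsHomog P d p) (hp' : IsHomog P d' p') (hv : IsHomog X.1 l v)
    (hv' : IsHomog X.1 m v') (hw : IsHomog W g w) (hw' : IsHomog W g' w')
    (h : halfLin X W (v ⊗ₜ w) = w' ⊗ₜ v') (e : trans P g' p' = p) :
    halfLin (ofReverse P ⊗ X) W ((p ⊗ₜ[k] v) ⊗ₜ[k] w) =
      (((ω d l g)⁻¹ * ω d g' m * (ω g' d' m)⁻¹ : kˣ) : k) •
        (w' ⊗ₜ[k] (p' ⊗ₜ[k] v')) := by
  change ((α_ P X.1 W).hom ≫ P ◁ (X.2.β W).hom ≫ (α_ P W X.1).inv ≫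
    (β_ W P).inv ▷ X.1 ≫ (α_ W P X.1).hom).toLin ((p ⊗ₜ[k] v) ⊗ₜ[k] w) = _
  rw [FinRep.comp_apply, FinRep.comp_apply, FinRep.comp_apply, FinRep.comp_apply,
    associator_hom_tmul hp hv hw, map_smul, FinRep.whiskerLeft_apply]
  have h1 : (X.2.β W).hom.toLin (v ⊗ₜ[k] w) = w' ⊗ₜ[k] v' := h
  have h2 : (β_ W P).inv.toLin (p ⊗ₜ[k] w') = w' ⊗ₜ[k] p' := by
    rw [← e, braiding_inv_tmul hw']
  rw [h1, map_smul, associator_inv_tmul hp hw' hv', map_smul, map_smul, map_smul,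
    FinRep.whiskerRight_apply, h2, map_smul, associator_hom_tmul hw' hp' hv', smul_smul,
    smul_smul, ← Units.val_mul, ← Units.val_mul, mul_assoc]

theorem contraction_tmul {e : V ⊗ W ⟶ 𝟙_ _} {a b l : G} {v : V.carrier} {w : W.carrier}
    {x : X.1.carrier} (hv : IsHomog V a v) (hw : IsHomog W b w) (hx : IsHomog X.1 l x) :
    (contraction e X).f.toLin (v ⊗ₜ[k] (w ⊗ₜ[k] x)) =
      ((ω a b l : kˣ) : k) • (e.toLin (v ⊗ₜ[k] w) : k) • x := by
  rw [contraction_f]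
  change (λ_ X.1).hom.toLin ((e ▷ X.1).toLin ((α_ V W X.1).inv.toLin (v ⊗ₜ[k] (w ⊗ₜ[k] x)))) = _
  rw [associator_inv_tmul hv hw hx, map_smul, map_smul, FinRep.whiskerRight_apply]
  rfl

theorem contractionReverse_tmul {e : V ⊗ W ⟶ 𝟙_ _} {a b l : G} {v : V.carrier} {w : W.carrier}
    {x : X.1.carrier} (hv : IsHomog V a v) (hw : IsHomog W b w) (hx : IsHomog X.1 l x) :
    (contractionReverse e X).f.toLin (v ⊗ₜ[k] (w ⊗ₜ[k] x)) =
      ((ω a b l : kˣ) : k) • (e.toLin (v ⊗ₜ[k] w) : k) • x := by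
  rw [contractionReverse_f]
  change (λ_ X.1).hom.toLin ((e ▷ X.1).toLin ((α_ V W X.1).inv.toLin (v ⊗ₜ[k] (w ⊗ₜ[k] x)))) = _
  rw [associator_inv_tmul hv hw hx, map_smul, map_smul, FinRep.whiskerRight_apply]
  rfl

theorem exists_trans_regElt_tmul {l : G} {v : V.carrier} (hv : IsHomog V l v) (g x y : G) :
    ∃ c : k, trans (reg ω ⊗ V) y (regElt ω g x ⊗ₜ[k] v) =
      regElt ω (y * g * y⁻¹) (y * x) ⊗ₜ[k] (c • trans V y v) := by
  rw [trans_tmul (isHomog_regElt g x) hv, trans_regElt, ← TensorProduct.smul_tmul', smul_smul]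
  exact ⟨_, (TensorProduct.tmul_smul _ _ _).symm⟩

end TensorExponent.TwistedDouble

end

/-! ### Covering the objects of the center by mixed products; conclusion -/

noncomputable section

namespace TensorExponent.TwistedDouble

variable {k : Type u} [Field k] {G : Type v} [Group G] [Fintype G] [DecidableEq G]
  {ω : NormalizedThreeCocycle G kˣ} {V W U P : FinRep k (TwistedDouble ω)}
  {X Y : Center (FinRep k (TwistedDouble ω))}

theorem contraction_regElt_eq_zero {a g x l : G} (hx : x ≠ 1) {v : X.1.carrier}
    (hv : IsHomog X.1 l v) : (contraction (evalHom ω) X).f.toLin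
      (regElt ω a 1 ⊗ₜ[k] (regElt ω g x ⊗ₜ[k] v)) = 0 := by
  refine (contraction_tmul (isHomog_regElt a 1) (isHomog_regElt g x) hv).trans ?_
  have h : (evalHom ω).toLin (regElt ω a 1 ⊗ₜ[k] regElt ω g x) = (0 : k) :=
    (evalLin_regElt a 1 g x).trans (if_neg fun h => hx h.2.symm)
  rw [h, zero_smul, smul_zero]

theorem contractionReverse_regElt_eq_zero {a g x l : G} (hx : x ≠ 1) {v : X.1.carrier}
    (hv : IsHomog X.1 l v) : (contractionReverse (evalHom ω) X).f.toLin
      (regElt ω a 1 ⊗ₜ[k] (regElt ω g x ⊗ₜ[k] v)) = 0 := by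
  refine (contractionReverse_tmul (isHomog_regElt a 1) (isHomog_regElt g x) hv).trans ?_
  have h : (evalHom ω).toLin (regElt ω a 1 ⊗ₜ[k] regElt ω g x) = (0 : k) :=
    (evalLin_regElt a 1 g x).trans (if_neg fun h => hx h.2.symm)
  rw [h, zero_smul, smul_zero]

theorem evalHom_regElt_inv (a : G) :
    (evalHom ω).toLin (regElt ω a 1 ⊗ₜ[k] regElt ω a⁻¹ 1) = (1 : k) := by
  refine (evalLin_regElt a 1 a⁻¹ 1).trans ?_
  simp [gamma, ω.map_one_left, ω.map_one_middle, ω.map_one_right]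

theorem contraction_regElt_inv {a l : G} {v : X.1.carrier}
    (hv : IsHomog X.1 l v) : (contraction (evalHom ω) X).f.toLin
      (regElt ω a 1 ⊗ₜ[k] (regElt ω a⁻¹ 1 ⊗ₜ[k] v)) = ((ω a a⁻¹ l : kˣ) : k) • v := by
  refine (contraction_tmul (isHomog_regElt a 1) (isHomog_regElt a⁻¹ 1) hv).trans ?_
  rw [evalHom_regElt_inv, one_smul]

theorem contractionReverse_regElt_inv {a l : G} {v : X.1.carrier}
    (hv : IsHomog X.1 l v) : (contractionReverse (evalHom ω) X).f.toLin
      (regElt ω a 1 ⊗ₜ[k] (regElt ω a⁻¹ 1 ⊗ₜ[k] v)) = ((ω a a⁻¹ l : kˣ) : k) • v := by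
  refine (contractionReverse_tmul (isHomog_regElt a 1) (isHomog_regElt a⁻¹ 1) hv).trans ?_
  rw [evalHom_regElt_inv, one_smul]

section Cover

variable {a l : G} {v : X.1.carrier}

/-- The tensor product of a vector of an object `X` of the center with vectors of the images in the
center of the regular representation under the two braidings. -/
def coverVec (a b : G) (v : X.1.carrier) :
    (ofReverse (reg ω) ⊗ (Center.ofBraidedObj (reg ω) ⊗ X)).1.carrier :=
  regElt ω b⁻¹ 1 ⊗ₜ[k] (regElt ω a⁻¹ 1 ⊗ₜ[k] v)

/-- The second degree is b = a⁻¹l so that b⁻¹a⁻¹l = 1 and averaging applies. -/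
theorem isHomog_coverVec (hv : IsHomog X.1 l v) (a : G) :
    IsHomog (ofReverse (reg ω) ⊗ (Center.ofBraidedObj (reg ω) ⊗ X)).1 1
      (coverVec a (a⁻¹ * l) v) := by
  have h := (isHomog_regElt (ω := ω) (a⁻¹ * l)⁻¹ 1).tmul ((isHomog_regElt (ω := ω) a⁻¹ 1).tmul hv)
  rwa [inv_mul_cancel] at h

/-- On e_g # 1 the half braiding of X produces e_{aga⁻¹} # a, since v lies in the component a. The
braiding with the vector of degree a⁻¹ translates this back to e_g # 1, and the inverse braiding
then marks the first factor with g⁻¹, so that contraction can detect g = 1. -/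
theorem exists_halfOp_coverVec (hv : IsHomog X.1 l v)
    (h : ∀ x, halfOp X 1 x v = if x = a then v else 0) (b g : G) :
    ∃ c : kˣ, halfOp (ofReverse (reg ω) ⊗ (Center.ofBraidedObj (reg ω) ⊗ X)) g 1
      (coverVec a b v) = regElt ω (g⁻¹ * b⁻¹ * g) g⁻¹ ⊗ₜ[k] (regElt ω a⁻¹ 1 ⊗ₜ[k]
        ((c : k) • halfOp X (a * g * a⁻¹) a v)) := by
  have hw := isHomog_regElt (ω := ω) g 1
  have hw1 := isHomog_regElt (ω := ω) (a * g * a⁻¹) a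
  have hv1 := isHomog_halfOp hv g a
  have hp := isHomog_regElt (ω := ω) a⁻¹ 1
  have hq := isHomog_regElt (ω := ω) b⁻¹ 1
  have hX : halfLin X (reg ω) (v ⊗ₜ regElt ω g 1) =
      regElt ω (a * g * a⁻¹) a ⊗ₜ halfOp X (a * g * a⁻¹) a v := by
    rw [halfLin_tmul_homog v hw, Finset.sum_eq_single a, trans_regElt_one]
    · intro x _ hx
      rw [halfOp_eq_zero hv h hx, TensorProduct.tmul_zero]
    · simp
  have hY := halfLin_ofBraidedObj_tensor hp hv hv1 hw hw1 hX
  have e1 : a⁻¹ * (a * g * a⁻¹) * a⁻¹⁻¹ = g := by group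
  rw [trans_regElt, inv_mul_cancel, e1, ← TensorProduct.smul_tmul', smul_smul, ← Units.val_mul,
    ← TensorProduct.tmul_smul, ← TensorProduct.tmul_smul] at hY
  set s : kˣ := _ * theta ω g a⁻¹ a
  have hv2 := hv1.smul (s : k)
  have hq' := (isHomog_regElt (ω := ω) (g⁻¹ * b⁻¹ * g) g⁻¹).smul
    (((theta ω b⁻¹ g g⁻¹)⁻¹ : kˣ) : k)
  have e2 : g * (g⁻¹ * b⁻¹ * g) * g⁻¹ = b⁻¹ := by group
  have e3 : trans (reg ω) g ((((theta ω b⁻¹ g g⁻¹)⁻¹ : kˣ) : k) •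
      regElt ω (g⁻¹ * b⁻¹ * g) g⁻¹) = regElt ω b⁻¹ 1 := by
    rw [map_smul, trans_regElt, e2, mul_inv_cancel, smul_smul, ← Units.val_mul, inv_mul_cancel,
      Units.val_one, one_smul]
  have hZ := halfLin_ofReverse_tensor (X := Center.ofBraidedObj (reg ω) ⊗ X) hq hq' (hp.tmul hv)
    (hp.tmul hv2) hw hw hY e3
  have pull (c d e : kˣ) (w q p : (reg ω).carrier) (u : X.1.carrier) :
      (c : k) • (w ⊗ₜ[k] (((d : k) • q) ⊗ₜ[k] (p ⊗ₜ[k] ((e : k) • u)))) =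
        w ⊗ₜ[k] (q ⊗ₜ[k] (p ⊗ₜ[k] (((c * (e * d) : kˣ) : k) • u))) := by
    simp only [TensorProduct.tmul_smul, ← TensorProduct.smul_tmul', smul_smul, Units.val_mul]
  have key := tcoord_halfLin
    (X := ofReverse (reg ω) ⊗ (Center.ofBraidedObj (reg ω) ⊗ X)) (coverVec a b v) g 1
  rw [one_mul, inv_one, mul_one] at key
  have key2 := (key.symm.trans (congrArg (tcoord _ g 1) (hZ.trans (pull _ _ _ _ _ _ _)))).trans
    (tcoord_tmul _ _ _ _)
  rw [regCoord_regElt, if_pos ⟨rfl, rfl⟩] at key2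
  exact ⟨_, key2.trans (one_smul k _)⟩

/-- The morphism to `X` defined by averaging and contracting. -/
def coverHom (hv : IsHomog X.1 l v) (a : G) :
    Center.ofBraidedObj (reg ω) ⊗ ofReverse (reg ω) ⟶ X :=
  _ ◁ ((ρ_ _).inv ≫ _ ◁ averageHom (isHomog_coverVec hv a) ≫
    contractionReverse (evalHom ω) (Center.ofBraidedObj (reg ω) ⊗ X)) ≫
      contraction (evalHom ω) X

theorem coverHom_tmul (hv : IsHomog X.1 l v) (a : G) (r s : (reg ω).carrier) :
    (coverHom hv a).f.toLin (r ⊗ₜ[k] s) = (contraction (evalHom ω) X).f.toLin (r ⊗ₜ[k]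
      (contractionReverse (evalHom ω) (Center.ofBraidedObj (reg ω) ⊗ X)).f.toLin
        (s ⊗ₜ[k] average _ (coverVec a (a⁻¹ * l) v))) := by
  have h1 : (averageHom (isHomog_coverVec hv a)).f.toLin (1 : k) =
    average _ (coverVec a (a⁻¹ * l) v) := by
    rw [averageHom_apply, one_smul]
  have h2 : (coverHom hv a).f = reg ω ◁ ((ρ_ (reg ω)).inv ≫
      reg ω ◁ (averageHom (isHomog_coverVec hv a)).f ≫
        (contractionReverse (evalHom ω) (Center.ofBraidedObj (reg ω) ⊗ X)).f) ≫
          (contraction (evalHom ω) X).f :=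
    congrArg (fun t => reg ω ◁ (t ≫ _) ≫ _) (Center.rightUnitor_inv_f (ofReverse (reg ω)))
  rw [← h1]
  exact congrArg (fun t => FinRep.Hom.toLin t (r ⊗ₜ[k] s)) h2

/-- The pairing with e_a # 1 or e_b # 1 vanishes unless the group component is 1. In the average
only the term x = g = 1 survives, and it is a product of units times v. -/
theorem exists_coverHom_eq (hv : IsHomog X.1 l v)
    (h : ∀ x, halfOp X 1 x v = if x = a then v else 0) :
    ∃ c : kˣ, (coverHom hv a).f.toLin (regElt ω a 1 ⊗ₜ[k] regElt ω (a⁻¹ * l) 1) = (c : k) • v := by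
  set b := a⁻¹ * l with hb
  let K : (reg ω).carrier ⊗[k] X.1.carrier →ₗ[k] X.1.carrier :=
    (contraction (evalHom ω) X).f.toLin ∘ₗ
      TensorProduct.mk k (reg ω).carrier ((reg ω).carrier ⊗[k] X.1.carrier) (regElt ω a 1)
  let F : (ofReverse (reg ω) ⊗ (Center.ofBraidedObj (reg ω) ⊗ X)).1.carrier →ₗ[k] X.1.carrier :=
    K ∘ₗ (contractionReverse (evalHom ω) (Center.ofBraidedObj (reg ω) ⊗ X)).f.toLin ∘ₗ
      TensorProduct.mk k (reg ω).carrier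
        ((reg ω).carrier ⊗[k] ((reg ω).carrier ⊗[k] X.1.carrier)) (regElt ω b 1)
  choose c hc using exists_halfOp_coverVec hv h b
  have hu (g : G) := (isHomog_halfOp hv g a).smul (c g : k)
  have hp := isHomog_regElt (ω := ω) a⁻¹ 1
  refine ⟨c 1 * ω b b⁻¹ (a⁻¹ * l) * ω a a⁻¹ l, ?_⟩
  rw [coverHom_tmul]
  change F (average _ _) = _
  rw [average, map_sum, Finset.sum_eq_single 1, map_sum, Finset.sum_eq_single 1]
  · have h1 : halfOp X (a * 1 * a⁻¹) a v = v := by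
      rw [mul_one, mul_inv_cancel, h, if_pos rfl]
    have hv1 := hv.smul (c 1 : k)
    rw [trans_one, LinearMap.id_apply, hc, h1, inv_one, one_mul, mul_one]
    have h2 := contractionReverse_regElt_inv (X := Center.ofBraidedObj (reg ω) ⊗ X) (a := b)
      (hp.tmul hv1)
    refine (congrArg K h2).trans ?_
    refine ((K.map_smul _ _).trans (congrArg _ (contraction_regElt_inv hv1))).trans ?_
    rw [smul_smul, smul_smul,
      ← Units.val_mul, ← Units.val_mul]
    congr 2
    ac_rfl
  -- For x = 1 and g ≠ 1 the outer factor has group component g⁻¹ and is killed.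
  · intro g _ hg
    rw [trans_one, LinearMap.id_apply, hc]
    have h2 := contractionReverse_regElt_eq_zero (X := Center.ofBraidedObj (reg ω) ⊗ X) (a := b)
      (g := g⁻¹ * b⁻¹ * g) (inv_ne_one.mpr hg) (hp.tmul (hu g))
    exact (congrArg K h2).trans (map_zero K)
  · simp
  -- For x ≠ 1 translation gives the inner factor the group component x; the second contraction
  -- kills it.
  · intro x _ hx
    rw [map_sum]
    refine Finset.sum_eq_zero fun g _ => ?_
    rw [hc]
    obtain ⟨d, hd⟩ := exists_trans_regElt_tmul (V := reg ω ⊗ X.1) (hp.tmul (hu g))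
      (g⁻¹ * b⁻¹ * g) g⁻¹ x
    obtain ⟨d', hd'⟩ := exists_trans_regElt_tmul (hu g) a⁻¹ 1 x
    have hu' := (hu g).trans x
    rw [hd', mul_one, ← TensorProduct.tmul_smul] at hd
    have hs := (isHomog_regElt (ω := ω) (x * a⁻¹ * x⁻¹) x).tmul ((hu'.smul d').smul d)
    have h2 := contractionReverse_tmul (X := Center.ofBraidedObj (reg ω) ⊗ X) (e := evalHom ω)
      (isHomog_regElt b 1)
      (isHomog_regElt (x * (g⁻¹ * b⁻¹ * g) * x⁻¹) (x * g⁻¹)) hs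
    have h3 := (congrArg (fun t => (contractionReverse (evalHom ω)
      (Center.ofBraidedObj (reg ω) ⊗ X)).f.toLin (regElt ω b 1 ⊗ₜ[k] t)) hd).trans h2
    have h4 := contraction_regElt_eq_zero (a := a) (g := x * a⁻¹ * x⁻¹) hx
      ((hu'.smul d').smul d)
    refine (congrArg K h3).trans ((K.map_smul _ _).trans ?_)
    refine (congrArg _ ((K.map_smul _ _).trans (congrArg _ h4))).trans ?_
    rw [smul_zero, smul_zero]
  · simp

end Cover

section Span

/-- These operators determine the half braiding on v ⊗ (e₁ # 1), and the half braiding is injective.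
-/
theorem eq_zero_of_halfOp_one {v : X.1.carrier}
    (h : ∀ x, halfOp X 1 x v = 0) : v = 0 := by
  have h1 : halfLin X (reg ω) (v ⊗ₜ regElt ω 1 1) = 0 := by
    rw [halfLin_tmul_homog v (isHomog_regElt 1 1)]
    refine Finset.sum_eq_zero fun x _ => ?_
    rw [mul_one, mul_inv_cancel, h, TensorProduct.tmul_zero]
  have h2 : v ⊗ₜ[k] regElt ω 1 1 = 0 := by
    have := FinRep.hom_inv_apply (X.2.β (reg ω)) (v ⊗ₜ[k] regElt ω 1 1)
    refine this.symm.trans ?_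
    exact (congrArg (X.2.β (reg ω)).inv.toLin h1).trans (map_zero _)
  have h3 := congrArg (TensorProduct.rid k X.1.carrier ∘
    TensorProduct.map LinearMap.id (regCoord ω 1 1)) h2
  simpa [regCoord_regElt] using h3

theorem sum_halfOp_one {l : G} {v : X.1.carrier} (hv : IsHomog X.1 l v) :
    ∑ a, halfOp X 1 a v = v := by
  refine (sub_eq_zero.mp (eq_zero_of_halfOp_one (X := X) fun x => ?_)).symm
  rw [map_sub, map_sum, Finset.sum_congr rfl fun a _ => halfOp_halfOp_one hv 1 a x]
  simp

/-- Every object of the center is spanned by the images of morphisms from the tensor product of the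
images of the regular representation under the two braidings. -/
theorem span_range_hom (X : Center (FinRep k (TwistedDouble ω))) :
    Submodule.span k {v : X.1.carrier |
      ∃ (f : Center.ofBraidedObj (reg ω) ⊗ ofReverse (reg ω) ⟶ X) (t : _), f.f.toLin t = v} =
        ⊤ := by
  refine eq_top_iff.mpr fun v _ => ?_
  rw [← sum_proj X.1 v]
  refine Submodule.sum_mem _ fun l _ => ?_
  have hl := isHomog_proj X.1 l v
  rw [← sum_halfOp_one hl]
  refine Submodule.sum_mem _ fun a _ => ?_
  have ha : IsHomog X.1 l (halfOp X 1 a (proj X.1 l v)) := by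
    simpa using isHomog_halfOp hl 1 a
  -- By orthogonality, the projection to component a of a homogeneous vector satisfies the
  -- hypothesis on v.
  obtain ⟨c, hc⟩ := exists_coverHom_eq (a := a) ha fun x => by
    rw [halfOp_halfOp_one hl]
    simp only [eq_comm]
    split_ifs with e
    · rw [e]
    · rfl
  have : halfOp X 1 a (proj X.1 l v) =
      ((c⁻¹ : kˣ) : k) • ((c : k) • halfOp X 1 a (proj X.1 l v)) := by
    rw [smul_smul, ← Units.val_mul, inv_mul_cancel, Units.val_one, one_smul]
  rw [this, ← hc]
  exact Submodule.smul_mem _ _ (Submodule.subset_span ⟨_, _, rfl⟩)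

theorem hom_ext_of_span {A : FinRep k (TwistedDouble ω)} {f g : X.1 ⊗ Y.1 ⟶ A}
    (h : ∀ (p : Center.ofBraidedObj (reg ω) ⊗ ofReverse (reg ω) ⟶ X)
      (q : Center.ofBraidedObj (reg ω) ⊗ ofReverse (reg ω) ⟶ Y),
        (p.f ⊗ₘ q.f) ≫ f = (p.f ⊗ₘ q.f) ≫ g) : f = g := by
  apply FinRep.hom_ext
  apply TensorProduct.ext
  refine LinearMap.ext_on (span_range_hom X) ?_
  rintro _ ⟨p, s, rfl⟩
  refine LinearMap.ext_on (span_range_hom Y) ?_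
  rintro _ ⟨q, t, rfl⟩
  exact congrArg (fun F => FinRep.Hom.toLin F (s ⊗ₜ[k] t)) (h p q)

end Span

theorem braidSq_pow_card_eq_one (h : ∀ g, cyclicProd ω (Fintype.card G) g = 1)
    (V W : FinRep k (TwistedDouble ω)) : braidSq V W ^ Fintype.card G = 1 := by
  apply FinRep.hom_ext
  refine tensor_ext_homog fun g g' v w hv hw => ?_
  refine (braidSq_pow_card hv hw).trans ?_
  rw [h, h, h]
  simp

/-- Naturality along pairs of morphisms from the mixed product to X and Y moves the computation to
mixed products, and the images of these morphisms span. -/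
theorem doubleBraiding_pow_card_eq_one (h : ∀ g, cyclicProd ω (Fintype.card G) g = 1)
    (X Y : Center (FinRep k (TwistedDouble ω))) : doubleBraiding X Y ^ Fintype.card G = 1 := by
  rw [doubleBraiding_pow]
  refine hom_ext_of_span fun p q => ?_
  have key := comp_pow_eq (braidSq_naturality p q) (Fintype.card G)
  rw [braidSq_mixed_pow (braidSq_pow_card_eq_one h)] at key
  have := congrArg Center.Hom.f key
  refine this.trans ?_
  change 𝟙 _ ≫ (p.f ⊗ₘ q.f) = (p.f ⊗ₘ q.f) ≫ 𝟙 _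
  simp

theorem exp_dvd_card (h : ∀ g, cyclicProd ω (Fintype.card G) g = 1) :
    exp ω ∣ Fintype.card G := by
  refine (exponent_dvd_iff _ Fintype.card_pos).mpr fun X Y => ?_
  rw [doubleBraiding_pow_card_eq_one h, sub_self]
  exact IsNilpotent.zero

end TensorExponent.TwistedDouble

end

theorem mainTheorem6 {k : Type u} [Field k] [IsAlgClosed k] [CharZero k]
    {G : Type v} [Group G] [Fintype G] [DecidableEq G]
    (ω : TensorExponent.NormalizedThreeCocycle G kˣ) :
    ((∀ g : G, TensorExponent.cohomologicalOrder
        (TensorExponent.restrictCocycle ω.toCocycle (Subgroup.zpowers g)) ∣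
          (Subgroup.zpowers g).index) →
      TensorExponent.TwistedDouble.exp ω ∣ Fintype.card G) ∧
    (Odd (Fintype.card G) →
      ((∀ g : G, TensorExponent.cohomologicalOrder
          (TensorExponent.restrictCocycle ω.toCocycle (Subgroup.zpowers g)) ∣
            (Subgroup.zpowers g).index) ↔
        TensorExponent.TwistedDouble.exp ω ∣ Fintype.card G)) := by
  have key : (∀ g : G, TensorExponent.cohomologicalOrder
      (TensorExponent.restrictCocycle ω.toCocycle (Subgroup.zpowers g)) ∣
        (Subgroup.zpowers g).index) →
      TensorExponent.TwistedDouble.exp ω ∣ Fintype.card G := fun h =>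
    TensorExponent.TwistedDouble.exp_dvd_card fun g =>
      (TensorExponent.cohomologicalOrder_dvd_index_iff ω g).mp (h g)
  refine ⟨key, fun hodd => ⟨key, fun h g => ?_⟩⟩
  exact (TensorExponent.cohomologicalOrder_dvd_index_iff ω g).mpr
    (TensorExponent.TwistedDouble.cyclicProd_eq_one_of_odd hodd
      ((TensorExponent.exponent_dvd_iff _ Fintype.card_pos).mp h) g)
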